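/- **Model.** Fix finite sets $L$ (control locations), $\Sigma$ (input alphabet), $\Gamma$ (stack alphabet), $X$ (global clocks), $Z$ (stack clocks, disjoint from $X$). A *clock constraint* over a set $C$ of clocks is a boolean combination of atoms that are *integer* ($\lfloor x\rfloor\le k$, $\lfloor x\rfloor-\lfloor y\rfloor\le k$), *modular* ($\lfloor x\rfloor\equiv_m k$, $\lfloor x\rfloor-\lfloor y\rfloor\equiv_m k$) or *fractional* ($\{x\}=0$, $\{x\}\le\{y\}$), where $x,y\in C$, $k\in\mathbb Z$, $m\ge 1$, and $\{\cdot\}$ is the fractional part. A *timed pushdown automaton* (TPDA) $\mathcal P=(\Sigma,\Gamma,L,X,Z,\Delta)$ has finitely many rules $(\ell,\mathsf{op},r)\in\Delta$ with $\ell,r\in L$, where $\mathsf{op}$ is one of: time elapse; input of a letter of $\Sigma$ or of $\varepsilon$; a test of a constraint over $X$; a reset of a set $Y\subseteq X$; $\mathsf{push}(\gamma,\psi)$ or $\mathsf{pop}(\gamma,\psi)$ with $\gamma\in\Gamma$ and $\psi$ a constraint over $X\cup Z$ each of whose atoms mentions some clock of $Z$. A configuration consists of a location, a valuation $\mu\in\mathbb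 Q_{\ge 0}^X$ and a stack in $(\Gamma\times\mathbb Q_{\ge 0}^Z)^*$. Time elapse adds some $\delta\in\mathbb Q_{\ge0}$ to all global clocks and to all clocks on the stack; $\mathsf{push}(\gamma,\psi)$ puts on top some $(\gamma,\mu_1)$ with $(\mu,\mu_1)\models\psi$; $\mathsf{pop}(\gamma,\psi)$ removes the top element $(\gamma,\mu_1)$ provided $(\mu,\mu_1)\models\psi$; the other operations are as usual. For $\ell,r\in L$, $\mu,\nu\in\mathbb Q_{\ge 0}^X$, $\pi\in\mathbb N^\Sigma$, write $\mu\xrightarrow{\pi}_{\ell r}\nu$ if some run leads from $(\ell,\mu,\varepsilon)$ to $(r,\nu,\varepsilon)$ (empty stack at both ends) and reads every $a\in\Sigma$ exactly $\pi(a)$ times. Let $\mathcal L_{\mathbb Z,\mathbb Q}$ be two-sorted first-order linear arithmetic over $(\mathbb Z,\le,(\equiv_m)_{m\ge 1},+,(k)_{k\in\mathbb Z})$ and $(\mathbb Q,\le,+,(q)_{q\in\mathbb Q})$. A family $\{\varphi_{\ell r}\}_{\ell,r\in L}$ of $\mathcal L_{\mathbb Z,\mathbb Q}$-formulas *expresses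 the reachability relation* of $\mathcal P$ if for all $\ell,r,\mu,\pi,\nu$: $\mu\xrightarrow{\pi}_{\ell r}\nu$ iff $(\lfloor\mu\rfloor,\{\mu\},\pi,\lfloor\nu\rfloor,\{\nu\})\models\varphi_{\ell r}$. A TPDA is *push-copy* if it has exactly one stack clock $z_x$ for each global clock $x$ and its only push constraint is $\bigwedge_{x\in X}\lfloor z_x\rfloor=\lfloor x\rfloor\wedge\{z_x\}=\{x\}$; it is *pop-integer-free* if its pop constraints contain no integer atoms; it is *fractional* if all its (test, push and pop) constraints contain only fractional atoms. A computable map $T$ *effectively reduces* a class $\mathcal A$ of TPDA to a class $\mathcal B$ if $T(\mathcal P)\in\mathcal B$ for all $\mathcal P\in\mathcal A$, and there is a computable function which, given any $\mathcal P\in\mathcal A$ and any family of $\mathcal L_{\mathbb Z,\mathbb Q}$-formulas expressing the reachability relation of $T(\mathcal P)$, returns a family of $\mathcal L_{\mathbb Z,\mathbb Q}$-formulas expressing the reachability relation of $\mathcal P$. **Theorem.** There are computable maps $T_1,T_2,T_3$ on TPDA such that $T_1$ effectively reduces all TPDA to push-copy TPDA, $T_2$ effectively reduces push-copy TPDA to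 push-copy and pop-integer-free TPDA, $T_3$ effectively reduces push-copy and pop-integer-free TPDA to fractional TPDA, and hence $T=T_3\circ T_2\circ T_1$ effectively reduces all TPDA to fractional TPDA. Moreover there is a polynomial $p$ such that for every TPDA $\mathcal P$, writing $|\mathcal P|$ for its size (constants in binary), $\mathcal Q=T(\mathcal P)$ has at most $2^{2^{p(|\mathcal P|)}}$ control locations, at most $2^{2^{p(|\mathcal P|)}}$ stack symbols, and at most $2^{p(|\mathcal P|)}$ clocks (global and stack clocks together). -/

import Mathlib

namespace TPDA

/-! ## Boolean combinations, linear terms and formulas of linear arithmetic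

All finite objects are given with an explicit bijective numbering, so that the notion of a
computable function (`Computable`) applies to them. -/

/-- Boolean combinations of atoms from `α`. -/
inductive BoolComb (α : Type) : Type
  | tru : BoolComb α
  | atom (a : α) : BoolComb α
  | not (φ : BoolComb α) : BoolComb α
  | and (φ ψ : BoolComb α) : BoolComb α
  | or (φ ψ : BoolComb α) : BoolComb α

namespace BoolComb

variable {α : Type}

/-- Truth of a boolean combination under an interpretation of the atoms. -/
def Sat (s : α → Prop) : BoolComb α → Prop
  | tru => True
  | atom a => s a
  | not φ => ¬ φ.Sat s
  | and φ ψ => φ.Sat s ∧ ψ.Sat s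
  | or φ ψ => φ.Sat s ∨ ψ.Sat s

/-- The list of atoms occurring in a boolean combination. -/
def atoms : BoolComb α → List α
  | tru => []
  | atom a => [a]
  | not φ => φ.atoms
  | and φ ψ => φ.atoms ++ ψ.atoms
  | or φ ψ => φ.atoms ++ ψ.atoms

/-- Syntactic size, given the sizes of the atoms. -/
def size (s : α → ℕ) : BoolComb α → ℕ
  | tru => 1
  | atom a => s a
  | not φ => φ.size s + 1
  | and φ ψ => φ.size s + ψ.size s + 1
  | or φ ψ => φ.size s + ψ.size s + 1

/-- Conjunction of a list. -/
def conj : List (BoolComb α) → BoolComb α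
  | [] => tru
  | φ :: l => and φ (conj l)

def toCode [Denumerable α] : BoolComb α → ℕ
  | tru => 0
  | atom a => 4 * Encodable.encode a + 1
  | not φ => 4 * φ.toCode + 2
  | and φ ψ => 4 * Nat.pair φ.toCode ψ.toCode + 3
  | or φ ψ => 4 * Nat.pair φ.toCode ψ.toCode + 4

def ofCode [Denumerable α] : ℕ → BoolComb α
  | 0 => tru
  | n + 1 =>
    have h0 : n / 4 < n + 1 := by omega
    have h1 : (n / 4).unpair.1 < n + 1 := lt_of_le_of_lt (Nat.unpair_left_le _) h0
    have h2 : (n / 4).unpair.2 < n + 1 := lt_of_le_of_lt (Nat.unpair_right_le _) h0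
    if n % 4 = 0 then atom (Denumerable.ofNat α (n / 4))
    else if n % 4 = 1 then not (ofCode (n / 4))
    else if n % 4 = 2 then and (ofCode (n / 4).unpair.1) (ofCode (n / 4).unpair.2)
    else or (ofCode (n / 4).unpair.1) (ofCode (n / 4).unpair.2)

theorem ofCode_toCode [Denumerable α] (φ : BoolComb α) : ofCode φ.toCode = φ := by
  have e1 : ∀ k, (4 * k + 1) / 4 = k := by omega
  have e2 : ∀ k, (4 * k + 2) / 4 = k := by omega
  have e3 : ∀ k, (4 * k + 3) / 4 = k := by omega
  have m1 : ∀ k, (4 * k + 1) % 4 = 1 := by omega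
  have m2 : ∀ k, (4 * k + 2) % 4 = 2 := by omega
  have m3 : ∀ k, (4 * k + 3) % 4 = 3 := by omega
  induction φ <;> simp [toCode, ofCode, *]

theorem toCode_ofCode [Denumerable α] : ∀ n, (ofCode n : BoolComb α).toCode = n
  | 0 => by simp [ofCode, toCode]
  | n + 1 => by
    have h0 : n / 4 < n + 1 := by omega
    have h1 : (n / 4).unpair.1 < n + 1 := lt_of_le_of_lt (Nat.unpair_left_le _) h0
    have h2 : (n / 4).unpair.2 < n + 1 := lt_of_le_of_lt (Nat.unpair_right_le _) h0
    have i0 := toCode_ofCode (n / 4)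
    have i1 := toCode_ofCode (n / 4).unpair.1
    have i2 := toCode_ofCode (n / 4).unpair.2
    rw [ofCode]
    split_ifs <;> simp [toCode, i0, i1, i2] <;> omega

instance instDenumerable [Denumerable α] : Denumerable (BoolComb α) :=
  Denumerable.mk' ⟨toCode, ofCode, ofCode_toCode, toCode_ofCode⟩

end BoolComb

/-- Linear terms: variables (numbered by `ℕ`), constants from `K`, and binary addition. -/
inductive LinTerm (K : Type) : Type
  | var (i : ℕ) : LinTerm K
  | const (k : K) : LinTerm K
  | add (s t : LinTerm K) : LinTerm K

namespace LinTerm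

variable {K : Type}

/-- Value of a term; variable `i` denotes the `i`-th entry of the environment. -/
def eval {R : Type} [AddMonoid R] (c : K → R) (ρ : List R) : LinTerm K → R
  | var i => ρ.getD i 0
  | const k => c k
  | add s t => s.eval c ρ + t.eval c ρ

/-- All variables of the term are among the first `n`. -/
def Scoped (n : ℕ) : LinTerm K → Prop
  | var i => i < n
  | const _ => True
  | add s t => s.Scoped n ∧ t.Scoped n

def toCode [Denumerable K] : LinTerm K → ℕ
  | var i => 3 * i
  | const k => 3 * Encodable.encode k + 1
  | add s t => 3 * Nat.pair s.toCode t.toCode + 2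

def ofCode [Denumerable K] (n : ℕ) : LinTerm K :=
  if _ha : n % 3 = 0 then var (n / 3)
  else if _hb : n % 3 = 1 then const (Denumerable.ofNat K (n / 3))
  else
    have h0 : n / 3 < n := by omega
    have h1 : (n / 3).unpair.1 < n := lt_of_le_of_lt (Nat.unpair_left_le _) h0
    have h2 : (n / 3).unpair.2 < n := lt_of_le_of_lt (Nat.unpair_right_le _) h0
    add (ofCode (n / 3).unpair.1) (ofCode (n / 3).unpair.2)
termination_by n

theorem ofCode_toCode [Denumerable K] (t : LinTerm K) : ofCode t.toCode = t := by
  have e1 : ∀ k, (3 * k + 1) / 3 = k := by omega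
  have e2 : ∀ k, (3 * k + 2) / 3 = k := by omega
  have m1 : ∀ k, (3 * k + 1) % 3 = 1 := by omega
  have m2 : ∀ k, (3 * k + 2) % 3 = 2 := by omega
  induction t <;> rw [toCode, ofCode] <;> simp [*]

theorem toCode_ofCode [Denumerable K] (n : ℕ) : (ofCode n : LinTerm K).toCode = n := by
  induction n using Nat.strong_induction_on with
  | _ n ih =>
    rw [ofCode]
    split_ifs with a b
    · simp only [toCode]; omega
    · simp only [toCode, Denumerable.encode_ofNat]; omega
    · have h0 : n / 3 < n := by omega
      have h1 : (n / 3).unpair.1 < n := lt_of_le_of_lt (Nat.unpair_left_le _) h0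
      have h2 : (n / 3).unpair.2 < n := lt_of_le_of_lt (Nat.unpair_right_le _) h0
      simp only [toCode, ih _ h1, ih _ h2, Nat.pair_unpair]; omega

instance instDenumerable [Denumerable K] : Denumerable (LinTerm K) :=
  Denumerable.mk' ⟨toCode, ofCode, ofCode_toCode, toCode_ofCode⟩

end LinTerm

/-- Formulas of two-sorted linear arithmetic over `(ℤ, ≤, ≡ₘ, +, constants)` and
`(ℚ, ≤, +, constants)`. A rational constant `(a, b)` stands for `a / b`. Variables of each sort are
de Bruijn indices: a quantifier binds index `0` of its sort. Equality, disjunction and universal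
quantification are the usual abbreviations. -/
inductive Formula : Type
  | zle (s t : LinTerm ℤ) : Formula
  | zmod (m : ℕ+) (s t : LinTerm ℤ) : Formula
  | qle (s t : LinTerm (ℤ × ℕ+)) : Formula
  | not (φ : Formula) : Formula
  | and (φ ψ : Formula) : Formula
  | exZ (φ : Formula) : Formula
  | exQ (φ : Formula) : Formula

namespace Formula

/-- Satisfaction in the standard structure, for given values of the integer variables (`ρ`) and
of the rational variables (`σ`). -/
def Sat : Formula → List ℤ → List ℚ → Prop
  | zle s t, ρ, _ => s.eval id ρ ≤ t.eval id ρ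
  | zmod m s t, ρ, _ => s.eval id ρ ≡ t.eval id ρ [ZMOD (m : ℕ)]
  | qle s t, _, σ =>
      s.eval (fun c => (c.1 : ℚ) / ((c.2 : ℕ) : ℚ)) σ ≤ t.eval (fun c => (c.1 : ℚ) / ((c.2 : ℕ) : ℚ)) σ
  | not φ, ρ, σ => ¬ φ.Sat ρ σ
  | and φ ψ, ρ, σ => φ.Sat ρ σ ∧ ψ.Sat ρ σ
  | exZ φ, ρ, σ => ∃ k : ℤ, φ.Sat (k :: ρ) σ
  | exQ φ, ρ, σ => ∃ q : ℚ, φ.Sat ρ (q :: σ)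

/-- The free variables are among the first `n` integer and the first `k` rational variables. -/
def Scoped : Formula → ℕ → ℕ → Prop
  | zle s t, n, _ => s.Scoped n ∧ t.Scoped n
  | zmod _ s t, n, _ => s.Scoped n ∧ t.Scoped n
  | qle s t, _, k => s.Scoped k ∧ t.Scoped k
  | not φ, n, k => φ.Scoped n k
  | and φ ψ, n, k => φ.Scoped n k ∧ ψ.Scoped n k
  | exZ φ, n, k => φ.Scoped (n + 1) k
  | exQ φ, n, k => φ.Scoped n (k + 1)

def toCode : Formula → ℕ
  | zle s t => 7 * Encodable.encode (s, t)
  | zmod m s t => 7 * Encodable.encode (m, s, t) + 1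
  | qle s t => 7 * Encodable.encode (s, t) + 2
  | not φ => 7 * φ.toCode + 3
  | and φ ψ => 7 * Nat.pair φ.toCode ψ.toCode + 4
  | exZ φ => 7 * φ.toCode + 5
  | exQ φ => 7 * φ.toCode + 6

def ofCode (n : ℕ) : Formula :=
  if _ha : n % 7 = 0 then
    let d := Denumerable.ofNat (LinTerm ℤ × LinTerm ℤ) (n / 7)
    zle d.1 d.2
  else if _hb : n % 7 = 1 then
    let d := Denumerable.ofNat (ℕ+ × LinTerm ℤ × LinTerm ℤ) (n / 7)
    zmod d.1 d.2.1 d.2.2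
  else if _hc : n % 7 = 2 then
    let d := Denumerable.ofNat (LinTerm (ℤ × ℕ+) × LinTerm (ℤ × ℕ+)) (n / 7)
    qle d.1 d.2
  else
    have h0 : n / 7 < n := by omega
    have h1 : (n / 7).unpair.1 < n := lt_of_le_of_lt (Nat.unpair_left_le _) h0
    have h2 : (n / 7).unpair.2 < n := lt_of_le_of_lt (Nat.unpair_right_le _) h0
    if n % 7 = 3 then not (ofCode (n / 7))
    else if n % 7 = 4 then and (ofCode (n / 7).unpair.1) (ofCode (n / 7).unpair.2)
    else if n % 7 = 5 then exZ (ofCode (n / 7))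
    else exQ (ofCode (n / 7))
termination_by n

theorem ofCode_toCode (φ : Formula) : ofCode φ.toCode = φ := by
  have e0 : ∀ k, 7 * k / 7 = k := by omega
  have m0 : ∀ k, 7 * k % 7 = 0 := by omega
  have e : ∀ k i, i < 7 → (7 * k + i) / 7 = k := by omega
  have m : ∀ k i, i < 7 → (7 * k + i) % 7 = i := by omega
  have m1 := fun k => m k 1 (by omega)
  have m2 := fun k => m k 2 (by omega)
  have e1 := fun k => e k 1 (by omega)
  have e2 := fun k => e k 2 (by omega)
  induction φ with
  | zle s t => rw [toCode, ofCode]; simp only [m0, e0, Denumerable.ofNat_encode]; rfl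
  | zmod k s t =>
    rw [toCode, ofCode]; simp only [m1, e1, Denumerable.ofNat_encode]; rfl
  | qle s t =>
    rw [toCode, ofCode]; simp only [m2, e2, Denumerable.ofNat_encode]; rfl
  | not φ ih => rw [toCode, ofCode]; simp [m, e, ih]
  | and φ ψ ih1 ih2 => rw [toCode, ofCode]; simp [m, e, ih1, ih2]
  | exZ φ ih => rw [toCode, ofCode]; simp [m, e, ih]
  | exQ φ ih => rw [toCode, ofCode]; simp [m, e, ih]

theorem toCode_ofCode (n : ℕ) : (ofCode n).toCode = n := by
  induction n using Nat.strong_induction_on with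
  | _ n ih =>
    rw [ofCode]
    split_ifs with a b c d e f
    · simp only [toCode, Prod.mk.eta, Denumerable.encode_ofNat]; omega
    · simp only [toCode, Prod.mk.eta, Denumerable.encode_ofNat]; omega
    · simp only [toCode, Prod.mk.eta, Denumerable.encode_ofNat]; omega
    all_goals
      have h0 : n / 7 < n := by omega
      have h1 : (n / 7).unpair.1 < n := lt_of_le_of_lt (Nat.unpair_left_le _) h0
      have h2 : (n / 7).unpair.2 < n := lt_of_le_of_lt (Nat.unpair_right_le _) h0
      simp only [toCode, ih _ h0, ih _ h1, ih _ h2, Nat.pair_unpair]; omega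

instance instDenumerable : Denumerable Formula :=
  Denumerable.mk' ⟨toCode, ofCode, ofCode_toCode, toCode_ofCode⟩

end Formula

/-! ## Clock constraints -/

/-- Atomic clock constraints over a set `C` of clocks; for a clock `x` with value `v`, the integer
and modular ones speak about `⌊v⌋` and the fractional ones about the fractional part of `v`.
The variants with `<`, `≥`, `>` are boolean combinations of these. -/
inductive Atom (C : Type) : Type
  | intLe (x : C) (k : ℤ) : Atom C
  | intDiffLe (x y : C) (k : ℤ) : Atom C
  | modEq (x : C) (m : ℕ+) (k : ℤ) : Atom C
  | modDiffEq (x y : C) (m : ℕ+) (k : ℤ) : Atom C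
  | fracZero (x : C) : Atom C
  | fracLe (x y : C) : Atom C

namespace Atom

variable {C : Type}

def Sat (v : C → ℚ≥0) : Atom C → Prop
  | intLe x k => ⌊(v x : ℚ)⌋ ≤ k
  | intDiffLe x y k => ⌊(v x : ℚ)⌋ - ⌊(v y : ℚ)⌋ ≤ k
  | modEq x m k => ⌊(v x : ℚ)⌋ ≡ k [ZMOD (m : ℕ)]
  | modDiffEq x y m k => ⌊(v x : ℚ)⌋ - ⌊(v y : ℚ)⌋ ≡ k [ZMOD (m : ℕ)]
  | fracZero x => Int.fract (v x : ℚ) = 0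
  | fracLe x y => Int.fract (v x : ℚ) ≤ Int.fract (v y : ℚ)

/-- Clocks occurring in an atom. -/
def clocks : Atom C → List C
  | intLe x _ => [x]
  | intDiffLe x y _ => [x, y]
  | modEq x _ _ => [x]
  | modDiffEq x y _ _ => [x, y]
  | fracZero x => [x]
  | fracLe x y => [x, y]

def IsInteger : Atom C → Prop
  | intLe _ _ => True
  | intDiffLe _ _ _ => True
  | _ => False

def IsFractional : Atom C → Prop
  | fracZero _ => True
  | fracLe _ _ => True
  | _ => False

/-- Size of an atom, with constants written in binary. -/
def size : Atom C → ℕ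
  | intLe _ k => 1 + Nat.size k.natAbs
  | intDiffLe _ _ k => 1 + Nat.size k.natAbs
  | modEq _ m k => 1 + Nat.size m + Nat.size k.natAbs
  | modDiffEq _ _ m k => 1 + Nat.size m + Nat.size k.natAbs
  | fracZero _ => 1
  | fracLe _ _ => 1

def equivSum : Atom C ≃
    (C × ℤ) ⊕ (C × C × ℤ) ⊕ (C × ℕ+ × ℤ) ⊕ (C × C × ℕ+ × ℤ) ⊕ C ⊕ (C × C) where
  toFun
    | intLe x k => .inl (x, k)
    | intDiffLe x y k => .inr (.inl (x, y, k))
    | modEq x m k => .inr (.inr (.inl (x, m, k)))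
    | modDiffEq x y m k => .inr (.inr (.inr (.inl (x, y, m, k))))
    | fracZero x => .inr (.inr (.inr (.inr (.inl x))))
    | fracLe x y => .inr (.inr (.inr (.inr (.inr (x, y)))))
  invFun
    | .inl (x, k) => intLe x k
    | .inr (.inl (x, y, k)) => intDiffLe x y k
    | .inr (.inr (.inl (x, m, k))) => modEq x m k
    | .inr (.inr (.inr (.inl (x, y, m, k)))) => modDiffEq x y m k
    | .inr (.inr (.inr (.inr (.inl x)))) => fracZero x
    | .inr (.inr (.inr (.inr (.inr (x, y))))) => fracLe x y
  left_inv a := by cases a <;> rfl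
  right_inv a := by rcases a with _ | _ | _ | _ | _ | _ <;> rfl

instance instDenumerable [Denumerable C] : Denumerable (Atom C) :=
  Denumerable.ofEquiv _ equivSum

end Atom

/-- Clock constraints: boolean combinations of atomic ones. -/
abbrev Constraint (C : Type) : Type := BoolComb (Atom C)

/-- Transition constraints speak about global clocks, numbered by `ℕ`. -/
abbrev TransConstraint : Type := Constraint ℕ

/-- Stack constraints speak about global clocks `Sum.inl x` and stack clocks `Sum.inr z`. -/
abbrev StackConstraint : Type := Constraint (ℕ ⊕ ℕ)

/-! ## Timed pushdown automata -/

/-- Operations of transition rules; `input none` reads the empty word. -/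
inductive Op : Type
  | elapse : Op
  | input (a : Option ℕ) : Op
  | test (φ : TransConstraint) : Op
  | reset (Y : List ℕ) : Op
  | push (γ : ℕ) (ψ : StackConstraint) : Op
  | pop (γ : ℕ) (ψ : StackConstraint) : Op

namespace Op

def equivSum : Op ≃ Unit ⊕ Option ℕ ⊕ TransConstraint ⊕ List ℕ ⊕
    (ℕ × StackConstraint) ⊕ (ℕ × StackConstraint) where
  toFun
    | elapse => .inl ()
    | input a => .inr (.inl a)
    | test φ => .inr (.inr (.inl φ))
    | reset Y => .inr (.inr (.inr (.inl Y)))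
    | push γ ψ => .inr (.inr (.inr (.inr (.inl (γ, ψ)))))
    | pop γ ψ => .inr (.inr (.inr (.inr (.inr (γ, ψ)))))
  invFun
    | .inl _ => elapse
    | .inr (.inl a) => input a
    | .inr (.inr (.inl φ)) => test φ
    | .inr (.inr (.inr (.inl Y))) => reset Y
    | .inr (.inr (.inr (.inr (.inl (γ, ψ))))) => push γ ψ
    | .inr (.inr (.inr (.inr (.inr (γ, ψ))))) => pop γ ψ
  left_inv a := by cases a <;> rfl
  right_inv a := by rcases a with _ | _ | _ | _ | _ | _ <;> rfl

instance instPrimcodable : Primcodable Op := Primcodable.ofEquiv _ equivSum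

/-- Size of an operation. -/
def size : Op → ℕ
  | elapse => 1
  | input _ => 1
  | test φ => 1 + φ.size Atom.size
  | reset Y => 1 + Y.length
  | push _ ψ => 1 + ψ.size Atom.size
  | pop _ ψ => 1 + ψ.size Atom.size

end Op

/-- A transition rule from location `src` to location `dst`. -/
structure Rule : Type where
  src : ℕ
  op : Op
  dst : ℕ

def Rule.equivProd : Rule ≃ ℕ × Op × ℕ where
  toFun ρ := (ρ.src, ρ.op, ρ.dst)
  invFun t := ⟨t.1, t.2.1, t.2.2⟩
  left_inv _ := rfl
  right_inv _ := rfl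

instance Rule.instPrimcodable : Primcodable Rule := Primcodable.ofEquiv _ Rule.equivProd

/-- The finite description of a timed pushdown automaton. Locations, input letters, stack symbols,
global clocks and stack clocks are the numbers below the respective bounds. -/
structure Automaton : Type where
  numLoc : ℕ
  numInput : ℕ
  numStackSym : ℕ
  numClock : ℕ
  numStackClock : ℕ
  rules : List Rule

namespace Automaton

def equivProd : Automaton ≃ ℕ × ℕ × ℕ × ℕ × ℕ × List Rule where
  toFun P := (P.numLoc, P.numInput, P.numStackSym, P.numClock, P.numStackClock, P.rules)
  invFun t := ⟨t.1, t.2.1, t.2.2.1, t.2.2.2.1, t.2.2.2.2.1, t.2.2.2.2.2⟩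
  left_inv _ := rfl
  right_inv _ := rfl

instance instPrimcodable : Primcodable Automaton := Primcodable.ofEquiv _ equivProd

/-- Everything mentioned in the operation exists in `P`, and every atomic constraint in a stack
constraint contains some stack clock. -/
def OpValid (P : Automaton) : Op → Prop
  | .elapse => True
  | .input a => ∀ b ∈ a, b < P.numInput
  | .test φ => ∀ a ∈ φ.atoms, ∀ x ∈ a.clocks, x < P.numClock
  | .reset Y => ∀ x ∈ Y, x < P.numClock
  | .push γ ψ => γ < P.numStackSym ∧ ∀ a ∈ ψ.atoms,
      (∀ c ∈ a.clocks, Sum.elim (· < P.numClock) (· < P.numStackClock) c) ∧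
      ∃ z, Sum.inr z ∈ a.clocks
  | .pop γ ψ => γ < P.numStackSym ∧ ∀ a ∈ ψ.atoms,
      (∀ c ∈ a.clocks, Sum.elim (· < P.numClock) (· < P.numStackClock) c) ∧
      ∃ z, Sum.inr z ∈ a.clocks

/-- The description is one of an automaton: all rules are between existing locations and carry
valid operations. -/
def Valid (P : Automaton) : Prop :=
  ∀ ρ ∈ P.rules, ρ.src < P.numLoc ∧ ρ.dst < P.numLoc ∧ P.OpValid ρ.op

/-- Size of the description, with constants written in binary. -/
def size (P : Automaton) : ℕ :=
  P.numLoc + P.numInput + P.numStackSym + P.numClock + P.numStackClock +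
    (P.rules.map fun ρ => ρ.op.size).sum

/-! ### Semantics -/

/-- Valuations of `n` clocks. -/
abbrev Val (n : ℕ) : Type := Fin n → ℚ≥0

/-- The value of clock number `i`; the default `0` is irrelevant for valid automata. -/
def Val.get {n : ℕ} (μ : Val n) (i : ℕ) : ℚ≥0 := if h : i < n then μ ⟨i, h⟩ else 0

/-- `μ ⊨ φ` for a transition constraint. -/
def transSat {n : ℕ} (μ : Val n) (φ : TransConstraint) : Prop :=
  φ.Sat (Atom.Sat μ.get)

/-- `(μ, μ₁) ⊨ ψ` for a stack constraint. -/
def stackSat {n k : ℕ} (μ : Val n) (μ₁ : Val k) (ψ : StackConstraint) : Prop :=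
  ψ.Sat (Atom.Sat (Sum.elim μ.get μ₁.get))

/-- Configurations: a location, a valuation of the global clocks, and a timed stack. The head of
the list is the top of the stack. -/
structure Config (P : Automaton) : Type where
  loc : ℕ
  val : Val P.numClock
  stack : List (ℕ × Val P.numStackClock)

/-- Labels of steps: time increments, and input letters or the empty word (`none`). -/
inductive Label : Type
  | time (δ : ℚ≥0) : Label
  | letter (a : Option ℕ) : Label

/-- One-step transitions. -/
inductive Step (P : Automaton) : Config P → Label → Config P → Prop
  | elapse {l r : ℕ} {μ : Val P.numClock} {w : List (ℕ × Val P.numStackClock)} (δ : ℚ≥0)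
      (h : Rule.mk l .elapse r ∈ P.rules) :
      Step P ⟨l, μ, w⟩ (.time δ)
        ⟨r, fun x => μ x + δ, w.map fun s => (s.1, fun z => s.2 z + δ)⟩
  | input {l r : ℕ} {μ : Val P.numClock} {w : List (ℕ × Val P.numStackClock)} {a : Option ℕ}
      (h : Rule.mk l (.input a) r ∈ P.rules) :
      Step P ⟨l, μ, w⟩ (.letter a) ⟨r, μ, w⟩
  | test {l r : ℕ} {μ : Val P.numClock} {w : List (ℕ × Val P.numStackClock)}
      {φ : TransConstraint} (h : Rule.mk l (.test φ) r ∈ P.rules) (hφ : transSat μ φ) :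
      Step P ⟨l, μ, w⟩ (.letter none) ⟨r, μ, w⟩
  | reset {l r : ℕ} {μ : Val P.numClock} {w : List (ℕ × Val P.numStackClock)} {Y : List ℕ}
      (h : Rule.mk l (.reset Y) r ∈ P.rules) :
      Step P ⟨l, μ, w⟩ (.letter none) ⟨r, fun x => if (x : ℕ) ∈ Y then 0 else μ x, w⟩
  | push {l r : ℕ} {μ : Val P.numClock} {w : List (ℕ × Val P.numStackClock)} {γ : ℕ}
      {ψ : StackConstraint} {μ₁ : Val P.numStackClock}
      (h : Rule.mk l (.push γ ψ) r ∈ P.rules) (hψ : stackSat μ μ₁ ψ) :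
      Step P ⟨l, μ, w⟩ (.letter none) ⟨r, μ, (γ, μ₁) :: w⟩
  | pop {l r : ℕ} {μ : Val P.numClock} {w : List (ℕ × Val P.numStackClock)} {γ : ℕ}
      {ψ : StackConstraint} {μ₁ : Val P.numStackClock}
      (h : Rule.mk l (.pop γ ψ) r ∈ P.rules) (hψ : stackSat μ μ₁ ψ) :
      Step P ⟨l, μ, (γ, μ₁) :: w⟩ (.letter none) ⟨r, μ, w⟩

/-- Runs over a sequence of labels. -/
inductive Run (P : Automaton) : Config P → List Label → Config P → Prop
  | nil (c : Config P) : Run P c [] c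
  | cons {c d e : Config P} {a : Label} {w : List Label} (h : Step P c a d) (t : Run P d w e) :
      Run P c (a :: w) e

/-- Number of occurrences of the input letter `a`. -/
def parikh (w : List Label) (a : ℕ) : ℕ :=
  (w.filterMap fun | .letter b => b | .time _ => none).count a

/-- The ternary reachability relation from location `l` to location `r`: some run leads from
valuation `μ` to valuation `ν`, with empty stack at both ends, and its Parikh image is `π`. -/
def Reach (P : Automaton) (l r : ℕ) (μ : Val P.numClock) (π : Fin P.numInput → ℕ)
    (ν : Val P.numClock) : Prop :=
  ∃ w : List Label, Run P ⟨l, μ, []⟩ w ⟨r, ν, []⟩ ∧ ∀ a : Fin P.numInput, parikh w a = π a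

/-! ### Families of formulas expressing the reachability relation -/

/-- Values of the integer variables: integer parts of the initial clock values, letter counts,
integer parts of the final clock values. -/
def intEnv {n s : ℕ} (μ : Val n) (π : Fin s → ℕ) (ν : Val n) : List ℤ :=
  (List.ofFn fun x => ⌊(μ x : ℚ)⌋) ++ (List.ofFn fun a => (π a : ℤ)) ++
    (List.ofFn fun x => ⌊(ν x : ℚ)⌋)

/-- Values of the rational variables: fractional parts of the initial clock values, fractional
parts of the final clock values. -/
def ratEnv {n : ℕ} (μ ν : Val n) : List ℚ :=
  (List.ofFn fun x => Int.fract (μ x : ℚ)) ++ (List.ofFn fun x => Int.fract (ν x : ℚ))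

/-- A family of formulas indexed by pairs of locations, as a matrix: row `l`, column `r`. -/
abbrev Family : Type := List (List Formula)

/-- The family `Φ` expresses the ternary reachability relation of `P`. -/
def Expresses (P : Automaton) (Φ : Family) : Prop :=
  ∀ l < P.numLoc, ∀ r < P.numLoc, ∃ φ : Formula,
    (∃ row : List Formula, Φ[l]? = some row ∧ row[r]? = some φ) ∧
    φ.Scoped (P.numClock + P.numInput + P.numClock) (P.numClock + P.numClock) ∧
    ∀ (μ : Val P.numClock) (π : Fin P.numInput → ℕ) (ν : Val P.numClock),
      P.Reach l r μ π ν ↔ φ.Sat (intEnv μ π ν) (ratEnv μ ν)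

/-! ### Classes of automata -/

/-- The constraint `⋀_{x < n} ⌊z_x⌋ = ⌊x⌋ ∧ {z_x} = {x}`, where `z_x` is stack clock number `x`. -/
def copyConstraint (n : ℕ) : StackConstraint :=
  .conj <| (List.range n).map fun x =>
    .and (.and (.atom (.intDiffLe (.inr x) (.inl x) 0)) (.atom (.intDiffLe (.inl x) (.inr x) 0)))
      (.and (.atom (.fracLe (.inr x) (.inl x))) (.atom (.fracLe (.inl x) (.inr x))))

/-- Push-copy: one stack clock `z_x` per global clock `x`, and pushing copies all global clocks. -/
def PushCopy (P : Automaton) : Prop :=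
  P.numStackClock = P.numClock ∧
    ∀ l γ ψ r, Rule.mk l (.push γ ψ) r ∈ P.rules → ψ = copyConstraint P.numClock

/-- Pop constraints contain no integer atoms. -/
def PopIntegerFree (P : Automaton) : Prop :=
  ∀ l γ ψ r, Rule.mk l (.pop γ ψ) r ∈ P.rules → ∀ a ∈ ψ.atoms, ¬ a.IsInteger

/-- All transition, push and pop constraints contain fractional atoms only. -/
def Fractional (P : Automaton) : Prop :=
  (∀ l φ r, Rule.mk l (.test φ) r ∈ P.rules → ∀ a ∈ φ.atoms, a.IsFractional) ∧
  (∀ l γ ψ r, Rule.mk l (.push γ ψ) r ∈ P.rules → ∀ a ∈ ψ.atoms, a.IsFractional) ∧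
  (∀ l γ ψ r, Rule.mk l (.pop γ ψ) r ∈ P.rules → ∀ a ∈ ψ.atoms, a.IsFractional)

/-- `T` effectively transforms automata of class `A` into automata of class `B`, and a family of
formulas expressing the reachability relation of `P` can be computed (uniformly) from `P` and any
family expressing the reachability relation of `T P`. -/
def EffectiveReduction (A B : Automaton → Prop) (T : Automaton → Automaton) : Prop :=
  Computable T ∧
  (∀ P : Automaton, P.Valid → A P → (T P).Valid ∧ B (T P)) ∧
  ∃ F : Automaton → Family → Family, Computable₂ F ∧
    ∀ P : Automaton, P.Valid → A P →
      ∀ Φ : Family, (T P).Expresses Φ → P.Expresses (F P Φ)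

end Automaton

end TPDA

/-! ## Primitive recursive functions

The library of primitive recursive functions in a form that `fun_prop` can use. -/

attribute [fun_prop] Primrec

namespace Primrec

variable {α β γ δ σ : Type} [Primcodable α] [Primcodable β] [Primcodable γ] [Primcodable δ]
  [Primcodable σ]

attribute [fun_prop] Primrec.const Primrec.comp

@[fun_prop] theorem id_fun : Primrec fun x : α => x := Primrec.id

@[fun_prop] theorem fst_fun {f : α → β × γ} (hf : Primrec f) : Primrec fun x => (f x).1 :=
  Primrec.fst.comp hf

@[fun_prop] theorem snd_fun {f : α → β × γ} (hf : Primrec f) : Primrec fun x => (f x).2 :=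
  Primrec.snd.comp hf

@[fun_prop] theorem mk_fun {f : α → β} {g : α → γ} (hf : Primrec f) (hg : Primrec g) :
    Primrec fun x => (f x, g x) := hf.pair hg

section Nat

variable {f g : α → ℕ}

@[fun_prop] theorem add_fun (hf : Primrec f) (hg : Primrec g) : Primrec fun x => f x + g x :=
  Primrec.nat_add.comp hf hg

@[fun_prop] theorem sub_fun (hf : Primrec f) (hg : Primrec g) : Primrec fun x => f x - g x :=
  Primrec.nat_sub.comp hf hg

@[fun_prop] theorem mul_fun (hf : Primrec f) (hg : Primrec g) : Primrec fun x => f x * g x :=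
  Primrec.nat_mul.comp hf hg

@[fun_prop] theorem div_fun (hf : Primrec f) (hg : Primrec g) : Primrec fun x => f x / g x :=
  Primrec.nat_div.comp hf hg

@[fun_prop] theorem mod_fun (hf : Primrec f) (hg : Primrec g) : Primrec fun x => f x % g x :=
  Primrec.nat_mod.comp hf hg

@[fun_prop] theorem max_fun (hf : Primrec f) (hg : Primrec g) : Primrec fun x => max (f x) (g x) :=
  Primrec.nat_max.comp hf hg

@[fun_prop] theorem pow_fun (hf : Primrec f) (hg : Primrec g) : Primrec fun x => f x ^ g x :=
  (Primrec₂.unpaired'.1 Nat.Primrec.pow).comp hf hg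

@[fun_prop] theorem iterate_fun {a : α → β} {h : α → β → β} (hf : Primrec f) (ha : Primrec a)
    (hh : Primrec fun p : α × β => h p.1 p.2) : Primrec fun x => (h x)^[f x] (a x) :=
  Primrec.nat_iterate hf ha hh

@[fun_prop] theorem factorial_fun (hf : Primrec f) : Primrec fun x => (f x).factorial := by
  refine Primrec.comp (f := Nat.factorial) ?_ hf
  refine (Primrec.nat_rec₁ (f := fun n y => (n + 1) * y) 1 ?_).of_eq fun n => ?_
  · change Primrec fun p : ℕ × ℕ => (p.1 + 1) * p.2
    fun_prop
  · induction n with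
    | zero => rfl
    | succ n ih => rw [Nat.factorial_succ, ← ih]

@[fun_prop] theorem decide_le_fun (hf : Primrec f) (hg : Primrec g) :
    Primrec fun x => decide (f x ≤ g x) :=
  PrimrecPred.decide (Primrec.nat_le.comp hf hg)

@[fun_prop] theorem decide_lt_fun (hf : Primrec f) (hg : Primrec g) :
    Primrec fun x => decide (f x < g x) :=
  PrimrecPred.decide (Primrec.nat_lt.comp hf hg)

@[fun_prop] theorem decide_eq_fun (hf : Primrec f) (hg : Primrec g) :
    Primrec fun x => decide (f x = g x) :=
  PrimrecPred.decide (Primrec.eq.comp hf hg)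

end Nat

section Bool

variable {f g : α → Bool}

@[fun_prop] theorem and_fun (hf : Primrec f) (hg : Primrec g) : Primrec fun x => f x && g x :=
  Primrec.and.comp hf hg

@[fun_prop] theorem or_fun (hf : Primrec f) (hg : Primrec g) : Primrec fun x => f x || g x :=
  Primrec.or.comp hf hg

@[fun_prop] theorem not_fun (hf : Primrec f) : Primrec fun x => !f x :=
  Primrec.not.comp hf

@[fun_prop] theorem cond_fun {a b : α → β} (hf : Primrec f) (ha : Primrec a) (hb : Primrec b) :
    Primrec fun x => bif f x then a x else b x :=
  Primrec.cond hf ha hb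

end Bool

section List

variable {f g : α → List β}

@[fun_prop] theorem cons_fun {a : α → β} (ha : Primrec a) (hf : Primrec f) :
    Primrec fun x => a x :: f x := Primrec.list_cons.comp ha hf

@[fun_prop] theorem append_fun (hf : Primrec f) (hg : Primrec g) : Primrec fun x => f x ++ g x :=
  Primrec.list_append.comp hf hg

@[fun_prop] theorem map_fun {h : α → β → γ} (hf : Primrec f)
    (hh : Primrec fun p : α × β => h p.1 p.2) : Primrec fun x => (f x).map (h x) :=
  Primrec.list_map hf hh

@[fun_prop] theorem flatMap_fun {h : α → β → List γ} (hf : Primrec f)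
    (hh : Primrec fun p : α × β => h p.1 p.2) : Primrec fun x => (f x).flatMap (h x) :=
  Primrec.list_flatMap hf hh

@[fun_prop] theorem range_fun {f : α → ℕ} (hf : Primrec f) : Primrec fun x => List.range (f x) :=
  Primrec.list_range.comp hf

@[fun_prop] theorem length_fun (hf : Primrec f) : Primrec fun x => (f x).length :=
  Primrec.list_length.comp hf

@[fun_prop] theorem getElem?_fun {i : α → ℕ} (hf : Primrec f) (hi : Primrec i) :
    Primrec fun x => (f x)[i x]? :=
  Primrec.list_getElem?.comp hf hi

@[fun_prop] theorem getD_fun {i : α → ℕ} {d : β} (hf : Primrec f) (hi : Primrec i) :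
    Primrec fun x => (f x).getD (i x) d :=
  (Primrec.list_getD d).comp hf hi

@[fun_prop] theorem foldr_fun {h : α → β → γ → γ} {c : α → γ} (hf : Primrec f) (hc : Primrec c)
    (hh : Primrec fun p : α × β × γ => h p.1 p.2.1 p.2.2) :
    Primrec fun x => (f x).foldr (h x) (c x) :=
  Primrec.list_foldr (h := fun x p => h x p.1 p.2) hf hc hh

@[fun_prop] theorem all_fun {h : α → β → Bool} (hf : Primrec f)
    (hh : Primrec fun p : α × β => h p.1 p.2) : Primrec fun x => (f x).all (h x) := by
  have : Primrec fun x => (f x).foldr (fun b r => h x b && r) true := by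
    refine foldr_fun hf (by fun_prop) (and_fun (hh.comp (f := fun p : α × β => h p.1 p.2)
      (g := fun p : α × β × Bool => (p.1, p.2.1)) (by fun_prop)) (by fun_prop))
  refine this.of_eq fun x => ?_
  induction f x <;> simp_all

@[fun_prop] theorem any_fun {h : α → β → Bool} (hf : Primrec f)
    (hh : Primrec fun p : α × β => h p.1 p.2) : Primrec fun x => (f x).any (h x) := by
  have : Primrec fun x => !(f x).all fun b => !h x b := by fun_prop
  exact this.of_eq fun x => by simp [List.all_eq_not_any_not]

@[fun_prop] theorem contains_fun {f : α → List ℕ} {a : α → ℕ} (hf : Primrec f) (ha : Primrec a) :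
    Primrec fun x => (f x).contains (a x) := by
  have : Primrec fun x => (f x).any fun b => decide (a x = b) := by fun_prop
  exact this.of_eq fun x => by rw [Bool.eq_iff_iff]; simp

end List

@[fun_prop] theorem inl_fun {f : α → β} (hf : Primrec f) :
    Primrec fun x => (Sum.inl (f x) : β ⊕ γ) := Primrec.sumInl.comp hf

@[fun_prop] theorem inr_fun {f : α → γ} (hf : Primrec f) :
    Primrec fun x => (Sum.inr (f x) : β ⊕ γ) := Primrec.sumInr.comp hf

@[fun_prop] theorem some_fun {f : α → β} (hf : Primrec f) : Primrec fun x => some (f x) :=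
  Primrec.option_some.comp hf

@[fun_prop] theorem sum_elim_fun {f : α → β ⊕ γ} {g : α → β → σ} {h : α → γ → σ} (hf : Primrec f)
    (hg : Primrec fun p : α × β => g p.1 p.2) (hh : Primrec fun p : α × γ => h p.1 p.2) :
    Primrec fun x => Sum.elim (g x) (h x) (f x) :=
  (Primrec.sumCasesOn hf hg hh).of_eq fun x => by cases f x <;> rfl

@[fun_prop] theorem option_elim_fun {f : α → Option β} {c : α → σ} {h : α → β → σ} (hf : Primrec f)
    (hc : Primrec c) (hh : Primrec fun p : α × β => h p.1 p.2) :
    Primrec fun x => (f x).elim (c x) (h x) :=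
  (Primrec.option_casesOn hf hc hh).of_eq fun x => by cases f x <;> rfl

@[fun_prop] theorem intCast_fun {f : α → ℕ} (hf : Primrec f) : Primrec fun x => (f x : ℤ) := by
  refine Primrec.comp (f := fun n : ℕ => (n : ℤ)) (Primrec.encode_iff.1 ?_) hf
  exact Primrec.nat_double.of_eq fun n => rfl

@[fun_prop] theorem int_toNat_fun {f : α → ℤ} (hf : Primrec f) :
    Primrec fun x => (f x).toNat := by
  have h : Primrec fun n : ℤ =>
      bif decide (Encodable.encode n % 2 = 0) then Encodable.encode n / 2 else 0 := by
    have := @Primrec.encode ℤ _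
    fun_prop
  refine Primrec.comp (f := Int.toNat) (h.of_eq fun n => ?_) hf
  rcases n with n | n
  · change (bif decide ((2 * n) % 2 = 0) then (2 * n) / 2 else 0) = n
    simp
  · change (bif decide ((2 * n + 1) % 2 = 0) then (2 * n + 1) / 2 else 0) = 0
    have : (2 * n + 1) % 2 = 1 := by omega
    simp [this]

@[fun_prop] theorem int_neg_toNat_fun {f : α → ℤ} (hf : Primrec f) :
    Primrec fun x => (-f x).toNat := by
  have h : Primrec fun n : ℤ =>
      bif decide (Encodable.encode n % 2 = 0) then 0 else Encodable.encode n / 2 + 1 := by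
    have := @Primrec.encode ℤ _
    fun_prop
  refine Primrec.comp (f := fun n : ℤ => (-n).toNat) (h.of_eq fun n => ?_) hf
  rcases n with n | n
  · change (bif decide ((2 * n) % 2 = 0) then 0 else (2 * n) / 2 + 1) = (-(n : ℤ)).toNat
    simp
  · change (bif decide ((2 * n + 1) % 2 = 0) then 0 else (2 * n + 1) / 2 + 1) = n + 1
    have : (2 * n + 1) % 2 = 1 := by omega
    simp [this]; omega

@[fun_prop] theorem pnat_val_fun {f : α → ℕ+} (hf : Primrec f) : Primrec fun x => (f x : ℕ) := by
  refine Primrec.comp (f := fun n : ℕ+ => (n : ℕ)) ?_ hf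
  have h : Primrec fun n : ℕ+ => Encodable.encode n + 1 := by
    have := @Primrec.encode ℕ+ _
    fun_prop
  refine h.of_eq fun n => ?_
  change n.natPred + 1 = n
  simp

@[fun_prop] theorem succPNat_fun {f : α → ℕ} (hf : Primrec f) :
    Primrec fun x => (f x).succPNat := by
  refine Primrec.comp (f := Nat.succPNat) (Primrec.encode_iff.1 ?_) hf
  refine Primrec.id.of_eq fun n => ?_
  change n = n.succPNat.natPred
  simp

end Primrec

/-! ## Primitive recursiveness of the syntactic operations -/

namespace TPDA

section Primrec

variable {α σ : Type} [Primcodable α] [Primcodable σ]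

namespace Atom

variable {C : Type} [Denumerable C]

/-- Case distinction on atoms, as a function on the sum type. -/
theorem primrec_casesOn {f : α → Atom C}
    {g₁ : α → C × ℤ → σ} {g₂ : α → C × C × ℤ → σ} {g₃ : α → C × ℕ+ × ℤ → σ}
    {g₄ : α → C × C × ℕ+ × ℤ → σ} {g₅ : α → C → σ} {g₆ : α → C × C → σ} {h : α → Atom C → σ}
    (hf : Primrec f) (h₁ : Primrec fun p : α × C × ℤ => g₁ p.1 p.2)
    (h₂ : Primrec fun p : α × C × C × ℤ => g₂ p.1 p.2)
    (h₃ : Primrec fun p : α × C × ℕ+ × ℤ => g₃ p.1 p.2)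
    (h₄ : Primrec fun p : α × C × C × ℕ+ × ℤ => g₄ p.1 p.2)
    (h₅ : Primrec fun p : α × C => g₅ p.1 p.2) (h₆ : Primrec fun p : α × C × C => g₆ p.1 p.2)
    (e : ∀ x a, h x a = (equivSum a).elim (g₁ x) (Sum.elim (g₂ x) (Sum.elim (g₃ x)
      (Sum.elim (g₄ x) (Sum.elim (g₅ x) (g₆ x)))))) :
    Primrec fun x => h x (f x) := by
  have hE : Primrec fun x => equivSum (f x) := Primrec.of_equiv.comp hf
  refine Primrec.of_eq ?_ fun x => (e x (f x)).symm
  refine Primrec.sum_elim_fun hE h₁ (Primrec.sum_elim_fun Primrec.snd ?_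
    (Primrec.sum_elim_fun Primrec.snd ?_ (Primrec.sum_elim_fun Primrec.snd ?_
    (Primrec.sum_elim_fun Primrec.snd ?_ ?_))))
  · exact h₂.comp (g := fun q : (α × _) × C × C × ℤ => (q.1.1, q.2)) (by fun_prop)
  · exact h₃.comp (g := fun q : ((α × _) × _) × C × ℕ+ × ℤ => (q.1.1.1, q.2)) (by fun_prop)
  · exact h₄.comp (g := fun q : (((α × _) × _) × _) × C × C × ℕ+ × ℤ => (q.1.1.1.1, q.2))
      (by fun_prop)
  · exact h₅.comp (g := fun q : ((((α × _) × _) × _) × _) × C => (q.1.1.1.1.1, q.2)) (by fun_prop)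
  · exact h₆.comp (g := fun q : ((((α × _) × _) × _) × _) × C × C => (q.1.1.1.1.1, q.2))
      (by fun_prop)

@[fun_prop] theorem primrec_fracZero {x : α → C} (hx : Primrec x) :
    Primrec fun a => fracZero (x a) :=
  (Primrec.of_equiv_symm (e := equivSum)).comp
    (g := fun a => .inr (.inr (.inr (.inr (.inl (x a)))))) (by fun_prop)

@[fun_prop] theorem primrec_fracLe {x y : α → C} (hx : Primrec x) (hy : Primrec y) :
    Primrec fun a => fracLe (x a) (y a) :=
  (Primrec.of_equiv_symm (e := equivSum)).comp
    (g := fun a => .inr (.inr (.inr (.inr (.inr (x a, y a)))))) (by fun_prop)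

@[fun_prop] theorem primrec_intDiffLe {x y : α → C} {k : α → ℤ} (hx : Primrec x) (hy : Primrec y)
    (hk : Primrec k) : Primrec fun a => intDiffLe (x a) (y a) (k a) :=
  (Primrec.of_equiv_symm (e := equivSum)).comp
    (g := fun a => .inr (.inl (x a, y a, k a))) (by fun_prop)

end Atom

namespace BoolComb

variable {β : Type} [Denumerable β]

@[fun_prop] theorem primrec_atom {f : α → β} (hf : Primrec f) : Primrec fun x => atom (f x) := by
  refine Primrec.encode_iff.1 (Primrec.of_eq (f := fun x => 4 * Encodable.encode (f x) + 1) ?_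
    fun x => rfl)
  have := Primrec.encode.comp hf
  fun_prop

@[fun_prop] theorem primrec_not {f : α → BoolComb β} (hf : Primrec f) :
    Primrec fun x => not (f x) := by
  refine Primrec.encode_iff.1 (Primrec.of_eq (f := fun x => 4 * Encodable.encode (f x) + 2) ?_
    fun x => rfl)
  have := Primrec.encode.comp hf
  fun_prop

@[fun_prop] theorem primrec_and {f g : α → BoolComb β} (hf : Primrec f) (hg : Primrec g) :
    Primrec fun x => and (f x) (g x) := by
  refine Primrec.encode_iff.1 (Primrec.of_eq
    (f := fun x => 4 * Nat.pair (Encodable.encode (f x)) (Encodable.encode (g x)) + 3) ?_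
    fun x => rfl)
  have := Primrec₂.natPair.comp (Primrec.encode.comp hf) (Primrec.encode.comp hg)
  fun_prop

@[fun_prop] theorem primrec_or {f g : α → BoolComb β} (hf : Primrec f) (hg : Primrec g) :
    Primrec fun x => or (f x) (g x) := by
  refine Primrec.encode_iff.1 (Primrec.of_eq
    (f := fun x => 4 * Nat.pair (Encodable.encode (f x)) (Encodable.encode (g x)) + 4) ?_
    fun x => rfl)
  have := Primrec₂.natPair.comp (Primrec.encode.comp hf) (Primrec.encode.comp hg)
  fun_prop

@[fun_prop] theorem primrec_conj {f : α → List (BoolComb β)} (hf : Primrec f) :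
    Primrec fun x => conj (f x) := by
  have : Primrec fun x => (f x).foldr (fun φ r => and φ r) tru := by fun_prop
  refine this.of_eq fun x => ?_
  induction f x with
  | nil => rfl
  | cons a l ih => rw [conj, ← ih]; rfl

/-- Structural recursion. -/
def fold {β τ : Type} (t : τ) (at' : β → τ) (nt : τ → τ) (an od : τ → τ → τ) : BoolComb β → τ
  | tru => t
  | atom a => at' a
  | not φ => nt (φ.fold t at' nt an od)
  | and φ ψ => an (φ.fold t at' nt an od) (ψ.fold t at' nt an od)
  | or φ ψ => od (φ.fold t at' nt an od) (ψ.fold t at' nt an od)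

theorem primrec_fold {f : α → BoolComb β} {t : σ} {at' : α → β → σ} {nt : σ → σ}
    {an od : σ → σ → σ} (hf : Primrec f) (hat : Primrec fun p : α × β => at' p.1 p.2)
    (hnt : Primrec nt) (han : Primrec fun p : σ × σ => an p.1 p.2)
    (hod : Primrec fun p : σ × σ => od p.1 p.2) :
    Primrec fun x => (f x).fold t (at' x) nt an od := by
  let g : α → List σ → Option σ := fun x l =>
    let k := (l.length - 1) / 4
    let i := (l.length - 1) % 4
    bif decide (l.length = 0) then some t
    else bif decide (i = 0) then some (at' x (Denumerable.ofNat β k))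
    else bif decide (i = 1) then l[k]?.elim none fun y => some (nt y)
    else bif decide (i = 2) then
      l[k.unpair.1]?.elim none fun y => l[k.unpair.2]?.elim none fun z => some (an y z)
    else l[k.unpair.1]?.elim none fun y => l[k.unpair.2]?.elim none fun z => some (od y z)
  have hg : Primrec₂ g := by
    have h1 : Primrec fun p : α × List σ => at' p.1 (Denumerable.ofNat β ((p.2.length - 1) / 4)) :=
      hat.comp (g := fun p : α × List σ => (p.1, Denumerable.ofNat β ((p.2.length - 1) / 4)))
        (by have := Primrec.ofNat β; fun_prop)
    have hu := Primrec.unpair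
    have h2 : Primrec fun p : (((α × List σ) × σ) × σ) => an p.1.2 p.2 :=
      han.comp (g := fun p : (((α × List σ) × σ) × σ) => (p.1.2, p.2)) (by fun_prop)
    have h3 : Primrec fun p : (((α × List σ) × σ) × σ) => od p.1.2 p.2 :=
      hod.comp (g := fun p : (((α × List σ) × σ) × σ) => (p.1.2, p.2)) (by fun_prop)
    refine Primrec₂.mk ?_
    refine Primrec.cond_fun (by fun_prop) (by fun_prop) (Primrec.cond_fun (by fun_prop)
      (Primrec.some_fun h1) (Primrec.cond_fun (by fun_prop) ?_ (Primrec.cond_fun (by fun_prop)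
      ?_ ?_)))
    · exact Primrec.option_elim_fun (by fun_prop) (by fun_prop) (by fun_prop)
    · exact Primrec.option_elim_fun (by fun_prop) (by fun_prop)
        (Primrec.option_elim_fun (by fun_prop) (by fun_prop) (Primrec.some_fun h2))
    · exact Primrec.option_elim_fun (by fun_prop) (by fun_prop)
        (Primrec.option_elim_fun (by fun_prop) (by fun_prop) (Primrec.some_fun h3))
  have H := Primrec.nat_strong_rec (fun x n => (ofCode n : BoolComb β).fold t (at' x) nt an od) hg
    fun x n => by
      have key : ∀ m < n, ((List.range n).map fun n =>
          (ofCode n : BoolComb β).fold t (at' x) nt an od)[m]? =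
          some ((ofCode m : BoolComb β).fold t (at' x) nt an od) := by
        intro m hm; simp [hm]
      rcases n with _ | n
      · simp [g, ofCode, fold]
      · have h0 : n / 4 < n + 1 := by omega
        have h1 : (n / 4).unpair.1 < n + 1 := lt_of_le_of_lt (Nat.unpair_left_le _) h0
        have h2 : (n / 4).unpair.2 < n + 1 := lt_of_le_of_lt (Nat.unpair_right_le _) h0
        have hl : ((List.range (n + 1)).map fun n =>
          (ofCode n : BoolComb β).fold t (at' x) nt an od).length = n + 1 := by simp
        simp only [g, hl, Nat.add_sub_cancel, key _ h0, key _ h1, key _ h2, Option.elim]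
        rw [ofCode]
        have : n % 4 < 4 := Nat.mod_lt _ (by omega)
        split_ifs with a b c <;> simp [*, fold]
  have := H.comp (Primrec.id (α := α)) (Primrec.encode.comp hf)
  refine this.of_eq fun x => ?_
  change (ofCode (f x).toCode : BoolComb β).fold t (at' x) nt an od = _
  rw [ofCode_toCode]

@[fun_prop] theorem primrec_atoms {f : α → BoolComb β} (hf : Primrec f) :
    Primrec fun x => (f x).atoms := by
  have : Primrec fun x => (f x).fold (τ := List β) [] (fun a => [a]) id (· ++ ·) (· ++ ·) :=
    primrec_fold (at' := fun _ a => [a]) (an := (· ++ ·)) (od := (· ++ ·)) hf (by fun_prop) Primrec.id (by fun_prop) (by fun_prop)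
  refine this.of_eq fun x => ?_
  induction f x with simp_all [fold, atoms]

/-- Substitution of boolean combinations for atoms. -/
def bind {β γ : Type} (g : β → BoolComb γ) : BoolComb β → BoolComb γ :=
  fold tru g not and or

@[fun_prop] theorem primrec_bind {γ : Type} [Denumerable γ] {f : α → BoolComb β}
    {g : α → β → BoolComb γ} (hf : Primrec f) (hg : Primrec fun p : α × β => g p.1 p.2) :
    Primrec fun x => (f x).bind (g x) :=
  primrec_fold hf hg (by fun_prop) (by fun_prop) (by fun_prop)

theorem sat_bind {β γ : Type} {s : γ → Prop} {g : β → BoolComb γ} {φ : BoolComb β} :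
    (φ.bind g).Sat s ↔ φ.Sat fun a => (g a).Sat s := by
  simp only [bind]
  induction φ with simp_all [fold, Sat]

theorem mem_atoms_bind {β γ : Type} {g : β → BoolComb γ} {φ : BoolComb β} {c : γ} :
    c ∈ (φ.bind g).atoms ↔ ∃ a ∈ φ.atoms, c ∈ (g a).atoms := by
  simp only [bind]
  induction φ with
  | and φ ψ h1 h2 => simp [fold, atoms, h1, h2, or_and_right, exists_or]
  | or φ ψ h1 h2 => simp [fold, atoms, h1, h2, or_and_right, exists_or]
  | _ => simp_all [fold, atoms]

theorem sat_congr {β : Type} {s s' : β → Prop} {φ : BoolComb β}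
    (h : ∀ a ∈ φ.atoms, (s a ↔ s' a)) : φ.Sat s ↔ φ.Sat s' := by
  induction φ with
  | tru => rfl
  | atom a => exact h a (by simp [atoms])
  | not φ ih => exact not_congr (ih h)
  | and φ ψ h1 h2 =>
    exact and_congr (h1 fun a ha => h a (by simp [atoms, ha]))
      (h2 fun a ha => h a (by simp [atoms, ha]))
  | or φ ψ h1 h2 =>
    exact or_congr (h1 fun a ha => h a (by simp [atoms, ha]))
      (h2 fun a ha => h a (by simp [atoms, ha]))

/-- Boolean evaluation. -/
def eval {β : Type} (g : β → Bool) : BoolComb β → Bool :=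
  fold true g (!·) (· && ·) (· || ·)

@[fun_prop] theorem primrec_eval {f : α → BoolComb β} {g : α → β → Bool} (hf : Primrec f)
    (hg : Primrec fun p : α × β => g p.1 p.2) : Primrec fun x => (f x).eval (g x) :=
  primrec_fold hf hg (by fun_prop) (by fun_prop) (by fun_prop)

theorem eval_iff {β : Type} {g : β → Bool} {φ : BoolComb β} :
    φ.eval g = true ↔ φ.Sat fun a => g a = true := by
  simp only [eval]
  induction φ with
  | not φ ih => rw [Sat, ← ih]; simp [fold]
  | _ => simp_all [fold, Sat]

/-- A truth constant. -/
def ofBool {β : Type} (b : Bool) : BoolComb β := bif b then tru else not tru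

@[fun_prop] theorem primrec_ofBool {f : α → Bool} (hf : Primrec f) :
    Primrec fun x => (ofBool (f x) : BoolComb β) := by
  unfold ofBool; fun_prop

@[simp] theorem sat_ofBool {β : Type} {s : β → Prop} {b : Bool} :
    (ofBool b).Sat s ↔ b = true := by
  cases b <;> simp [ofBool, Sat]

@[simp] theorem atoms_ofBool {β : Type} {b : Bool} : (ofBool b : BoolComb β).atoms = [] := by
  cases b <;> simp [ofBool, atoms]

@[simp] theorem sat_conj {β : Type} {s : β → Prop} {l : List (BoolComb β)} :
    (conj l).Sat s ↔ ∀ φ ∈ l, φ.Sat s := by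
  induction l with simp_all [conj, Sat]

@[simp] theorem mem_atoms_conj {β : Type} {l : List (BoolComb β)} {a : β} :
    a ∈ (conj l).atoms ↔ ∃ φ ∈ l, a ∈ φ.atoms := by
  induction l with simp_all [conj, atoms]

end BoolComb

namespace Op

@[fun_prop] theorem primrec_input {f : α → Option ℕ} (hf : Primrec f) :
    Primrec fun x => input (f x) :=
  (Primrec.of_equiv_symm (e := equivSum)).comp (g := fun x => .inr (.inl (f x))) (by fun_prop)

@[fun_prop] theorem primrec_test {f : α → TransConstraint} (hf : Primrec f) :
    Primrec fun x => test (f x) :=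
  (Primrec.of_equiv_symm (e := equivSum)).comp (g := fun x => .inr (.inr (.inl (f x))))
    (by fun_prop)

@[fun_prop] theorem primrec_reset {f : α → List ℕ} (hf : Primrec f) :
    Primrec fun x => reset (f x) :=
  (Primrec.of_equiv_symm (e := equivSum)).comp (g := fun x => .inr (.inr (.inr (.inl (f x)))))
    (by fun_prop)

@[fun_prop] theorem primrec_push {f : α → ℕ} {g : α → StackConstraint} (hf : Primrec f)
    (hg : Primrec g) : Primrec fun x => push (f x) (g x) :=
  (Primrec.of_equiv_symm (e := equivSum)).comp
    (g := fun x => .inr (.inr (.inr (.inr (.inl (f x, g x)))))) (by fun_prop)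

@[fun_prop] theorem primrec_pop {f : α → ℕ} {g : α → StackConstraint} (hf : Primrec f)
    (hg : Primrec g) : Primrec fun x => pop (f x) (g x) :=
  (Primrec.of_equiv_symm (e := equivSum)).comp
    (g := fun x => .inr (.inr (.inr (.inr (.inr (f x, g x)))))) (by fun_prop)

/-- Case distinction on operations. -/
def elim {τ : Type} (e : τ) (i : Option ℕ → τ) (t : TransConstraint → τ) (r : List ℕ → τ)
    (pu po : ℕ → StackConstraint → τ) : Op → τ
  | elapse => e
  | input a => i a
  | test φ => t φ
  | reset Y => r Y
  | push γ ψ => pu γ ψ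
  | pop γ ψ => po γ ψ

@[fun_prop] theorem primrec_elim {f : α → Op} {e : α → σ} {i : α → Option ℕ → σ}
    {t : α → TransConstraint → σ} {r : α → List ℕ → σ} {pu po : α → ℕ → StackConstraint → σ}
    (hf : Primrec f) (he : Primrec e) (hi : Primrec fun p : α × Option ℕ => i p.1 p.2)
    (ht : Primrec fun p : α × TransConstraint => t p.1 p.2)
    (hr : Primrec fun p : α × List ℕ => r p.1 p.2)
    (hpu : Primrec fun p : α × ℕ × StackConstraint => pu p.1 p.2.1 p.2.2)
    (hpo : Primrec fun p : α × ℕ × StackConstraint => po p.1 p.2.1 p.2.2) :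
    Primrec fun x => (f x).elim (e x) (i x) (t x) (r x) (pu x) (po x) := by
  have hE : Primrec fun x => equivSum (f x) := Primrec.of_equiv.comp hf
  have : Primrec fun x => (equivSum (f x)).elim (fun _ => e x) (Sum.elim (i x) (Sum.elim (t x)
      (Sum.elim (r x) (Sum.elim (fun p => pu x p.1 p.2) fun p => po x p.1 p.2)))) := by
    refine Primrec.sum_elim_fun hE (by fun_prop) (Primrec.sum_elim_fun Primrec.snd ?_
      (Primrec.sum_elim_fun Primrec.snd ?_ (Primrec.sum_elim_fun Primrec.snd ?_
      (Primrec.sum_elim_fun Primrec.snd ?_ ?_))))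
    · exact hi.comp (g := fun q : (α × _) × Option ℕ => (q.1.1, q.2)) (by fun_prop)
    · exact ht.comp (g := fun q : ((α × _) × _) × TransConstraint => (q.1.1.1, q.2)) (by fun_prop)
    · exact hr.comp (g := fun q : (((α × _) × _) × _) × List ℕ => (q.1.1.1.1, q.2)) (by fun_prop)
    · exact hpu.comp (g := fun q : ((((α × _) × _) × _) × _) × ℕ × StackConstraint =>
        (q.1.1.1.1.1, q.2)) (by fun_prop)
    · exact hpo.comp (g := fun q : ((((α × _) × _) × _) × _) × ℕ × StackConstraint =>
        (q.1.1.1.1.1, q.2)) (by fun_prop)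
  refine this.of_eq fun x => ?_
  cases f x <;> rfl

end Op

namespace Rule

@[fun_prop] theorem primrec_mk {f g : α → ℕ} {o : α → Op} (hf : Primrec f) (ho : Primrec o)
    (hg : Primrec g) : Primrec fun x => Rule.mk (f x) (o x) (g x) :=
  (Primrec.of_equiv_symm (e := equivProd)).comp (g := fun x => (f x, o x, g x)) (by fun_prop)

@[fun_prop] theorem primrec_src {f : α → Rule} (hf : Primrec f) : Primrec fun x => (f x).src :=
  Primrec.fst_fun ((Primrec.of_equiv (e := equivProd)).comp hf)

@[fun_prop] theorem primrec_op {f : α → Rule} (hf : Primrec f) : Primrec fun x => (f x).op :=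
  Primrec.fst_fun (Primrec.snd_fun ((Primrec.of_equiv (e := equivProd)).comp hf))

@[fun_prop] theorem primrec_dst {f : α → Rule} (hf : Primrec f) : Primrec fun x => (f x).dst :=
  Primrec.snd_fun (Primrec.snd_fun ((Primrec.of_equiv (e := equivProd)).comp hf))

end Rule

namespace Automaton

@[fun_prop] theorem primrec_mk {a b c d e : α → ℕ} {r : α → List Rule} (ha : Primrec a)
    (hb : Primrec b) (hc : Primrec c) (hd : Primrec d) (he : Primrec e) (hr : Primrec r) :
    Primrec fun x => Automaton.mk (a x) (b x) (c x) (d x) (e x) (r x) :=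
  (Primrec.of_equiv_symm (e := equivProd)).comp (g := fun x => (a x, b x, c x, d x, e x, r x))
    (by fun_prop)

variable {f : α → Automaton}

theorem primrec_equivProd (hf : Primrec f) : Primrec fun x => equivProd (f x) :=
  (Primrec.of_equiv (e := equivProd)).comp hf

@[fun_prop] theorem primrec_numLoc (hf : Primrec f) : Primrec fun x => (f x).numLoc :=
  Primrec.fst_fun (primrec_equivProd hf)

@[fun_prop] theorem primrec_numInput (hf : Primrec f) : Primrec fun x => (f x).numInput :=
  (primrec_equivProd hf).snd_fun.fst_fun

@[fun_prop] theorem primrec_numStackSym (hf : Primrec f) : Primrec fun x => (f x).numStackSym :=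
  (primrec_equivProd hf).snd_fun.snd_fun.fst_fun

@[fun_prop] theorem primrec_numClock (hf : Primrec f) : Primrec fun x => (f x).numClock :=
  (primrec_equivProd hf).snd_fun.snd_fun.snd_fun.fst_fun

@[fun_prop] theorem primrec_numStackClock (hf : Primrec f) :
    Primrec fun x => (f x).numStackClock :=
  (primrec_equivProd hf).snd_fun.snd_fun.snd_fun.snd_fun.fst_fun

@[fun_prop] theorem primrec_rules (hf : Primrec f) : Primrec fun x => (f x).rules :=
  (primrec_equivProd hf).snd_fun.snd_fun.snd_fun.snd_fun.snd_fun

end Automaton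

namespace LinTerm

variable {K : Type} [Denumerable K]

@[fun_prop] theorem primrec_var {f : α → ℕ} (hf : Primrec f) :
    Primrec fun x => (var (f x) : LinTerm K) := by
  refine Primrec.encode_iff.1 (Primrec.of_eq (f := fun x => 3 * f x) ?_ fun x => rfl)
  fun_prop

@[fun_prop] theorem primrec_const {f : α → K} (hf : Primrec f) :
    Primrec fun x => (const (f x) : LinTerm K) := by
  refine Primrec.encode_iff.1 (Primrec.of_eq (f := fun x => 3 * Encodable.encode (f x) + 1) ?_
    fun x => rfl)
  have := Primrec.encode.comp hf
  fun_prop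

@[fun_prop] theorem primrec_add {f g : α → LinTerm K} (hf : Primrec f) (hg : Primrec g) :
    Primrec fun x => add (f x) (g x) := by
  refine Primrec.encode_iff.1 (Primrec.of_eq
    (f := fun x => 3 * Nat.pair (Encodable.encode (f x)) (Encodable.encode (g x)) + 2) ?_
    fun x => rfl)
  have := Primrec₂.natPair.comp (Primrec.encode.comp hf) (Primrec.encode.comp hg)
  fun_prop

end LinTerm

namespace Formula

@[fun_prop] theorem primrec_zle {s t : α → LinTerm ℤ} (hs : Primrec s) (ht : Primrec t) :
    Primrec fun x => zle (s x) (t x) := by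
  refine Primrec.encode_iff.1 (Primrec.of_eq (f := fun x => 7 * Encodable.encode (s x, t x)) ?_
    fun x => rfl)
  have := Primrec.encode.comp (hs.pair ht)
  fun_prop

@[fun_prop] theorem primrec_zmod {m : α → ℕ+} {s t : α → LinTerm ℤ} (hm : Primrec m)
    (hs : Primrec s) (ht : Primrec t) : Primrec fun x => zmod (m x) (s x) (t x) := by
  refine Primrec.encode_iff.1 (Primrec.of_eq
    (f := fun x => 7 * Encodable.encode (m x, s x, t x) + 1) ?_ fun x => rfl)
  have := Primrec.encode.comp (hm.pair (hs.pair ht))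
  fun_prop

@[fun_prop] theorem primrec_qle {s t : α → LinTerm (ℤ × ℕ+)} (hs : Primrec s) (ht : Primrec t) :
    Primrec fun x => qle (s x) (t x) := by
  refine Primrec.encode_iff.1 (Primrec.of_eq (f := fun x => 7 * Encodable.encode (s x, t x) + 2) ?_
    fun x => rfl)
  have := Primrec.encode.comp (hs.pair ht)
  fun_prop

@[fun_prop] theorem primrec_not {f : α → Formula} (hf : Primrec f) : Primrec fun x => not (f x) := by
  refine Primrec.encode_iff.1 (Primrec.of_eq (f := fun x => 7 * Encodable.encode (f x) + 3) ?_
    fun x => rfl)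
  have := Primrec.encode.comp hf
  fun_prop

@[fun_prop] theorem primrec_and {f g : α → Formula} (hf : Primrec f) (hg : Primrec g) :
    Primrec fun x => and (f x) (g x) := by
  refine Primrec.encode_iff.1 (Primrec.of_eq
    (f := fun x => 7 * Nat.pair (Encodable.encode (f x)) (Encodable.encode (g x)) + 4) ?_
    fun x => rfl)
  have := Primrec₂.natPair.comp (Primrec.encode.comp hf) (Primrec.encode.comp hg)
  fun_prop

@[fun_prop] theorem primrec_exZ {f : α → Formula} (hf : Primrec f) : Primrec fun x => exZ (f x) := by
  refine Primrec.encode_iff.1 (Primrec.of_eq (f := fun x => 7 * Encodable.encode (f x) + 5) ?_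
    fun x => rfl)
  have := Primrec.encode.comp hf
  fun_prop

@[fun_prop] theorem primrec_exQ {f : α → Formula} (hf : Primrec f) : Primrec fun x => exQ (f x) := by
  refine Primrec.encode_iff.1 (Primrec.of_eq (f := fun x => 7 * Encodable.encode (f x) + 6) ?_
    fun x => rfl)
  have := Primrec.encode.comp hf
  fun_prop

end Formula

end Primrec

end TPDA

/-! ## Big-step semantics -/

namespace TPDA

namespace Automaton

/-- Letter counts of a single input operation. -/
def letterCount : Option ℕ → ℕ → ℕ
  | none => 0
  | some a => Pi.single a 1

/-- Balanced runs, which start and end on the same stack level: from a location and a valuation,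
with given letter counts and total time, to a location and a valuation. -/
inductive Balanced (P : Automaton) :
    ℕ → Val P.numClock → (ℕ → ℕ) → ℚ≥0 → ℕ → Val P.numClock → Prop
  | nil (l : ℕ) (μ : Val P.numClock) : Balanced P l μ 0 0 l μ
  | elapse {l l' r : ℕ} {μ ν : Val P.numClock} {π : ℕ → ℕ} {δ' : ℚ≥0} (δ : ℚ≥0)
      (h : Rule.mk l .elapse l' ∈ P.rules) (t : Balanced P l' (fun x => μ x + δ) π δ' r ν) :
      Balanced P l μ π (δ + δ') r ν
  | input {l l' r : ℕ} {μ ν : Val P.numClock} {π : ℕ → ℕ} {δ : ℚ≥0} {a : Option ℕ}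
      (h : Rule.mk l (.input a) l' ∈ P.rules) (t : Balanced P l' μ π δ r ν) :
      Balanced P l μ (letterCount a + π) δ r ν
  | test {l l' r : ℕ} {μ ν : Val P.numClock} {π : ℕ → ℕ} {δ : ℚ≥0} {φ : TransConstraint}
      (h : Rule.mk l (.test φ) l' ∈ P.rules) (hφ : transSat μ φ) (t : Balanced P l' μ π δ r ν) :
      Balanced P l μ π δ r ν
  | reset {l l' r : ℕ} {μ ν : Val P.numClock} {π : ℕ → ℕ} {δ : ℚ≥0} {Y : List ℕ}
      (h : Rule.mk l (.reset Y) l' ∈ P.rules)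
      (t : Balanced P l' (fun x => if (x : ℕ) ∈ Y then 0 else μ x) π δ r ν) :
      Balanced P l μ π δ r ν
  | pushPop {l l₁ r₁ l' r : ℕ} {μ μ₁ ν : Val P.numClock} {π₁ π₂ : ℕ → ℕ} {δ₁ δ₂ : ℚ≥0} {γ : ℕ}
      {ψ ψ' : StackConstraint} (z : Val P.numStackClock)
      (h₁ : Rule.mk l (.push γ ψ) l₁ ∈ P.rules) (hψ : stackSat μ z ψ)
      (t₁ : Balanced P l₁ μ π₁ δ₁ r₁ μ₁)
      (h₂ : Rule.mk r₁ (.pop γ ψ') l' ∈ P.rules) (hψ' : stackSat μ₁ (fun i => z i + δ₁) ψ')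
      (t₂ : Balanced P l' μ₁ π₂ δ₂ r ν) :
      Balanced P l μ (π₁ + π₂) (δ₁ + δ₂) r ν

variable {P : Automaton}

theorem Balanced.trans {l l' r : ℕ} {μ μ' ν : Val P.numClock} {π₁ π₂ : ℕ → ℕ} {δ₁ δ₂ : ℚ≥0}
    (s : Balanced P l μ π₁ δ₁ l' μ') (t : Balanced P l' μ' π₂ δ₂ r ν) :
    Balanced P l μ (π₁ + π₂) (δ₁ + δ₂) r ν := by
  induction s with
  | nil => simpa using t
  | elapse δ h _ ih => rw [add_assoc]; exact .elapse δ h (ih t)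
  | input h _ ih => rw [add_assoc]; exact .input h (ih t)
  | test h hφ _ ih => exact .test h hφ (ih t)
  | reset h _ ih => exact .reset h (ih t)
  | pushPop z h₁ hψ s₁ h₂ hψ' _ _ ih =>
    rw [add_assoc, add_assoc]; exact .pushPop z h₁ hψ s₁ h₂ hψ' (ih t)

/-- Time elapse on a stack. -/
def shiftStack {k : ℕ} (δ : ℚ≥0) (w : List (ℕ × Val k)) : List (ℕ × Val k) :=
  w.map fun s => (s.1, fun z => s.2 z + δ)

theorem shiftStack_zero {k : ℕ} (w : List (ℕ × Val k)) : shiftStack 0 w = w := by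
  simp [shiftStack]

theorem shiftStack_shiftStack {k : ℕ} (δ δ' : ℚ≥0) (w : List (ℕ × Val k)) :
    shiftStack δ (shiftStack δ' w) = shiftStack (δ' + δ) w := by
  simp [shiftStack, add_assoc]

theorem Run.append {c d e : Config P} {u v : List Label} (s : Run P c u d) (t : Run P d v e) :
    Run P c (u ++ v) e := by
  induction s with
  | nil => exact t
  | cons h _ ih => exact .cons h (ih t)

theorem parikh_append (u v : List Label) : parikh (u ++ v) = parikh u + parikh v := by
  funext a; simp [parikh]

theorem parikh_cons (a : Label) (u : List Label) : parikh (a :: u) = parikh [a] + parikh u :=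
  parikh_append [a] u

theorem parikh_time (δ : ℚ≥0) : parikh [.time δ] = 0 := by
  funext a; simp [parikh]

theorem parikh_letter (a : Option ℕ) : parikh [.letter a] = letterCount a := by
  funext b
  cases a with
  | none => simp [parikh, letterCount]
  | some a =>
    by_cases h : b = a
    · subst h; simp [parikh, letterCount]
    · simp [parikh, letterCount, h, Ne.symm h]

theorem Balanced.exists_run {l r : ℕ} {μ ν : Val P.numClock} {π : ℕ → ℕ} {δ : ℚ≥0}
    (s : Balanced P l μ π δ r ν) (w : List (ℕ × Val P.numStackClock)) :
    ∃ u, Run P ⟨l, μ, w⟩ u ⟨r, ν, shiftStack δ w⟩ ∧ parikh u = π := by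
  induction s generalizing w with
  | nil l μ => exact ⟨[], by rw [shiftStack_zero]; exact .nil _, rfl⟩
  | elapse δ h _ ih =>
    obtain ⟨u, hu, e⟩ := ih (shiftStack δ w)
    refine ⟨_, .cons (.elapse δ h) (by rwa [shiftStack_shiftStack] at hu), ?_⟩
    rw [parikh_cons, parikh_time, e, zero_add]
  | input h _ ih =>
    obtain ⟨u, hu, e⟩ := ih w
    refine ⟨_, .cons (.input h) hu, ?_⟩
    rw [parikh_cons, parikh_letter, e]
  | test h hφ _ ih =>
    obtain ⟨u, hu, e⟩ := ih w
    refine ⟨_, .cons (.test h hφ) hu, ?_⟩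
    rw [parikh_cons, parikh_letter, e, letterCount, zero_add]
  | reset h _ ih =>
    obtain ⟨u, hu, e⟩ := ih w
    refine ⟨_, .cons (.reset h) hu, ?_⟩
    rw [parikh_cons, parikh_letter, e, letterCount, zero_add]
  | @pushPop l l₁ r₁ l' r μ μ₁ ν π₁ π₂ δ₁ δ₂ γ ψ ψ' z h₁ hψ _ h₂ hψ' _ ih₁ ih₂ =>
    obtain ⟨u₁, hu₁, e₁⟩ := ih₁ ((γ, z) :: w)
    obtain ⟨u₂, hu₂, e₂⟩ := ih₂ (shiftStack δ₁ w)
    rw [shiftStack_shiftStack] at hu₂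
    refine ⟨_, .cons (.push h₁ hψ) (hu₁.append (.cons (.pop h₂ hψ') hu₂)), ?_⟩
    rw [parikh_cons, parikh_append, parikh_cons _ u₂, parikh_letter, e₁, e₂, letterCount, zero_add,
      zero_add]

/-- A run that empties the stack, cut at the moments when its level decreases for good. -/
inductive Unwind (P : Automaton) : ℕ → Val P.numClock → List (ℕ × Val P.numStackClock) →
    (ℕ → ℕ) → ℕ → Val P.numClock → Prop
  | nil {l r : ℕ} {μ ν : Val P.numClock} {π : ℕ → ℕ} {δ : ℚ≥0} (t : Balanced P l μ π δ r ν) :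
      Unwind P l μ [] π r ν
  | cons {l l₁ r₁ r : ℕ} {μ μ₁ ν : Val P.numClock} {π₁ π₂ : ℕ → ℕ} {δ : ℚ≥0} {γ : ℕ}
      {z : Val P.numStackClock} {w : List (ℕ × Val P.numStackClock)} {ψ : StackConstraint}
      (t : Balanced P l μ π₁ δ l₁ μ₁) (h : Rule.mk l₁ (.pop γ ψ) r₁ ∈ P.rules)
      (hψ : stackSat μ₁ (fun i => z i + δ) ψ) (u : Unwind P r₁ μ₁ (shiftStack δ w) π₂ r ν) :
      Unwind P l μ ((γ, z) :: w) (π₁ + π₂) r ν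

theorem Unwind.prefix {l l' r : ℕ} {μ μ' ν : Val P.numClock} {π₁ π₂ : ℕ → ℕ} {δ : ℚ≥0}
    {w : List (ℕ × Val P.numStackClock)} (t : Balanced P l μ π₁ δ l' μ')
    (u : Unwind P l' μ' (shiftStack δ w) π₂ r ν) : Unwind P l μ w (π₁ + π₂) r ν := by
  cases w with
  | nil => cases u with | nil s => exact .nil (t.trans s)
  | cons f w =>
    obtain ⟨γ, z⟩ := f
    cases u with
    | cons s h hψ u =>
      change Unwind P _ _ (shiftStack _ (shiftStack δ w)) _ _ _ at u
      rw [shiftStack_shiftStack] at u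
      rw [← add_assoc]
      exact .cons (t.trans s) h (by simpa [add_assoc] using hψ) u

theorem Run.unwind {c d : Config P} {u : List Label} (h : Run P c u d) (hd : d.stack = []) :
    Unwind P c.loc c.val c.stack (parikh u) d.loc d.val := by
  induction h with
  | nil c => rw [hd]; exact .nil (.nil _ _)
  | @cons c d e a w s _ ih =>
    have ih := ih hd
    rw [parikh_cons]
    cases s with
    | elapse δ h =>
      rw [parikh_time]
      exact Unwind.prefix (by simpa using Balanced.elapse δ h (.nil _ _)) ih
    | input h =>
      rw [parikh_letter]
      refine Unwind.prefix (δ := 0) (by simpa using Balanced.input h (.nil _ _)) ?_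
      rwa [shiftStack_zero]
    | test h hφ =>
      rw [parikh_letter]
      refine Unwind.prefix (δ := 0) (by simpa [letterCount] using Balanced.test h hφ (.nil _ _)) ?_
      rwa [shiftStack_zero]
    | reset h =>
      rw [parikh_letter]
      refine Unwind.prefix (δ := 0) (by simpa [letterCount] using Balanced.reset h (.nil _ _)) ?_
      rwa [shiftStack_zero]
    | push h hψ =>
      rw [parikh_letter, letterCount, zero_add]
      generalize parikh w = π at ih
      cases ih with
      | cons t h' hψ' u' =>
        exact Unwind.prefix (by simpa using Balanced.pushPop _ h hψ t h' hψ' (.nil _ _)) u'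
    | pop h hψ =>
      rw [parikh_letter, letterCount]
      refine .cons (.nil _ _) h (by simpa using hψ) ?_
      rwa [shiftStack_zero]

/-- The reachability relation in terms of balanced runs. -/
theorem reach_iff {l r : ℕ} {μ ν : Val P.numClock} {π : Fin P.numInput → ℕ} :
    P.Reach l r μ π ν ↔ ∃ π' δ, Balanced P l μ π' δ r ν ∧ ∀ a : Fin P.numInput, π' a = π a := by
  constructor
  · rintro ⟨w, h, e⟩
    have := h.unwind rfl
    cases this with | nil t => exact ⟨_, _, t, e⟩
  · rintro ⟨π', δ, h, e⟩
    obtain ⟨u, hu, rfl⟩ := h.exists_run []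
    exact ⟨u, hu, e⟩

end Automaton

end TPDA

/-! ## Formulas for reachability relations -/

namespace TPDA

namespace LinTerm

variable {K : Type}

theorem eval_append {R : Type} [AddMonoid R] (c : K → R) (ρ ρ' : List R) {t : LinTerm K}
    (h : t.Scoped ρ.length) : t.eval c (ρ ++ ρ') = t.eval c ρ := by
  induction t with
  | var i => exact List.getD_append ρ ρ' 0 i h
  | const k => rfl
  | add s t h₁ h₂ => rw [eval, eval, h₁ h.1, h₂ h.2]

theorem Scoped.mono {t : LinTerm K} {m n : ℕ} (h : t.Scoped m) (hmn : m ≤ n) : t.Scoped n := by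
  induction t with
  | var i => exact lt_of_lt_of_le h hmn
  | const k => trivial
  | add s t h₁ h₂ => exact ⟨h₁ h.1, h₂ h.2⟩

end LinTerm

namespace Formula

theorem sat_append {φ : Formula} {ρ : List ℤ} {σ : List ℚ} (h : φ.Scoped ρ.length σ.length)
    (ρ' : List ℤ) (σ' : List ℚ) : φ.Sat (ρ ++ ρ') (σ ++ σ') ↔ φ.Sat ρ σ := by
  induction φ generalizing ρ σ with
  | zle s t => rw [Sat, Sat, LinTerm.eval_append _ _ _ h.1, LinTerm.eval_append _ _ _ h.2]
  | zmod m s t => rw [Sat, Sat, LinTerm.eval_append _ _ _ h.1, LinTerm.eval_append _ _ _ h.2]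
  | qle s t => rw [Sat, Sat, LinTerm.eval_append _ _ _ h.1, LinTerm.eval_append _ _ _ h.2]
  | not φ ih => exact not_congr (ih h)
  | and φ ψ h₁ h₂ => exact and_congr (h₁ h.1) (h₂ h.2)
  | exZ φ ih => exact exists_congr fun k => ih (ρ := k :: ρ) h
  | exQ φ ih => exact exists_congr fun q => ih (σ := q :: σ) h

theorem Scoped.mono {φ : Formula} {m n m' n' : ℕ} (h : φ.Scoped m m') (hmn : m ≤ n)
    (hmn' : m' ≤ n') : φ.Scoped n n' := by
  induction φ generalizing m n m' n' with
  | zle s t => exact ⟨h.1.mono hmn, h.2.mono hmn⟩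
  | zmod k s t => exact ⟨h.1.mono hmn, h.2.mono hmn⟩
  | qle s t => exact ⟨h.1.mono hmn', h.2.mono hmn'⟩
  | not φ ih => exact ih h hmn hmn'
  | and φ ψ h₁ h₂ => exact ⟨h₁ h.1 hmn hmn', h₂ h.2 hmn hmn'⟩
  | exZ φ ih => exact ih h (by omega) hmn'
  | exQ φ ih => exact ih h hmn (by omega)

theorem sat_iterate_exZ {φ : Formula} {k : ℕ} {ρ : List ℤ} {σ : List ℚ} :
    (exZ^[k] φ).Sat ρ σ ↔ ∃ z : List ℤ, z.length = k ∧ φ.Sat (z ++ ρ) σ := by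
  induction k generalizing ρ with
  | zero => simp
  | succ k ih =>
    rw [Function.iterate_succ_apply', Sat]
    constructor
    · rintro ⟨a, h⟩
      obtain ⟨z, hz, h⟩ := ih.1 h
      exact ⟨z ++ [a], by simp [hz], by simpa using h⟩
    · rintro ⟨z, hz, h⟩
      have hne : z ≠ [] := by rintro rfl; simp at hz
      refine ⟨z.getLast hne, ih.2 ⟨z.dropLast, by simp [hz], ?_⟩⟩
      have := List.dropLast_append_getLast hne
      rw [← this] at h
      simpa using h

theorem sat_iterate_exQ {φ : Formula} {k : ℕ} {ρ : List ℤ} {σ : List ℚ} :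
    (exQ^[k] φ).Sat ρ σ ↔ ∃ z : List ℚ, z.length = k ∧ φ.Sat ρ (z ++ σ) := by
  induction k generalizing σ with
  | zero => simp
  | succ k ih =>
    rw [Function.iterate_succ_apply', Sat]
    constructor
    · rintro ⟨a, h⟩
      obtain ⟨z, hz, h⟩ := ih.1 h
      exact ⟨z ++ [a], by simp [hz], by simpa using h⟩
    · rintro ⟨z, hz, h⟩
      have hne : z ≠ [] := by rintro rfl; simp at hz
      refine ⟨z.getLast hne, ih.2 ⟨z.dropLast, by simp [hz], ?_⟩⟩
      have := List.dropLast_append_getLast hne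
      rw [← this] at h
      simpa using h

theorem scoped_iterate_exZ {φ : Formula} {k m n : ℕ} :
    (exZ^[k] φ).Scoped m n ↔ φ.Scoped (m + k) n := by
  induction k generalizing m with
  | zero => rfl
  | succ k ih => rw [Function.iterate_succ_apply', Scoped, ih, add_right_comm, add_assoc]

theorem scoped_iterate_exQ {φ : Formula} {k m n : ℕ} :
    (exQ^[k] φ).Scoped m n ↔ φ.Scoped m (n + k) := by
  induction k generalizing n with
  | zero => rfl
  | succ k ih => rw [Function.iterate_succ_apply', Scoped, ih, add_right_comm, add_assoc]

/-- A true formula. -/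
def tru : Formula := zle (.const 0) (.const 0)

/-- Conjunction of a list. -/
def conj (l : List Formula) : Formula := l.foldr and tru

/-- Disjunction. -/
def or (φ ψ : Formula) : Formula := not (and (not φ) (not ψ))

/-- Disjunction of a list. -/
def disj (l : List Formula) : Formula := l.foldr or (not tru)

/-- Equality of integer terms. -/
def zeq (s t : LinTerm ℤ) : Formula := and (zle s t) (zle t s)

/-- Equality of rational terms. -/
def qeq (s t : LinTerm (ℤ × ℕ+)) : Formula := and (qle s t) (qle t s)

variable {ρ : List ℤ} {σ : List ℚ} {l : List Formula} {n k : ℕ}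

@[simp] theorem sat_tru : tru.Sat ρ σ := le_rfl

@[simp] theorem scoped_tru : tru.Scoped n k := ⟨trivial, trivial⟩

@[simp] theorem sat_conj : (conj l).Sat ρ σ ↔ ∀ φ ∈ l, φ.Sat ρ σ := by
  induction l with
  | nil => simp [conj]
  | cons φ l ih => rw [List.forall_mem_cons, ← ih]; rfl

@[simp] theorem sat_or {φ ψ : Formula} : (or φ ψ).Sat ρ σ ↔ φ.Sat ρ σ ∨ ψ.Sat ρ σ := by
  simp only [or, Sat]; tauto

@[simp] theorem sat_disj : (disj l).Sat ρ σ ↔ ∃ φ ∈ l, φ.Sat ρ σ := by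
  induction l with
  | nil => simp [disj, Sat]
  | cons φ l ih => rw [List.exists_mem_cons_iff, ← ih]; exact sat_or

@[simp] theorem scoped_conj : (conj l).Scoped n k ↔ ∀ φ ∈ l, φ.Scoped n k := by
  induction l with
  | nil => simp [conj]
  | cons φ l ih => rw [List.forall_mem_cons, ← ih]; rfl

@[simp] theorem scoped_disj : (disj l).Scoped n k ↔ ∀ φ ∈ l, φ.Scoped n k := by
  induction l with
  | nil => simp [disj, Scoped]
  | cons φ l ih => rw [List.forall_mem_cons, ← ih]; rfl

@[simp] theorem sat_qeq {s t : LinTerm (ℤ × ℕ+)} : (qeq s t).Sat ρ σ ↔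
    s.eval (fun c => (c.1 : ℚ) / ((c.2 : ℕ) : ℚ)) σ =
      t.eval (fun c => (c.1 : ℚ) / ((c.2 : ℕ) : ℚ)) σ := by
  simp [qeq, Sat, le_antisymm_iff]

@[simp] theorem sat_zeq {s t : LinTerm ℤ} : (zeq s t).Sat ρ σ ↔ s.eval id ρ = t.eval id ρ := by
  simp [zeq, Sat, le_antisymm_iff]

section Primrec

variable {α : Type} [Primcodable α]

@[fun_prop] theorem primrec_conj {f : α → List Formula} (hf : Primrec f) :
    Primrec fun x => conj (f x) := by unfold conj; fun_prop

@[fun_prop] theorem primrec_or {f g : α → Formula} (hf : Primrec f) (hg : Primrec g) :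
    Primrec fun x => or (f x) (g x) := by unfold or; fun_prop

@[fun_prop] theorem primrec_disj {f : α → List Formula} (hf : Primrec f) :
    Primrec fun x => disj (f x) := by unfold disj; fun_prop

@[fun_prop] theorem primrec_zeq {f g : α → LinTerm ℤ} (hf : Primrec f) (hg : Primrec g) :
    Primrec fun x => zeq (f x) (g x) := by unfold zeq; fun_prop

@[fun_prop] theorem primrec_qeq {f g : α → LinTerm (ℤ × ℕ+)} (hf : Primrec f) (hg : Primrec g) :
    Primrec fun x => qeq (f x) (g x) := by unfold qeq; fun_prop

end Primrec

end Formula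

namespace Automaton

/-! ### Adding one clock and one letter -/

/-- Conditions on the values of the variables for an automaton with one more clock and one more
letter, followed by the variables for the given automaton. -/
def linkFormula (n s : ℕ) : Formula :=
  .conj <|
    ((List.range n).flatMap fun i =>
      [.zeq (.var i) (.var (2 * n + s + 3 + i)),
        .zeq (.var (n + s + 2 + i)) (.var (2 * n + s + 3 + n + s + i)),
        .qeq (.var i) (.var (2 * n + 2 + i)),
        .qeq (.var (n + 1 + i)) (.var (2 * n + 2 + n + i))]) ++
    ((List.range s).map fun a => .zeq (.var (n + 1 + a)) (.var (2 * n + s + 3 + n + a))) ++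
    [.zle (.const 0) (.var n), .zle (.const 0) (.var (n + 1 + s)),
      .zle (.const 0) (.var (2 * n + s + 2)),
      .qle (.const (0, 1)) (.var n), .qle (.const (0, 1)) (.var (2 * n + 1)),
      .not (.qle (.const (1, 1)) (.var n)), .not (.qle (.const (1, 1)) (.var (2 * n + 1)))]

/-- Elimination of the additional clock and letter. -/
def project (n s : ℕ) (φ : Formula) : Formula :=
  Formula.exZ^[2 * n + s + 3] (Formula.exQ^[2 * n + 2] (.and (linkFormula n s) φ))

theorem scoped_project {n s : ℕ} {φ : Formula} (h : φ.Scoped (2 * n + s + 3) (2 * n + 2)) :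
    (project n s φ).Scoped (n + s + n) (n + n) := by
  rw [project, Formula.scoped_iterate_exZ, Formula.scoped_iterate_exQ]
  refine ⟨?_, h.mono (by omega) (by omega)⟩
  simp only [linkFormula, Formula.scoped_conj, List.mem_append, List.mem_flatMap, List.mem_map,
    List.mem_range, List.mem_cons, List.not_mem_nil, or_false]
  rintro φ ((⟨i, hi, rfl | rfl | rfl | rfl⟩ | ⟨a, ha, rfl⟩) | rfl | rfl | rfl | rfl | rfl | rfl |
    rfl) <;> simp only [Formula.zeq, Formula.qeq, Formula.Scoped, LinTerm.Scoped, true_and] <;> omega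

theorem getD_ofFn {n : ℕ} {β : Type} (f : Fin n → β) (d : β) {i : ℕ} (h : i < n) :
    (List.ofFn f).getD i d = f ⟨i, h⟩ := by
  rw [List.getD_eq_getElem _ _ (by simpa using h)]; simp

theorem getD_append_right' {β : Type} (l l' : List β) (d : β) (i : ℕ) :
    (l ++ l').getD (l.length + i) d = l'.getD i d := by
  rw [List.getD_append_right _ _ _ _ (by omega), Nat.add_sub_cancel_left]

theorem Val.get_of_lt {n i : ℕ} (μ : Val n) (h : i < n) : μ.get i = μ ⟨i, h⟩ := dif_pos h

section Env

variable {n s : ℕ} (μ : Val n) (π : Fin s → ℕ) (ν : Val n)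

theorem length_intEnv : (intEnv μ π ν).length = n + s + n := by simp [intEnv, add_assoc]

theorem length_ratEnv : (ratEnv μ ν).length = n + n := by simp [ratEnv]

theorem intEnv_left {i : ℕ} (h : i < n) : (intEnv μ π ν).getD i 0 = ⌊(μ.get i : ℚ)⌋ := by
  rw [intEnv, List.append_assoc, List.getD_append _ _ _ _ (by simpa using h), getD_ofFn _ _ h,
    μ.get_of_lt h]

theorem intEnv_mid {a : ℕ} (h : a < s) : (intEnv μ π ν).getD (n + a) 0 = π ⟨a, h⟩ := by
  have := getD_append_right' (List.ofFn fun x => ⌊(μ x : ℚ)⌋)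
    ((List.ofFn fun a => (π a : ℤ)) ++ List.ofFn fun x => ⌊(ν x : ℚ)⌋) 0 a
  rw [List.length_ofFn] at this
  rw [intEnv, List.append_assoc, this, List.getD_append _ _ _ _ (by simpa using h), getD_ofFn _ _ h]

theorem intEnv_right {i : ℕ} (h : i < n) :
    (intEnv μ π ν).getD (n + s + i) 0 = ⌊(ν.get i : ℚ)⌋ := by
  have := getD_append_right' ((List.ofFn fun x => ⌊(μ x : ℚ)⌋) ++ (List.ofFn fun a => (π a : ℤ)))
    (List.ofFn fun x => ⌊(ν x : ℚ)⌋) 0 i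
  rw [List.length_append, List.length_ofFn, List.length_ofFn] at this
  rw [intEnv, this, getD_ofFn _ _ h, ν.get_of_lt h]

theorem ratEnv_left {i : ℕ} (h : i < n) :
    (ratEnv μ ν).getD i 0 = Int.fract (μ.get i : ℚ) := by
  rw [ratEnv, List.getD_append _ _ _ _ (by simpa using h), getD_ofFn _ _ h, μ.get_of_lt h]

theorem ratEnv_right {i : ℕ} (h : i < n) :
    (ratEnv μ ν).getD (n + i) 0 = Int.fract (ν.get i : ℚ) := by
  have := getD_append_right' (List.ofFn fun x => Int.fract (μ x : ℚ))
    (List.ofFn fun x => Int.fract (ν x : ℚ)) 0 i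
  rw [List.length_ofFn] at this
  rw [ratEnv, this, getD_ofFn _ _ h, ν.get_of_lt h]

end Env

/-- Extension of a valuation by one clock. -/
def Val.snoc {n : ℕ} (μ : Val n) (q : ℚ≥0) : Val (n + 1) := Fin.snoc (α := fun _ => ℚ≥0) μ q

theorem Val.snoc_get {n : ℕ} (μ : Val n) (q : ℚ≥0) {i : ℕ} (h : i < n) :
    (μ.snoc q).get i = μ.get i := by
  rw [Val.get_of_lt _ (by omega), Val.get_of_lt _ h, snoc, Fin.snoc, dif_pos (by exact h)]
  rfl

theorem Val.snoc_get_last {n : ℕ} (μ : Val n) (q : ℚ≥0) : (μ.snoc q).get n = q := by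
  rw [Val.get_of_lt _ (by omega), snoc, Fin.snoc, dif_neg (by simp)]
  rfl

theorem exists_mem_map' {β γ : Type} {f : β → γ} {l : List β} {p : γ → Prop} :
    (∃ c ∈ l.map f, p c) ↔ ∃ b ∈ l, p (f b) := by simp

theorem list_ext_getD {β : Type} {l l' : List β} (d : β) (h : l.length = l'.length)
    (e : ∀ i < l.length, l.getD i d = l'.getD i d) : l = l' := by
  refine List.ext_getElem h fun i h₁ h₂ => ?_
  simpa [List.getD_eq_getElem, h₁, h₂] using e i h₁

theorem sat_linkFormula {n s : ℕ} {z ρ : List ℤ} {q σ : List ℚ} (hz : z.length = 2 * n + s + 3)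
    (hq : q.length = 2 * n + 2) :
    (linkFormula n s).Sat (z ++ ρ) (q ++ σ) ↔
      (∀ i < n, z.getD i 0 = ρ.getD i 0 ∧ z.getD (n + s + 2 + i) 0 = ρ.getD (n + s + i) 0 ∧
        q.getD i 0 = σ.getD i 0 ∧ q.getD (n + 1 + i) 0 = σ.getD (n + i) 0) ∧
      (∀ a < s, z.getD (n + 1 + a) 0 = ρ.getD (n + a) 0) ∧
      0 ≤ z.getD n 0 ∧ 0 ≤ z.getD (n + 1 + s) 0 ∧ 0 ≤ z.getD (2 * n + s + 2) 0 ∧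
      0 ≤ q.getD n 0 ∧ 0 ≤ q.getD (2 * n + 1) 0 ∧ q.getD n 0 < 1 ∧ q.getD (2 * n + 1) 0 < 1 := by
  have z1 : ∀ i < 2 * n + s + 3, (z ++ ρ).getD i 0 = z.getD i 0 := fun i hi =>
    List.getD_append _ _ _ _ (by omega)
  have z2 : ∀ i, (z ++ ρ).getD (2 * n + s + 3 + i) 0 = ρ.getD i 0 := fun i => by
    rw [← hz, getD_append_right']
  have q1 : ∀ i < 2 * n + 2, (q ++ σ).getD i 0 = q.getD i 0 := fun i hi =>
    List.getD_append _ _ _ _ (by omega)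
  have q2 : ∀ i, (q ++ σ).getD (2 * n + 2 + i) 0 = σ.getD i 0 := fun i => by
    rw [← hq, getD_append_right']
  have c0 : ((0 : ℤ) : ℚ) / (((1 : ℕ+) : ℕ) : ℚ) = 0 := by simp
  have c1 : ((1 : ℤ) : ℚ) / (((1 : ℕ+) : ℕ) : ℚ) = 1 := by simp
  rw [linkFormula, Formula.sat_conj, List.forall_mem_append, List.forall_mem_append,
    List.forall_mem_flatMap, List.forall_mem_map, and_assoc]
  refine and_congr ?_ (and_congr ?_ ?_)
  · refine forall_congr' fun i => ?_
    rw [List.mem_range]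
    refine imp_congr_right fun hi => ?_
    have e1 : 2 * n + s + 3 + n + s + i = 2 * n + s + 3 + (n + s + i) := by ring
    have e2 : 2 * n + 2 + n + i = 2 * n + 2 + (n + i) := by ring
    simp only [List.forall_mem_cons, Formula.sat_zeq, Formula.sat_qeq, LinTerm.eval,
      List.not_mem_nil, false_imp_iff, implies_true, and_true, e1, e2, z2, q2,
      z1 i (by omega), z1 (n + s + 2 + i) (by omega), q1 i (by omega), q1 (n + 1 + i) (by omega)]
  · refine forall_congr' fun a => ?_
    rw [List.mem_range]
    refine imp_congr_right fun ha => ?_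
    rw [add_assoc _ n a]
    simp only [Formula.sat_zeq, LinTerm.eval, z2, z1 (n + 1 + a) (by omega)]
  · simp only [List.forall_mem_cons, Formula.Sat, LinTerm.eval, id, List.not_mem_nil,
      false_imp_iff, implies_true, and_true, not_le, c0, c1, z1 n (by omega),
      z1 (n + 1 + s) (by omega), z1 (2 * n + s + 2) (by omega), q1 n (by omega),
      q1 (2 * n + 1) (by omega)]

theorem exists_nnrat {k : ℤ} {f : ℚ} (hk : 0 ≤ k) (hf : 0 ≤ f) (hf' : f < 1) :
    ∃ p : ℚ≥0, ⌊(p : ℚ)⌋ = k ∧ Int.fract (p : ℚ) = f := by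
  have h0 : (0 : ℚ) ≤ k + f := add_nonneg (by exact_mod_cast hk) hf
  refine ⟨⟨k + f, h0⟩, ?_, ?_⟩
  · change ⌊(k + f : ℚ)⌋ = k
    rw [Int.floor_intCast_add, Int.floor_eq_zero_iff.2 ⟨hf, hf'⟩, add_zero]
  · change Int.fract (k + f : ℚ) = f
    rw [Int.fract_intCast_add, Int.fract_eq_self.2 ⟨hf, hf'⟩]

theorem sat_project {n s : ℕ} {φ : Formula} (h : φ.Scoped (2 * n + s + 3) (2 * n + 2)) (μ : Val n)
    (π : Fin s → ℕ) (ν : Val n) :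
    (project n s φ).Sat (intEnv μ π ν) (ratEnv μ ν) ↔
      ∃ (p q : ℚ≥0) (t : ℕ), φ.Sat
        (intEnv (μ.snoc p) (Fin.snoc (α := fun _ => ℕ) π t : Fin (s + 1) → ℕ) (ν.snoc q))
        (ratEnv (μ.snoc p) (ν.snoc q)) := by
  rw [project, Formula.sat_iterate_exZ]
  simp only [Formula.sat_iterate_exQ]
  have cast_snoc : ∀ (t a : ℕ) (h : a < s),
      (Fin.snoc (α := fun _ => ℕ) π t : Fin (s + 1) → ℕ) ⟨a, by omega⟩ = π ⟨a, h⟩ := by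
    intro t a h; simp [Fin.snoc, h]
  have last_snoc : ∀ (t : ℕ),
      (Fin.snoc (α := fun _ => ℕ) π t : Fin (s + 1) → ℕ) ⟨s, by omega⟩ = t := by
    intro t; simp [Fin.snoc]
  constructor
  · rintro ⟨z, hz, q, hq, hl, hφ⟩
    obtain ⟨h1, h2, a1, a2, a3, b1, b2, b3, b4⟩ := (sat_linkFormula hz hq).1 hl
    obtain ⟨x, hx, hx'⟩ := exists_nnrat a1 b1 b3
    obtain ⟨y, hy, hy'⟩ := exists_nnrat a3 b2 b4
    obtain ⟨t, ht⟩ := Int.eq_ofNat_of_zero_le a2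
    refine ⟨x, y, t, ?_⟩
    rw [Formula.sat_append (by rwa [hz, hq])] at hφ
    convert hφ using 1
    · refine list_ext_getD 0 (by rw [length_intEnv, hz]; ring) fun i hi => ?_
      rw [length_intEnv] at hi
      rcases lt_or_ge i (n + 1) with h | h
      · rw [intEnv_left _ _ _ h]
        rcases (Nat.lt_succ_iff_lt_or_eq.1 h) with h | rfl
        · rw [Val.snoc_get _ _ h, (h1 i h).1, intEnv_left _ _ _ h]
        · rw [Val.snoc_get_last, hx]
      · obtain ⟨i, rfl⟩ := Nat.exists_eq_add_of_le h
        rcases lt_or_ge i (s + 1) with h | h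
        · rw [intEnv_mid _ _ _ h]
          rcases (Nat.lt_succ_iff_lt_or_eq.1 h) with h | rfl
          · rw [cast_snoc t i h, h2 i h, intEnv_mid _ _ _ h]
          · rw [last_snoc, ht]
        · obtain ⟨i, rfl⟩ := Nat.exists_eq_add_of_le h
          have h : i < n + 1 := by omega
          rw [← add_assoc, intEnv_right _ _ _ h]
          rcases (Nat.lt_succ_iff_lt_or_eq.1 h) with h | rfl
          · have e : n + 1 + (s + 1) + i = n + s + 2 + i := by ring
            rw [Val.snoc_get _ _ h, e, (h1 i h).2.1, intEnv_right _ _ _ h]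
          · have e : i + 1 + (s + 1) + i = 2 * i + s + 2 := by ring
            rw [Val.snoc_get_last, e, hy]
    · refine list_ext_getD 0 (by rw [length_ratEnv, hq]; ring) fun i hi => ?_
      rw [length_ratEnv] at hi
      rcases lt_or_ge i (n + 1) with h | h
      · rw [ratEnv_left _ _ h]
        rcases (Nat.lt_succ_iff_lt_or_eq.1 h) with h | rfl
        · rw [Val.snoc_get _ _ h, (h1 i h).2.2.1, ratEnv_left _ _ h]
        · rw [Val.snoc_get_last, hx']
      · obtain ⟨i, rfl⟩ := Nat.exists_eq_add_of_le h
        have h : i < n + 1 := by omega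
        rw [ratEnv_right _ _ h]
        rcases (Nat.lt_succ_iff_lt_or_eq.1 h) with h | rfl
        · rw [Val.snoc_get _ _ h, (h1 i h).2.2.2, ratEnv_right _ _ h]
        · have e : i + 1 + i = 2 * i + 1 := by ring
          rw [Val.snoc_get_last, e, hy']
  · rintro ⟨p, q, t, hφ⟩
    have hz := length_intEnv (μ.snoc p) (Fin.snoc (α := fun _ => ℕ) π t : Fin (s + 1) → ℕ) (ν.snoc q)
    have hq := length_ratEnv (μ.snoc p) (ν.snoc q)
    have ez : n + 1 + (s + 1) + (n + 1) = 2 * n + s + 3 := by ring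
    have eq : n + 1 + (n + 1) = 2 * n + 2 := by ring
    rw [ez] at hz
    rw [eq] at hq
    refine ⟨_, hz, _, hq, (sat_linkFormula hz hq).2 ⟨fun i hi => ⟨?_, ?_, ?_, ?_⟩, fun a ha => ?_,
      ?_, ?_, ?_, ?_, ?_, ?_, ?_⟩, (Formula.sat_append (by rwa [hz, hq]) _ _).2 hφ⟩
    · rw [intEnv_left _ _ _ (by omega), intEnv_left _ _ _ hi, Val.snoc_get _ _ hi]
    · have e : n + s + 2 + i = n + 1 + (s + 1) + i := by ring
      rw [e, intEnv_right _ _ _ (by omega), intEnv_right _ _ _ hi, Val.snoc_get _ _ hi]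
    · rw [ratEnv_left _ _ (by omega), ratEnv_left _ _ hi, Val.snoc_get _ _ hi]
    · rw [ratEnv_right _ _ (by omega), ratEnv_right _ _ hi, Val.snoc_get _ _ hi]
    · rw [intEnv_mid _ _ _ (by omega), intEnv_mid _ _ _ ha, cast_snoc t a ha]
    · rw [intEnv_left _ _ _ (by omega)]; exact Int.floor_nonneg.2 (NNRat.coe_nonneg _)
    · rw [intEnv_mid _ _ _ (by omega)]; exact Int.natCast_nonneg _
    · have e : 2 * n + s + 2 = n + 1 + (s + 1) + n := by ring
      rw [e, intEnv_right _ _ _ (by omega)]; exact Int.floor_nonneg.2 (NNRat.coe_nonneg _)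
    · rw [ratEnv_left _ _ (by omega)]; exact Int.fract_nonneg _
    · have e : 2 * n + 1 = n + 1 + n := by ring
      rw [e, ratEnv_right _ _ (by omega)]; exact Int.fract_nonneg _
    · rw [ratEnv_left _ _ (by omega)]; exact Int.fract_lt_one _
    · have e : 2 * n + 1 = n + 1 + n := by ring
      rw [e, ratEnv_right _ _ (by omega)]; exact Int.fract_lt_one _

/-- Formulas for the reachability relation of an automaton from those for another one with one
more clock and one more letter. -/
def reduceFamily (P : Automaton) (L : ℕ → ℕ → List (ℕ × ℕ × Formula)) (Φ : Family) : Family :=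
  (List.range P.numLoc).map fun l => (List.range P.numLoc).map fun r =>
    .disj ((L l r).map fun e =>
      project P.numClock P.numInput (.and e.2.2 ((Φ.getD e.1 []).getD e.2.1 .tru)))

theorem expresses_reduceFamily {P : Automaton} {nl g k : ℕ} {R : List Rule}
    {L : ℕ → ℕ → List (ℕ × ℕ × Formula)} {Φ : Family}
    (hΦ : Expresses ⟨nl, P.numInput + 1, g, P.numClock + 1, k, R⟩ Φ)
    (hL : ∀ l < P.numLoc, ∀ r < P.numLoc, ∀ e ∈ L l r, e.1 < nl ∧ e.2.1 < nl ∧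
      e.2.2.Scoped (2 * P.numClock + P.numInput + 3) (2 * P.numClock + 2))
    (hR : ∀ l < P.numLoc, ∀ r < P.numLoc, ∀ (μ : Val P.numClock) (π : Fin P.numInput → ℕ)
      (ν : Val P.numClock), P.Reach l r μ π ν ↔
        ∃ e ∈ L l r, ∃ (p q : ℚ≥0) (t : ℕ),
          e.2.2.Sat (intEnv (μ.snoc p) (Fin.snoc (α := fun _ => ℕ) π t : Fin (P.numInput + 1) → ℕ)
            (ν.snoc q)) (ratEnv (μ.snoc p) (ν.snoc q)) ∧
          Reach ⟨nl, P.numInput + 1, g, P.numClock + 1, k, R⟩ e.1 e.2.1 (μ.snoc p)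
            (Fin.snoc (α := fun _ => ℕ) π t : Fin (P.numInput + 1) → ℕ) (ν.snoc q)) :
    P.Expresses (P.reduceFamily L Φ) := by
  intro l hl r hr
  have key : ∀ e ∈ L l r,
      ((Φ.getD e.1 []).getD e.2.1 .tru).Scoped (2 * P.numClock + P.numInput + 3)
        (2 * P.numClock + 2) ∧
      ∀ (μ : Val (P.numClock + 1)) (π : Fin (P.numInput + 1) → ℕ) (ν : Val (P.numClock + 1)),
        Reach ⟨nl, P.numInput + 1, g, P.numClock + 1, k, R⟩ e.1 e.2.1 μ π ν ↔
          ((Φ.getD e.1 []).getD e.2.1 .tru).Sat (intEnv μ π ν) (ratEnv μ ν) := by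
    intro e he
    obtain ⟨h₁, h₂, -⟩ := hL l hl r hr e he
    obtain ⟨φ, ⟨row, hrow, hφ⟩, hs, h⟩ := hΦ e.1 h₁ e.2.1 h₂
    have e1 : (Φ.getD e.1 []).getD e.2.1 .tru = φ := by
      simp [List.getD_eq_getElem?_getD, hrow, hφ]
    rw [e1]
    refine ⟨?_, h⟩
    have a1 : P.numClock + 1 + (P.numInput + 1) + (P.numClock + 1) =
      2 * P.numClock + P.numInput + 3 := by omega
    have a2 : P.numClock + 1 + (P.numClock + 1) = 2 * P.numClock + 2 := by omega
    simpa only [a1, a2] using hs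
  have hsc : ∀ e ∈ L l r, (Formula.and e.2.2 ((Φ.getD e.1 []).getD e.2.1 .tru)).Scoped
      (2 * P.numClock + P.numInput + 3) (2 * P.numClock + 2) := fun e he =>
    ⟨(hL l hl r hr e he).2.2, (key e he).1⟩
  refine ⟨_, ⟨_, by rw [reduceFamily, List.getElem?_map, List.getElem?_range hl]; rfl,
    by rw [List.getElem?_map, List.getElem?_range hr]; rfl⟩, ?_, fun μ π ν => ?_⟩
  · simp only [Formula.scoped_disj, List.forall_mem_map]
    exact fun e he => scoped_project (hsc e he)
  · rw [hR l hl r hr, Formula.sat_disj]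
    rw [exists_mem_map']
    refine exists_congr fun e => and_congr_right fun he => ?_
    rw [sat_project (hsc e he)]
    refine exists_congr fun p => exists_congr fun q => exists_congr fun t => ?_
    exact and_congr_right' ((key e he).2 _ _ _)

section Primrec

variable {α : Type} [Primcodable α]

@[fun_prop] theorem primrec_linkFormula {n s : α → ℕ} (hn : Primrec n) (hs : Primrec s) :
    Primrec fun x => linkFormula (n x) (s x) := by
  unfold linkFormula
  fun_prop

@[fun_prop] theorem primrec_project {n s : α → ℕ} {φ : α → Formula} (hn : Primrec n)
    (hs : Primrec s) (hφ : Primrec φ) : Primrec fun x => project (n x) (s x) (φ x) := by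
  unfold project
  fun_prop

theorem computable_reduceFamily {L : Automaton → ℕ → ℕ → List (ℕ × ℕ × Formula)}
    (hL : Primrec fun p : Automaton × ℕ × ℕ => L p.1 p.2.1 p.2.2) :
    Computable₂ fun (P : Automaton) Φ => P.reduceFamily (L P) Φ := by
  refine Primrec.to_comp (?_ : Primrec fun p : Automaton × Family => p.1.reduceFamily (L p.1) p.2)
  unfold reduceFamily
  have h : Primrec fun p : ((Automaton × Family) × ℕ) × ℕ => L p.1.1.1 p.1.2 p.2 :=
    hL.comp (g := fun p : ((Automaton × Family) × ℕ) × ℕ => (p.1.1.1, p.1.2, p.2)) (by fun_prop)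
  refine Primrec.map_fun (by fun_prop) (Primrec.map_fun (by fun_prop)
    (Formula.primrec_disj (Primrec.map_fun h ?_)))
  refine primrec_project (by fun_prop) (by fun_prop) (Formula.primrec_and (by fun_prop) ?_)
  exact Primrec.getD_fun (Primrec.getD_fun (by fun_prop) (by fun_prop)) (by fun_prop)

end Primrec

/-! ### Composition of reductions -/

theorem EffectiveReduction.comp {A B B' C : Automaton → Prop} {T T' : Automaton → Automaton}
    (h : EffectiveReduction A B T) (h' : EffectiveReduction B' C T') (hB : ∀ P, B P → B' P) :
    EffectiveReduction A C fun P => T' (T P) := by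
  obtain ⟨hT, hv, F, hF, hE⟩ := h
  obtain ⟨hT', hv', F', hF', hE'⟩ := h'
  refine ⟨hT'.comp hT, fun P hP hA => ?_, fun P Φ => F P (F' (T P) Φ), ?_, fun P hP hA Φ hΦ => ?_⟩
  · obtain ⟨h1, h2⟩ := hv P hP hA
    exact hv' _ h1 (hB _ h2)
  · exact hF.comp Computable.fst (hF'.comp (hT.comp Computable.fst) Computable.snd)
  · obtain ⟨h1, h2⟩ := hv P hP hA
    exact hE P hP hA _ (hE' _ h1 (hB _ h2) _ hΦ)

theorem EffectiveReduction.mono {A A' B B' : Automaton → Prop} {T : Automaton → Automaton}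
    (h : EffectiveReduction A B T) (hA : ∀ P, A' P → A P) (hB : ∀ P, B P → B' P) :
    EffectiveReduction A' B' T := by
  obtain ⟨hT, hv, F, hF, hE⟩ := h
  exact ⟨hT, fun P hP h => ⟨(hv P hP (hA P h)).1, hB _ (hv P hP (hA P h)).2⟩, F, hF,
    fun P hP h => hE P hP (hA P h)⟩

end Automaton

end TPDA

/-! ## Integers up to a threshold and a modulus -/

namespace TPDA

/-- Integers that agree modulo `M` and agree exactly if one of them is at most `K` in absolute
value. -/
def Sim (K M : ℕ) (d e : ℤ) : Prop :=
  d ≡ e [ZMOD M] ∧ (d = e ∨ ((K : ℤ) < d ∧ (K : ℤ) < e) ∨ (d < -K ∧ e < -K))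

namespace Sim

variable {K K' M : ℕ} {d e d' e' : ℤ}

theorem refl (K M : ℕ) (d : ℤ) : Sim K M d d := ⟨rfl, .inl rfl⟩

theorem symm (h : Sim K M d e) : Sim K M e d :=
  ⟨h.1.symm, by have := h.2; omega⟩

theorem trans (h : Sim K M d e) (h' : Sim K M e e') : Sim K M d e' :=
  ⟨h.1.trans h'.1, by have := h.2; have := h'.2; omega⟩

theorem neg (h : Sim K M d e) : Sim K M (-d) (-e) :=
  ⟨h.1.neg, by have := h.2; omega⟩

theorem mono (h : Sim K M d e) (hK : K' ≤ K) : Sim K' M d e :=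
  ⟨h.1, by have := h.2; omega⟩

theorem add (h : Sim K M d e) (h' : Sim K M d' e') (hd : 0 ≤ d) (hd' : 0 ≤ d') :
    Sim K M (d + d') (e + e') :=
  ⟨h.1.add h'.1, by have := h.2; have := h'.2; omega⟩

theorem nonneg (h : Sim K M d e) (hd : 0 ≤ d) : 0 ≤ e := by have := h.2; omega

theorem eq_zero (h : Sim K M d e) (hd : d = 0) : e = 0 := by have := h.2; omega

end Sim

/-- A number with the given residue in a half-open interval of length `M`. -/
theorem exists_modEq_mem_Ioc (M : ℕ) (hM : 0 < M) (a c : ℤ) :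
    ∃ x, x ≡ c [ZMOD M] ∧ a < x ∧ x ≤ a + M := by
  refine ⟨a + 1 + (c - (a + 1)) % M, ?_, ?_, ?_⟩
  · have : a + 1 + (c - (a + 1)) % M ≡ a + 1 + (c - (a + 1)) [ZMOD M] :=
      (Int.mod_modEq _ _).add_left _
    simpa using this
  · have := Int.emod_nonneg (c - (a + 1)) (b := M) (by omega); omega
  · have := Int.emod_lt_of_pos (c - (a + 1)) (b := M) (by omega); omega

/-- Extension of a similarity of finite families by one element. -/
theorem exists_sim_extend {ι : Type} {K M : ℕ} (hM : 0 < M) {s : Finset ι} (hs : s.Nonempty)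
    {f g : ι → ℤ} (h : ∀ i ∈ s, ∀ j ∈ s, Sim (2 * K + M) M (f i - f j) (g i - g j)) (v : ℤ) :
    ∃ w, (∀ i ∈ s, Sim K M (v - f i) (w - g i)) ∧ ∃ i ∈ s, |w - g i| ≤ K + M := by
  by_cases hn : ∃ i ∈ s, |v - f i| ≤ K + M
  · obtain ⟨i, hi, hv⟩ := hn
    refine ⟨g i + (v - f i), fun j hj => ?_, i, hi, by simpa using hv⟩
    have hij := h i hi j hj
    refine ⟨?_, ?_⟩
    · have := hij.1.add_right (v - f i)
      convert this using 1 <;> ring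
    · have := hij.2
      rw [abs_le] at hv
      omega
  push Not at hn
  have hn' : ∀ i ∈ s, v - f i < -(K + M) ∨ (K + M : ℤ) < v - f i := fun i hi => by
    have := hn i hi
    rw [lt_abs] at this
    omega
  have hg : ∀ i ∈ s, ∀ j ∈ s, f i ≤ f j → g i ≤ g j := fun i hi j hj hij => by
    have := (h i hi j hj).2
    omega
  by_cases ha : ∃ i ∈ s, v < f i
  · obtain ⟨i, hi, hmin⟩ := (s.filter fun i => v < f i).exists_min_image f
      (by obtain ⟨i, hi, hv⟩ := ha; exact ⟨i, by simp [hi, hv]⟩)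
    rw [Finset.mem_filter] at hi
    obtain ⟨x, hx, hx1, hx2⟩ := exists_modEq_mem_Ioc M hM (g i - K - M - 1) (g i + (v - f i))
    refine ⟨x, fun j hj => ?_, i, hi.1, by rw [abs_le]; omega⟩
    refine ⟨?_, ?_⟩
    · have h1 := (h i hi.1 j hj).1
      have h2 := hx.sub_right (g j)
      have h3 := (h1.add_right (v - f i)).symm
      have : x - g j ≡ f i - f j + (v - f i) [ZMOD M] := h2.trans (by convert h3 using 1; ring)
      exact (this.trans (by ring_nf; rfl)).symm
    · have h1 := hn' i hi.1
      have h2 := hn' j hj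
      have h3 := (h i hi.1 j hj).2
      by_cases hv : v < f j
      · have := hmin j (by simp [hj, hv])
        have := hg i hi.1 j hj this
        omega
      · omega
  · push Not at ha
    obtain ⟨i, hi, hmax⟩ := s.exists_max_image f hs
    obtain ⟨x, hx, hx1, hx2⟩ := exists_modEq_mem_Ioc M hM (g i + K) (g i + (v - f i))
    refine ⟨x, fun j hj => ?_, i, hi, by rw [abs_le]; omega⟩
    refine ⟨?_, ?_⟩
    · have h1 := (h i hi j hj).1
      have h2 := hx.sub_right (g j)
      have h3 := (h1.add_right (v - f i)).symm
      have : x - g j ≡ f i - f j + (v - f i) [ZMOD M] := h2.trans (by convert h3 using 1; ring)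
      exact (this.trans (by ring_nf; rfl)).symm
    · have := hn' j hj
      have := ha j hj
      have := hg j hj i hi (hmax j hj)
      omega

/-- Thresholds for iterated extensions. -/
def threshold (K M : ℕ) : ℕ → ℕ
  | 0 => K
  | n + 1 => 2 * threshold K M n + M

theorem threshold_succ' (K M n : ℕ) : threshold K M (n + 1) = threshold (2 * K + M) M n := by
  induction n with
  | zero => rfl
  | succ n ih => rw [threshold, ih, threshold]

theorem le_threshold (K M n : ℕ) : K ≤ threshold K M n := by
  induction n with
  | zero => rfl
  | succ n ih => rw [threshold]; omega

/-- Extension of a similarity of finite families by finitely many elements. -/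
theorem exists_sim_extend_finset {ι : Type} [DecidableEq ι] {M : ℕ} (hM : 0 < M) (t : Finset ι)
    {s : Finset ι} (hs : s.Nonempty) (hst : Disjoint s t) {f g : ι → ℤ} {K : ℕ}
    (h : ∀ i ∈ s, ∀ j ∈ s, Sim (threshold K M t.card) M (f i - f j) (g i - g j)) {c B : ℤ}
    (hc : ∀ i ∈ s, |g i - c| ≤ B) :
    ∃ g' : ι → ℤ, (∀ i ∈ s, g' i = g i) ∧
      (∀ i ∈ s ∪ t, ∀ j ∈ s ∪ t, Sim K M (f i - f j) (g' i - g' j)) ∧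
      ∀ i ∈ s ∪ t, |g' i - c| ≤ B + t.card * threshold K M t.card := by
  induction t using Finset.induction generalizing K with
  | empty => exact ⟨g, fun _ _ => rfl, by simpa [threshold] using h, by simpa using hc⟩
  | insert a t ha ih =>
    rw [Finset.card_insert_of_notMem ha, threshold_succ'] at h
    obtain ⟨g', h1, h2, h3⟩ := ih (Finset.disjoint_of_subset_right (Finset.subset_insert _ _) hst) h
    obtain ⟨w, hw, k, hk, hwk⟩ := exists_sim_extend hM (hs.mono Finset.subset_union_left) h2 (f a)
    have has : a ∉ s ∪ t := by
      rw [Finset.mem_union, not_or]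
      exact ⟨fun h => (Finset.disjoint_left.1 hst h) (Finset.mem_insert_self _ _), ha⟩
    have hne : ∀ i ∈ s ∪ t, Function.update g' a w i = g' i := fun i hi =>
      Function.update_of_ne (by rintro rfl; exact has hi) _ _
    have hle : K + M ≤ threshold K M (t.card + 1) := by
      have := le_threshold (2 * K + M) M t.card
      rw [threshold_succ']; omega
    refine ⟨Function.update g' a w, fun i hi => ?_, ?_, ?_⟩
    · rw [hne i (Finset.mem_union_left _ hi), h1 i hi]
    · rw [Finset.union_insert]
      intro i hi' j hj'
      rcases Finset.mem_insert.1 hi' with rfl | hi <;> rcases Finset.mem_insert.1 hj' with rfl | hj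
      · simpa using Sim.refl K M 0
      · rw [hne j hj, Function.update_self]; exact hw j hj
      · rw [hne i hi, Function.update_self]
        simpa using (hw i hi).neg
      · rw [hne i hi, hne j hj]; exact (h2 i hi j hj).mono (by omega)
    · have hk' := h3 k hk
      rw [← threshold_succ'] at h3 hk'
      have e : B + ((insert a t).card : ℤ) * (threshold K M (insert a t).card : ℤ) =
          B + t.card * threshold K M (t.card + 1) + threshold K M (t.card + 1) := by
        rw [Finset.card_insert_of_notMem ha]; push_cast; ring
      rw [e, Finset.union_insert]
      intro i hi
      rcases Finset.mem_insert.1 hi with rfl | hi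
      · rw [Function.update_self, abs_le] at *
        constructor <;> omega
      · rw [hne i hi]
        have := h3 i hi
        omega

end TPDA

/-! ## Elimination of integer and modular constraints: construction -/

namespace TPDA

section Digits

/-- Digits to the base `b`. -/
def digit (b c i : ℕ) : ℕ := c / b ^ i % b

theorem digit_lt {b : ℕ} (hb : 0 < b) (c i : ℕ) : digit b c i < b := Nat.mod_lt _ hb

theorem exists_digits {b : ℕ} (k : ℕ) (f : ℕ → ℕ) (hf : ∀ i < k, f i < b) :
    ∃ c < b ^ k, ∀ i < k, digit b c i = f i := by
  induction k generalizing f with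
  | zero => exact ⟨0, by simp, by simp⟩
  | succ k ih =>
    obtain ⟨c, hc, h⟩ := ih (fun i => f (i + 1)) fun i hi => hf _ (by omega)
    have h0 := hf 0 (by omega)
    refine ⟨f 0 + b * c, ?_, fun i hi => ?_⟩
    · rw [pow_succ']
      nlinarith
    · cases i with
      | zero => simp [digit, Nat.mod_eq_of_lt h0]
      | succ i =>
        rw [← h i (by omega), digit, digit, pow_succ', ← Nat.div_div_eq_div_mul,
          Nat.add_mul_div_left _ _ (by omega), Nat.div_eq_of_lt h0, zero_add]

theorem add_mul_inj {A a a' c c' : ℕ} (ha : a < A) (ha' : a' < A) (h : a + A * c = a' + A * c') :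
    a = a' ∧ c = c' := by
  have h1 := congrArg (· % A) h
  simp only [Nat.add_mul_mod_self_left, Nat.mod_eq_of_lt ha, Nat.mod_eq_of_lt ha'] at h1
  subst h1
  exact ⟨rfl, Nat.eq_of_mul_eq_mul_left (by omega) (Nat.add_left_cancel h)⟩

theorem add_mul_lt {A C a c : ℕ} (ha : a < A) (hc : c < C) : a + A * c < A * C := by
  have : A * (c + 1) ≤ A * C := Nat.mul_le_mul_left _ hc
  rw [mul_add, mul_one] at this
  omega

@[fun_prop] theorem primrec_digit {α : Type} [Primcodable α] {b c i : α → ℕ} (hb : Primrec b)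
    (hc : Primrec c) (hi : Primrec i) : Primrec fun x => digit (b x) (c x) (i x) := by
  unfold digit; fun_prop

end Digits

@[fun_prop] theorem primrec_threshold {α : Type} [Primcodable α] {K M n : α → ℕ} (hK : Primrec K)
    (hM : Primrec M) (hn : Primrec n) : Primrec fun x => threshold (K x) (M x) (n x) := by
  have : Primrec fun x => (fun y => 2 * y + M x)^[n x] (K x) :=
    Primrec.iterate_fun (h := fun x y => 2 * y + M x) hn hK (by fun_prop)
  refine this.of_eq fun x => ?_
  induction n x with
  | zero => rfl
  | succ n ih => rw [Function.iterate_succ_apply', ih]; rfl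

/-- Decision of `Sim` for differences of natural numbers. -/
def simB (K M p q p' q' : ℕ) : Bool :=
  decide ((p + q') % M = (p' + q) % M) &&
    (decide (p + q' = p' + q) || (decide (K + q < p) && decide (K + q' < p')) ||
      (decide (p + K < q) && decide (p' + K < q')))

theorem simB_iff {K M p q p' q' : ℕ} :
    simB K M p q p' q' = true ↔ Sim K M ((p : ℤ) - q) (p' - q') := by
  have h : (p + q') % M = (p' + q) % M ↔ (p : ℤ) - q ≡ p' - q' [ZMOD M] := by
    rw [← Nat.ModEq, ← Int.natCast_modEq_iff]
    push_cast
    constructor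
    · intro h
      have := h.sub_right (q + q' : ℤ)
      convert this using 1 <;> ring
    · intro h
      have := h.add_right (q + q' : ℤ)
      convert this using 1 <;> ring
  simp only [simB, Bool.and_eq_true, Bool.or_eq_true, decide_eq_true_eq, h, Sim]
  refine and_congr_right fun _ => ?_
  omega

@[fun_prop] theorem primrec_simB {α : Type} [Primcodable α] {K M p q p' q' : α → ℕ}
    (hK : Primrec K) (hM : Primrec M) (hp : Primrec p) (hq : Primrec q) (hp' : Primrec p')
    (hq' : Primrec q') : Primrec fun x => simB (K x) (M x) (p x) (q x) (p' x) (q' x) := by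
  unfold simB; fun_prop

namespace Atom

variable {C : Type}

/-- The largest absolute value of a constant relevant for an atom. -/
def param : Atom C → ℕ
  | intLe _ k => k.natAbs
  | intDiffLe _ _ k => k.natAbs
  | modEq _ m _ => m
  | modDiffEq _ _ m _ => m
  | fracZero _ => 0
  | fracLe _ _ => 0

/-- Case distinction on whether the fractional part of `x` exceeds that of `r`. -/
def split (r x : C) (f : ℕ → Constraint C) : Constraint C :=
  .or (.and (.atom (fracLe x r)) (f 0)) (.and (.not (.atom (fracLe x r))) (f 1))

/-- Replacement of integer and modular atoms by fractional ones. The integer part of `x` is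
`now - pos x`, minus one if the fractional part of `x` exceeds that of `r`. -/
def toFrac (r : C) (pos : C → ℕ) (now : ℕ) : Atom C → Constraint C
  | intLe x k => split r x fun e =>
      .ofBool (decide (now + (-k).toNat ≤ pos x + e + k.toNat))
  | intDiffLe x y k => split r x fun e => split r y fun e' =>
      .ofBool (decide (pos y + e' + (-k).toNat ≤ pos x + e + k.toNat))
  | modEq x m k => split r x fun e =>
      .ofBool (decide ((now + (-k).toNat) % m = (pos x + e + k.toNat) % m))
  | modDiffEq x y m k => split r x fun e => split r y fun e' =>
      .ofBool (decide ((pos y + e' + (-k).toNat) % m = (pos x + e + k.toNat) % m))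
  | fracZero x => .atom (fracZero x)
  | fracLe x y => .atom (fracLe x y)

theorem sat_congr {v v' : C → ℚ≥0} {a : Atom C} (h : ∀ x ∈ a.clocks, v x = v' x) :
    a.Sat v ↔ a.Sat v' := by
  cases a <;> simp_all [Sat, clocks]

theorem sat_split {r x : C} {f : ℕ → Constraint C} {v : C → ℚ≥0} :
    (split r x f).Sat (Sat v) ↔
      (f (if Int.fract (v x : ℚ) ≤ Int.fract (v r : ℚ) then 0 else 1)).Sat (Sat v) := by
  simp only [split, BoolComb.Sat, Sat]
  split_ifs with h <;> simp [h]

theorem floor_eq_sub (y t : ℚ) :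
    ⌊y⌋ = ⌊t⌋ - ⌊t - y⌋ - ((if Int.fract y ≤ Int.fract t then 0 else 1 : ℕ) : ℤ) := by
  have hy := Int.floor_add_fract y
  have ht := Int.floor_add_fract t
  have y0 := Int.fract_nonneg y
  have y1 := Int.fract_lt_one y
  have t0 := Int.fract_nonneg t
  have t1 := Int.fract_lt_one t
  split_ifs with h
  · have : ⌊t - y⌋ = ⌊t⌋ - ⌊y⌋ := by
      rw [Int.floor_eq_iff]; push_cast; constructor <;> linarith
    rw [this]; simp
  · have : ⌊t - y⌋ = ⌊t⌋ - ⌊y⌋ - 1 := by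
      rw [Int.floor_eq_iff]; push_cast; constructor <;> linarith
    rw [this]; push_cast; ring

theorem sat_toFrac {r : C} {pos : C → ℕ} {now K M : ℕ} {a : Atom C} {v v' : C → ℚ≥0} {t : ℚ}
    (hv : ∀ x ∈ a.clocks, Int.fract (v x : ℚ) = Int.fract (v' x : ℚ))
    (hr : Int.fract (v r : ℚ) = Int.fract t)
    (h₁ : ∀ x, a.clocks = [x] → Sim K M (⌊t⌋ - ⌊t - v' x⌋) (now - pos x))
    (h₂ : ∀ x y, a.clocks = [x, y] → Sim K M (⌊t - v' y⌋ - ⌊t - v' x⌋) (pos y - pos x))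
    (hK : a.param < K) (hM : ∀ m, 0 < m → m ≤ a.param → m ∣ M) :
    (a.toFrac r pos now).Sat (Sat v) ↔ a.Sat v' := by
  have aux : ∀ (m : ℕ+) (p q : ℕ) (D k : ℤ), ((m : ℕ) : ℤ) ∣ (p - q) - (D - k) →
      (p % m = q % m ↔ D ≡ k [ZMOD (m : ℕ)]) := by
    intro m p q D k h
    rw [← Nat.ModEq, ← Int.natCast_modEq_iff, Int.modEq_iff_dvd, Int.modEq_iff_dvd, ← dvd_neg,
      neg_sub, ← dvd_neg (b := k - D), neg_sub]
    exact dvd_iff_dvd_of_dvd_sub h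
  cases a with
  | intLe x k =>
    have h := (h₁ x rfl).2
    have hx := hv x (by simp [clocks])
    simp only [param] at hK
    rw [toFrac, sat_split, BoolComb.sat_ofBool, decide_eq_true_eq, Sat, floor_eq_sub (v' x) t, hr,
      hx]
    split_ifs <;> omega
  | intDiffLe x y k =>
    have h := (h₂ x y rfl).2
    have hx := hv x (by simp [clocks])
    have hy := hv y (by simp [clocks])
    simp only [param] at hK
    rw [toFrac, sat_split, sat_split, BoolComb.sat_ofBool, decide_eq_true_eq, Sat,
      floor_eq_sub (v' x) t, floor_eq_sub (v' y) t, hr, hx, hy]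
    split_ifs <;> omega
  | modEq x m k =>
    have h := (h₁ x rfl).1.of_dvd (Int.natCast_dvd_natCast.2 (hM m m.2 le_rfl))
    have hx := hv x (by simp [clocks])
    rw [toFrac, sat_split, BoolComb.sat_ofBool, decide_eq_true_eq, Sat, floor_eq_sub (v' x) t, hr,
      hx]
    refine aux m _ _ _ _ ?_
    have := h.dvd
    convert this using 1
    push_cast
    split_ifs <;> omega
  | modDiffEq x y m k =>
    have h := (h₂ x y rfl).1.of_dvd (Int.natCast_dvd_natCast.2 (hM m m.2 le_rfl))
    have hx := hv x (by simp [clocks])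
    have hy := hv y (by simp [clocks])
    rw [toFrac, sat_split, sat_split, BoolComb.sat_ofBool, decide_eq_true_eq, Sat,
      floor_eq_sub (v' x) t, floor_eq_sub (v' y) t, hr, hx, hy]
    refine aux m _ _ _ _ ?_
    have := h.dvd
    convert this using 1
    push_cast
    split_ifs <;> omega
  | fracZero x => simp [toFrac, BoolComb.Sat, Sat, hv x (by simp [clocks])]
  | fracLe x y => simp [toFrac, BoolComb.Sat, Sat, hv x (by simp [clocks]), hv y (by simp [clocks])]

theorem mem_atoms_toFrac {r : C} {pos : C → ℕ} {now : ℕ} {a c : Atom C}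
    (h : c ∈ (a.toFrac r pos now).atoms) :
    c.IsFractional ∧ (c = a ∨ ∃ x ∈ a.clocks, c = fracLe x r) := by
  have hs : ∀ {x : C} {f : ℕ → Constraint C} {c : Atom C}, c ∈ (split r x f).atoms →
      c = fracLe x r ∨ ∃ e, c ∈ (f e).atoms := by
    intro x f c h
    simp only [split, BoolComb.atoms, List.mem_append, List.mem_singleton] at h
    rcases h with (h | h) | h | h
    exacts [.inl h, .inr ⟨_, h⟩, .inl h, .inr ⟨_, h⟩]
  cases a with
  | fracZero x =>
    simp only [toFrac, BoolComb.atoms, List.mem_singleton] at h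
    subst h; exact ⟨trivial, .inl rfl⟩
  | fracLe x y =>
    simp only [toFrac, BoolComb.atoms, List.mem_singleton] at h
    subst h; exact ⟨trivial, .inl rfl⟩
  | intLe x k | modEq x m k =>
    rw [toFrac] at h
    rcases hs h with rfl | ⟨e, h⟩
    · exact ⟨trivial, .inr ⟨x, by simp [clocks], rfl⟩⟩
    · simp at h
  | intDiffLe x y k | modDiffEq x y m k =>
    rw [toFrac] at h
    rcases hs h with rfl | ⟨e, h⟩
    · exact ⟨trivial, .inr ⟨x, by simp [clocks], rfl⟩⟩
    · rcases hs h with rfl | ⟨e, h⟩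
      · exact ⟨trivial, .inr ⟨y, by simp [clocks], rfl⟩⟩
      · simp at h

section Primrec

variable {α : Type} [Primcodable α] [Denumerable C]

@[fun_prop] theorem primrec_param {f : α → Atom C} (hf : Primrec f) :
    Primrec fun x => (f x).param := by
  have h : Primrec fun k : ℤ => k.natAbs := by
    have : Primrec fun k : ℤ => k.toNat + (-k).toNat := by fun_prop
    exact this.of_eq fun k => by omega
  refine primrec_casesOn (h := fun _ a => a.param) (g₁ := fun _ p => p.2.natAbs)
    (g₂ := fun _ p => p.2.2.natAbs) (g₃ := fun _ p => p.2.1) (g₄ := fun _ p => p.2.2.1)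
    (g₅ := fun _ _ => 0) (g₆ := fun _ _ => 0) hf (by fun_prop) (by fun_prop) (by fun_prop)
    (by fun_prop) (by fun_prop) (by fun_prop) ?_
  rintro _ (_ | _ | _ | _ | _ | _) <;> rfl

@[fun_prop] theorem primrec_split {r x : α → C} {f : α → ℕ → Constraint C} (hr : Primrec r)
    (hx : Primrec x) (hf : Primrec fun p : α × ℕ => f p.1 p.2) :
    Primrec fun a => split (r a) (x a) (f a) := by
  have h0 : Primrec fun a => f a 0 := hf.comp (g := fun a => (a, 0)) (by fun_prop)
  have h1 : Primrec fun a => f a 1 := hf.comp (g := fun a => (a, 1)) (by fun_prop)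
  unfold split
  fun_prop

@[fun_prop] theorem primrec_toFrac {r : α → C} {pos : α → C → ℕ} {now : α → ℕ} {a : α → Atom C}
    (hr : Primrec r) (hp : Primrec fun p : α × C => pos p.1 p.2) (hn : Primrec now)
    (ha : Primrec a) : Primrec fun x => (a x).toFrac (r x) (pos x) (now x) := by
  have hp' : ∀ {β : Type} [Primcodable β] {f : β → α} {g : β → C}, Primrec f → Primrec g →
      Primrec fun y => pos (f y) (g y) := fun hf hg => hp.comp (hf.pair hg)
  refine primrec_casesOn (h := fun x a => a.toFrac (r x) (pos x) (now x))
    (g₁ := fun x p => toFrac (r x) (pos x) (now x) (intLe p.1 p.2))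
    (g₂ := fun x p => toFrac (r x) (pos x) (now x) (intDiffLe p.1 p.2.1 p.2.2))
    (g₃ := fun x p => toFrac (r x) (pos x) (now x) (modEq p.1 p.2.1 p.2.2))
    (g₄ := fun x p => toFrac (r x) (pos x) (now x) (modDiffEq p.1 p.2.1 p.2.2.1 p.2.2.2))
    (g₅ := fun x p => .atom (fracZero p)) (g₆ := fun x p => .atom (fracLe p.1 p.2)) ha
    ?_ ?_ ?_ ?_ (by fun_prop) (by fun_prop) ?_
  · simp only [toFrac]
    have := @hp' ((α × C × ℤ) × ℕ) _ (fun p => p.1.1) (fun p => p.1.2.1) (by fun_prop) (by fun_prop)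
    fun_prop
  · simp only [toFrac]
    have := @hp' (((α × C × C × ℤ) × ℕ) × ℕ) _ (fun p => p.1.1.1) (fun p => p.1.1.2.1) (by fun_prop)
      (by fun_prop)
    have := @hp' (((α × C × C × ℤ) × ℕ) × ℕ) _ (fun p => p.1.1.1) (fun p => p.1.1.2.2.1)
      (by fun_prop) (by fun_prop)
    fun_prop
  · simp only [toFrac]
    have := @hp' ((α × C × ℕ+ × ℤ) × ℕ) _ (fun p => p.1.1) (fun p => p.1.2.1) (by fun_prop)
      (by fun_prop)
    fun_prop
  · simp only [toFrac]
    have := @hp' (((α × C × C × ℕ+ × ℤ) × ℕ) × ℕ) _ (fun p => p.1.1.1) (fun p => p.1.1.2.1)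
      (by fun_prop) (by fun_prop)
    have := @hp' (((α × C × C × ℕ+ × ℤ) × ℕ) × ℕ) _ (fun p => p.1.1.1) (fun p => p.1.1.2.2.1)
      (by fun_prop) (by fun_prop)
    fun_prop
  · rintro x (_ | _ | _ | _ | _ | _) <;> rfl

end Primrec

end Atom

end TPDA

namespace TPDA

/-- The constants relevant for an operation. -/
def Op.params (o : Op) : List ℕ :=
  o.elim [] (fun _ => []) (fun φ => φ.atoms.map Atom.param) (fun _ => [])
    (fun _ ψ => ψ.atoms.map Atom.param) (fun _ ψ => ψ.atoms.map Atom.param)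

namespace Automaton

/-- The largest constant of an automaton. -/
def maxParam (P : Automaton) : ℕ := (P.rules.flatMap fun ρ => ρ.op.params).foldr max 0

/-- Threshold for integer constraints. -/
def thr (P : Automaton) : ℕ := P.maxParam + 1

/-- Common multiple of all moduli. -/
def modulus (P : Automaton) : ℕ := P.maxParam.factorial

/-- Threshold for the differences of global clocks. -/
def bigThr (P : Automaton) : ℕ := threshold P.thr P.modulus P.numStackClock

/-- Base for coding ages of global clocks and time distances. -/
def base (P : Automaton) : ℕ :=
  P.numClock * threshold P.bigThr P.modulus P.numClock + P.thr + P.modulus + 2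

/-- Number of control states that abstract integer parts. -/
def numAbs (P : Automaton) : ℕ := P.base ^ (2 * P.numClock + 1)

/-- Base for coding ages of stack clocks. -/
def stackBase (P : Automaton) : ℕ := P.base + P.numStackClock * P.bigThr

/-- Number of abstractions of stack clocks. -/
def numStackAbs (P : Automaton) : ℕ := P.stackBase ^ P.numStackClock

/-- Age of a clock: the number of integer points of absolute time since it was zero. -/
def age (P : Automaton) (s i : ℕ) : ℕ :=
  bif decide (i < P.numClock) then digit P.base s i else 0

/-- Distance from the last push to the last reset of a clock, plus one; or `0` if the clock has
not been reset since. -/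
def off (P : Automaton) (s i : ℕ) : ℕ := digit P.base s (P.numClock + i)

/-- Distance from the last push to the present. -/
def dist (P : Automaton) (s : ℕ) : ℕ := digit P.base s (P.numClock + P.numClock)

def sameAges (P : Automaton) (s s' : ℕ) : Bool :=
  (List.range P.numClock).all fun i => decide (P.age s' i = P.age s i)

def tickB (P : Automaton) (s s' : ℕ) : Bool :=
  ((List.range (P.numClock + 1)).all fun i => (List.range (P.numClock + 1)).all fun j =>
    simB P.bigThr P.modulus ((bif decide (i = P.numClock) then 1 else 0) + P.age s j)
      ((bif decide (j = P.numClock) then 1 else 0) + P.age s i) (P.age s' j) (P.age s' i)) &&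
  ((List.range P.numClock).all fun i => decide (P.off s' i = P.off s i)) &&
  simB P.thr P.modulus (P.dist s + 1) 0 (P.dist s') 0

def resetB (P : Automaton) (Y : List ℕ) (s s' : ℕ) : Bool :=
  ((List.range P.numClock).all fun i =>
    bif Y.contains i then decide (P.age s' i = 0) && decide (1 ≤ P.off s' i) &&
      simB P.thr P.modulus (P.dist s) 0 (P.off s' i) 1
    else decide (P.age s' i = P.age s i) && decide (P.off s' i = P.off s i)) &&
  decide (P.dist s' = P.dist s)

def pushB (P : Automaton) (s s' : ℕ) : Bool :=
  P.sameAges s s' && ((List.range P.numClock).all fun i => decide (P.off s' i = 0)) &&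
    decide (P.dist s' = 0)

def popB (P : Automaton) (t s s' : ℕ) : Bool :=
  P.sameAges s s' &&
  ((List.range P.numClock).all fun i =>
    bif decide (P.off s i = 0) then decide (P.off s' i = P.off t i)
    else decide (1 ≤ P.off s' i) &&
      simB P.thr P.modulus (P.off s i + P.dist t) 1 (P.off s' i) 1) &&
  simB P.thr P.modulus (P.dist s + P.dist t) 0 (P.dist s') 0

/-- Code of a location. -/
def locCode (P : Automaton) (l ph s : ℕ) : ℕ := l + P.numLoc * (ph + 5 * s)

/-- Code of a stack symbol. -/
def symCode (P : Automaton) (γ t v : ℕ) : ℕ := γ + P.numStackSym * (t + P.numAbs * v)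

def testC (P : Automaton) (s : ℕ) (φ : TransConstraint) : TransConstraint :=
  φ.bind (Atom.toFrac P.numClock (fun i => P.base - P.age s i) P.base)

def pushC (P : Automaton) (t v : ℕ) (ψ : StackConstraint) : StackConstraint :=
  .and (.and (.atom (.fracLe (.inr P.numStackClock) (.inl P.numClock)))
    (.atom (.fracLe (.inl P.numClock) (.inr P.numStackClock)))) <|
  .and (.conj ((List.range P.numStackClock).map fun z =>
      bif decide (digit P.stackBase v z = 0) then
        .atom (.fracLe (.inr z) (.inr P.numStackClock)) else .tru)) <|
  ψ.bind (Atom.toFrac (.inr P.numStackClock)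
    (fun c => c.elim (fun i => P.stackBase - P.age t i)
      fun z => P.stackBase - digit P.stackBase v z)
    P.stackBase)

def popC (P : Automaton) (t s v : ℕ) (ψ : StackConstraint) : StackConstraint :=
  ψ.bind (Atom.toFrac (.inr P.numStackClock)
    (fun c => c.elim
      (fun i => bif decide (P.off s i = 0) then P.stackBase - P.age t i
        else P.stackBase + (P.off s i - 1))
      fun z => P.stackBase - digit P.stackBase v z)
    (P.stackBase + P.dist s))

def opRules (P : Automaton) (s s' : ℕ) (ρ : Rule) : List Rule :=
  ρ.op.elim
    (bif decide (s = s') then [⟨P.locCode ρ.src 0 s, .input none, P.locCode ρ.dst 1 s'⟩] else [])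
    (fun a => bif decide (s = s') then
      [⟨P.locCode ρ.src 0 s, .input a, P.locCode ρ.dst 0 s'⟩] else [])
    (fun φ => bif decide (s = s') then
      [⟨P.locCode ρ.src 0 s, .test (P.testC s φ), P.locCode ρ.dst 0 s'⟩] else [])
    (fun Y => bif P.resetB Y s s' then
      [⟨P.locCode ρ.src 0 s, .reset Y, P.locCode ρ.dst 0 s'⟩] else [])
    (fun γ ψ => bif P.pushB s s' then (List.range P.numStackAbs).map fun v =>
      ⟨P.locCode ρ.src 0 s, .push (P.symCode γ s v) (P.pushC s v ψ), P.locCode ρ.dst 0 s'⟩ else [])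
    (fun γ ψ => (List.range P.numAbs).flatMap fun t => bif P.popB t s s' then
      (List.range P.numStackAbs).map fun v =>
      ⟨P.locCode ρ.src 0 s, .pop (P.symCode γ t v) (P.popC t s v ψ), P.locCode ρ.dst 0 s'⟩ else [])

def phaseRules (P : Automaton) (s s' l : ℕ) : List Rule :=
  (bif decide (s = s') then
    [⟨P.locCode l 1 s, .elapse, P.locCode l 1 s'⟩, ⟨P.locCode l 1 s, .input none, P.locCode l 0 s'⟩,
      ⟨P.locCode l 1 s, .test (.not (.atom (.fracZero P.numClock))), P.locCode l 2 s'⟩,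
      ⟨P.locCode l 2 s, .elapse, P.locCode l 3 s'⟩,
      ⟨P.locCode l 3 s, .test (.atom (.fracZero P.numClock)), P.locCode l 4 s'⟩]
    else []) ++
  (bif P.tickB s s' then
    [⟨P.locCode l 4 s, .input (some P.numInput), P.locCode l 1 s'⟩] else [])

/-- An automaton with fractional constraints only that keeps track of integer parts in its
locations and stack symbols. The new clock is never reset; the new letter is read whenever the
new clock is supposed to pass an integer. -/
def toFractional (P : Automaton) : Automaton where
  numLoc := P.numLoc * (5 * P.numAbs)
  numInput := P.numInput + 1
  numStackSym := P.numStackSym * (P.numAbs * P.numStackAbs)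
  numClock := P.numClock + 1
  numStackClock := P.numStackClock + 1
  rules := (List.range P.numAbs).flatMap fun s => (List.range P.numAbs).flatMap fun s' =>
    P.rules.flatMap (P.opRules s s') ++ (List.range P.numLoc).flatMap (P.phaseRules s s')

section Primrec

variable {α : Type} [Primcodable α] {P : α → Automaton}

@[fun_prop] theorem primrec_params {o : α → Op} (ho : Primrec o) :
    Primrec fun x => (o x).params := by
  unfold Op.params; fun_prop

@[fun_prop] theorem primrec_maxParam (hP : Primrec P) : Primrec fun x => (P x).maxParam := by
  unfold maxParam; fun_prop

@[fun_prop] theorem primrec_thr (hP : Primrec P) : Primrec fun x => (P x).thr := by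
  unfold thr; fun_prop

@[fun_prop] theorem primrec_modulus (hP : Primrec P) : Primrec fun x => (P x).modulus := by
  unfold modulus; fun_prop

@[fun_prop] theorem primrec_bigThr (hP : Primrec P) : Primrec fun x => (P x).bigThr := by
  unfold bigThr; fun_prop

@[fun_prop] theorem primrec_base (hP : Primrec P) : Primrec fun x => (P x).base := by
  unfold base; fun_prop

@[fun_prop] theorem primrec_numAbs (hP : Primrec P) : Primrec fun x => (P x).numAbs := by
  unfold numAbs; fun_prop

@[fun_prop] theorem primrec_stackBase (hP : Primrec P) : Primrec fun x => (P x).stackBase := by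
  unfold stackBase; fun_prop

@[fun_prop] theorem primrec_numStackAbs (hP : Primrec P) :
    Primrec fun x => (P x).numStackAbs := by
  unfold numStackAbs; fun_prop

variable {s s' t v i l ph γ : α → ℕ}

@[fun_prop] theorem primrec_age (hP : Primrec P) (hs : Primrec s) (hi : Primrec i) :
    Primrec fun x => (P x).age (s x) (i x) := by
  unfold age; fun_prop

@[fun_prop] theorem primrec_off (hP : Primrec P) (hs : Primrec s) (hi : Primrec i) :
    Primrec fun x => (P x).off (s x) (i x) := by
  unfold off; fun_prop

@[fun_prop] theorem primrec_dist (hP : Primrec P) (hs : Primrec s) :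
    Primrec fun x => (P x).dist (s x) := by
  unfold dist; fun_prop

@[fun_prop] theorem primrec_sameAges (hP : Primrec P) (hs : Primrec s) (hs' : Primrec s') :
    Primrec fun x => (P x).sameAges (s x) (s' x) := by
  unfold sameAges; fun_prop

@[fun_prop] theorem primrec_tickB (hP : Primrec P) (hs : Primrec s) (hs' : Primrec s') :
    Primrec fun x => (P x).tickB (s x) (s' x) := by
  unfold tickB; fun_prop

@[fun_prop] theorem primrec_resetB {Y : α → List ℕ} (hP : Primrec P) (hY : Primrec Y)
    (hs : Primrec s) (hs' : Primrec s') : Primrec fun x => (P x).resetB (Y x) (s x) (s' x) := by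
  unfold resetB; fun_prop

@[fun_prop] theorem primrec_pushB (hP : Primrec P) (hs : Primrec s) (hs' : Primrec s') :
    Primrec fun x => (P x).pushB (s x) (s' x) := by
  unfold pushB; fun_prop

@[fun_prop] theorem primrec_popB (hP : Primrec P) (ht : Primrec t) (hs : Primrec s)
    (hs' : Primrec s') : Primrec fun x => (P x).popB (t x) (s x) (s' x) := by
  unfold popB; fun_prop

@[fun_prop] theorem primrec_locCode (hP : Primrec P) (hl : Primrec l) (hph : Primrec ph)
    (hs : Primrec s) : Primrec fun x => (P x).locCode (l x) (ph x) (s x) := by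
  unfold locCode; fun_prop

@[fun_prop] theorem primrec_symCode (hP : Primrec P) (hγ : Primrec γ) (ht : Primrec t)
    (hv : Primrec v) : Primrec fun x => (P x).symCode (γ x) (t x) (v x) := by
  unfold symCode; fun_prop

@[fun_prop] theorem primrec_testC {φ : α → TransConstraint} (hP : Primrec P) (hs : Primrec s)
    (hφ : Primrec φ) : Primrec fun x => (P x).testC (s x) (φ x) := by
  unfold testC; fun_prop

@[fun_prop] theorem primrec_pushC {ψ : α → StackConstraint} (hP : Primrec P) (ht : Primrec t)
    (hv : Primrec v) (hψ : Primrec ψ) : Primrec fun x => (P x).pushC (t x) (v x) (ψ x) := by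
  unfold pushC; fun_prop

@[fun_prop] theorem primrec_popC {ψ : α → StackConstraint} (hP : Primrec P) (ht : Primrec t)
    (hs : Primrec s) (hv : Primrec v) (hψ : Primrec ψ) :
    Primrec fun x => (P x).popC (t x) (s x) (v x) (ψ x) := by
  unfold popC; fun_prop

@[fun_prop] theorem primrec_opRules {ρ : α → Rule} (hP : Primrec P) (hs : Primrec s)
    (hs' : Primrec s') (hρ : Primrec ρ) : Primrec fun x => (P x).opRules (s x) (s' x) (ρ x) := by
  unfold opRules; fun_prop

@[fun_prop] theorem primrec_phaseRules (hP : Primrec P) (hs : Primrec s) (hs' : Primrec s')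
    (hl : Primrec l) : Primrec fun x => (P x).phaseRules (s x) (s' x) (l x) := by
  unfold phaseRules; fun_prop

theorem primrec_toFractional : Primrec toFractional := by
  unfold toFractional; fun_prop

end Primrec

end Automaton

end TPDA

namespace TPDA

namespace Automaton

/-- The rules of `toFractional`. -/
inductive FracRule (P : Automaton) : ℕ → Op → ℕ → Prop
  | start {l r s : ℕ} (h : Rule.mk l .elapse r ∈ P.rules) (hs : s < P.numAbs) :
      FracRule P (P.locCode l 0 s) (.input none) (P.locCode r 1 s)
  | input {l r s : ℕ} {a : Option ℕ} (h : Rule.mk l (.input a) r ∈ P.rules) (hs : s < P.numAbs) :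
      FracRule P (P.locCode l 0 s) (.input a) (P.locCode r 0 s)
  | test {l r s : ℕ} {φ : TransConstraint} (h : Rule.mk l (.test φ) r ∈ P.rules)
      (hs : s < P.numAbs) : FracRule P (P.locCode l 0 s) (.test (P.testC s φ)) (P.locCode r 0 s)
  | reset {l r s s' : ℕ} {Y : List ℕ} (h : Rule.mk l (.reset Y) r ∈ P.rules) (hs : s < P.numAbs)
      (hs' : s' < P.numAbs) (hb : P.resetB Y s s' = true) :
      FracRule P (P.locCode l 0 s) (.reset Y) (P.locCode r 0 s')
  | push {l r s s' v γ : ℕ} {ψ : StackConstraint} (h : Rule.mk l (.push γ ψ) r ∈ P.rules)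
      (hs : s < P.numAbs) (hs' : s' < P.numAbs) (hb : P.pushB s s' = true)
      (hv : v < P.numStackAbs) : FracRule P (P.locCode l 0 s)
        (.push (P.symCode γ s v) (P.pushC s v ψ)) (P.locCode r 0 s')
  | pop {l r s s' t v γ : ℕ} {ψ : StackConstraint} (h : Rule.mk l (.pop γ ψ) r ∈ P.rules)
      (hs : s < P.numAbs) (hs' : s' < P.numAbs) (ht : t < P.numAbs) (hb : P.popB t s s' = true)
      (hv : v < P.numStackAbs) : FracRule P (P.locCode l 0 s)
        (.pop (P.symCode γ t v) (P.popC t s v ψ)) (P.locCode r 0 s')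
  | wait {l s : ℕ} (hl : l < P.numLoc) (hs : s < P.numAbs) :
      FracRule P (P.locCode l 1 s) .elapse (P.locCode l 1 s)
  | finish {l s : ℕ} (hl : l < P.numLoc) (hs : s < P.numAbs) :
      FracRule P (P.locCode l 1 s) (.input none) (P.locCode l 0 s)
  | nonint {l s : ℕ} (hl : l < P.numLoc) (hs : s < P.numAbs) :
      FracRule P (P.locCode l 1 s) (.test (.not (.atom (.fracZero P.numClock)))) (P.locCode l 2 s)
  | cross {l s : ℕ} (hl : l < P.numLoc) (hs : s < P.numAbs) :
      FracRule P (P.locCode l 2 s) .elapse (P.locCode l 3 s)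
  | int {l s : ℕ} (hl : l < P.numLoc) (hs : s < P.numAbs) :
      FracRule P (P.locCode l 3 s) (.test (.atom (.fracZero P.numClock))) (P.locCode l 4 s)
  | tick {l s s' : ℕ} (hl : l < P.numLoc) (hs : s < P.numAbs) (hs' : s' < P.numAbs)
      (hb : P.tickB s s' = true) :
      FracRule P (P.locCode l 4 s) (.input (some P.numInput)) (P.locCode l 1 s')

variable {P : Automaton}

theorem mem_bif_nil {β : Type} {b : Bool} {l : List β} {a : β} :
    a ∈ (bif b then l else []) ↔ b = true ∧ a ∈ l := by
  cases b <;> simp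

theorem mem_toFractional_rules {a b : ℕ} {o : Op} :
    Rule.mk a o b ∈ P.toFractional.rules ↔ FracRule P a o b := by
  constructor
  · intro h
    simp only [toFractional, List.mem_flatMap, List.mem_append, List.mem_range] at h
    obtain ⟨s, hs, s', hs', ⟨⟨l, p, r⟩, hρ, h⟩ | ⟨l, hl, h⟩⟩ := h
    · cases p with
      | elapse =>
        simp only [opRules, Op.elim, mem_bif_nil, List.mem_singleton, Rule.mk.injEq,
          decide_eq_true_eq] at h
        obtain ⟨rfl, rfl, rfl, rfl⟩ := h
        exact .start hρ hs
      | input =>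
        simp only [opRules, Op.elim, mem_bif_nil, List.mem_singleton, Rule.mk.injEq,
          decide_eq_true_eq] at h
        obtain ⟨rfl, rfl, rfl, rfl⟩ := h
        exact .input hρ hs
      | test =>
        simp only [opRules, Op.elim, mem_bif_nil, List.mem_singleton, Rule.mk.injEq,
          decide_eq_true_eq] at h
        obtain ⟨rfl, rfl, rfl, rfl⟩ := h
        exact .test hρ hs
      | reset =>
        simp only [opRules, Op.elim, mem_bif_nil, List.mem_singleton, Rule.mk.injEq] at h
        obtain ⟨hb, rfl, rfl, rfl⟩ := h
        exact .reset hρ hs hs' hb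
      | push =>
        simp only [opRules, Op.elim, mem_bif_nil, List.mem_map, List.mem_range,
          Rule.mk.injEq] at h
        obtain ⟨hb, v, hv, rfl, rfl, rfl⟩ := h
        exact .push hρ hs hs' hb hv
      | pop =>
        simp only [opRules, Op.elim, mem_bif_nil, List.mem_map, List.mem_range, List.mem_flatMap,
          Rule.mk.injEq] at h
        obtain ⟨t, ht, hb, v, hv, rfl, rfl, rfl⟩ := h
        exact .pop hρ hs hs' ht hb hv
    · simp only [phaseRules, List.mem_append, mem_bif_nil, List.mem_cons, List.not_mem_nil,
        or_false, Rule.mk.injEq, decide_eq_true_eq] at h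
      obtain ⟨rfl, h⟩ | ⟨hb, rfl, rfl, rfl⟩ := h
      · obtain ⟨rfl, rfl, rfl⟩ | ⟨rfl, rfl, rfl⟩ | ⟨rfl, rfl, rfl⟩ | ⟨rfl, rfl, rfl⟩ |
          ⟨rfl, rfl, rfl⟩ := h
        exacts [.wait hl hs, .finish hl hs, .nonint hl hs, .cross hl hs, .int hl hs]
      · exact .tick hl hs hs' hb
  · have key : ∀ {s s' : ℕ}, s < P.numAbs → s' < P.numAbs →
        ((∃ ρ ∈ P.rules, Rule.mk a o b ∈ P.opRules s s' ρ) ∨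
          ∃ l < P.numLoc, Rule.mk a o b ∈ P.phaseRules s s' l) →
        Rule.mk a o b ∈ P.toFractional.rules := by
      intro s s' hs hs' h
      simp only [toFractional, List.mem_flatMap, List.mem_append, List.mem_range]
      exact ⟨s, hs, s', hs', h⟩
    intro h
    cases h with
    | start h hs => exact key hs hs (.inl ⟨_, h, by simp [opRules, Op.elim]⟩)
    | input h hs => exact key hs hs (.inl ⟨_, h, by simp [opRules, Op.elim]⟩)
    | test h hs => exact key hs hs (.inl ⟨_, h, by simp [opRules, Op.elim]⟩)
    | reset h hs hs' hb => exact key hs hs' (.inl ⟨_, h, by simp [opRules, Op.elim, hb]⟩)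
    | @push _ _ _ _ v _ _ h hs hs' hb hv =>
      refine key hs hs' (.inl ⟨_, h, ?_⟩)
      simp only [opRules, Op.elim, mem_bif_nil, List.mem_map, List.mem_range]
      exact ⟨hb, v, hv, rfl⟩
    | @pop _ _ _ _ t v _ _ h hs hs' ht hb hv =>
      refine key hs hs' (.inl ⟨_, h, ?_⟩)
      simp only [opRules, Op.elim, mem_bif_nil, List.mem_map, List.mem_range, List.mem_flatMap]
      exact ⟨t, ht, hb, v, hv, rfl⟩
    | wait hl hs => exact key hs hs (.inr ⟨_, hl, by simp [phaseRules]⟩)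
    | finish hl hs => exact key hs hs (.inr ⟨_, hl, by simp [phaseRules]⟩)
    | nonint hl hs => exact key hs hs (.inr ⟨_, hl, by simp [phaseRules]⟩)
    | cross hl hs => exact key hs hs (.inr ⟨_, hl, by simp [phaseRules]⟩)
    | int hl hs => exact key hs hs (.inr ⟨_, hl, by simp [phaseRules]⟩)
    | tick hl hs hs' hb => exact key hs hs' (.inr ⟨_, hl, by simp [phaseRules, hb]⟩)

theorem locCode_lt {l ph s : ℕ} (hl : l < P.numLoc) (hph : ph < 5) (hs : s < P.numAbs) :
    P.locCode l ph s < P.toFractional.numLoc :=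
  add_mul_lt hl (add_mul_lt hph hs)

theorem locCode_inj {l ph s l' ph' s' : ℕ} (h : P.locCode l ph s = P.locCode l' ph' s')
    (hl : l < P.numLoc) (hl' : l' < P.numLoc) (hph : ph < 5) (hph' : ph' < 5) :
    l = l' ∧ ph = ph' ∧ s = s' := by
  obtain ⟨rfl, e⟩ := add_mul_inj hl hl' h
  exact ⟨rfl, add_mul_inj hph hph' e⟩

theorem symCode_lt {γ t v : ℕ} (hγ : γ < P.numStackSym) (ht : t < P.numAbs)
    (hv : v < P.numStackAbs) : P.symCode γ t v < P.toFractional.numStackSym :=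
  add_mul_lt hγ (add_mul_lt ht hv)

theorem symCode_inj {γ t v γ' t' v' : ℕ} (h : P.symCode γ t v = P.symCode γ' t' v')
    (hγ : γ < P.numStackSym) (hγ' : γ' < P.numStackSym) (ht : t < P.numAbs) (ht' : t' < P.numAbs) :
    γ = γ' ∧ t = t' ∧ v = v' := by
  obtain ⟨rfl, e⟩ := add_mul_inj hγ hγ' h
  exact ⟨rfl, add_mul_inj ht ht' e⟩

theorem Valid.op {P : Automaton} (hP : P.Valid) {l r : ℕ} {o : Op} (h : Rule.mk l o r ∈ P.rules) :
    l < P.numLoc ∧ r < P.numLoc ∧ P.OpValid o := hP _ h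

theorem stackAtom_toFrac {ψ : StackConstraint} {pos : ℕ ⊕ ℕ → ℕ} {now : ℕ}
    (hψ : ∀ a ∈ ψ.atoms, (∀ c ∈ a.clocks,
      Sum.elim (· < P.numClock) (· < P.numStackClock) c) ∧ ∃ z, Sum.inr z ∈ a.clocks)
    {a : Atom (ℕ ⊕ ℕ)} (ha : a ∈ (ψ.bind (Atom.toFrac (.inr P.numStackClock) pos now)).atoms) :
    ((∀ c ∈ a.clocks, Sum.elim (· < P.numClock + 1) (· < P.numStackClock + 1) c) ∧
      ∃ z, Sum.inr z ∈ a.clocks) ∧ a.IsFractional := by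
  obtain ⟨b, hb, h⟩ := BoolComb.mem_atoms_bind.1 ha
  obtain ⟨hf, h⟩ := Atom.mem_atoms_toFrac h
  have hc : ∀ c ∈ b.clocks, Sum.elim (· < P.numClock + 1) (· < P.numStackClock + 1) c := by
    intro c hc
    have := (hψ b hb).1 c hc
    cases c <;> exact Nat.lt_succ_of_lt this
  refine ⟨?_, hf⟩
  obtain rfl | ⟨x, hx, rfl⟩ := h
  · exact ⟨hc, (hψ a hb).2⟩
  · refine ⟨fun c h => ?_, P.numStackClock, by simp [Atom.clocks]⟩
    simp only [Atom.clocks, List.mem_cons, List.not_mem_nil, or_false] at h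
    rcases h with rfl | rfl
    · exact hc _ hx
    · exact Nat.lt_succ_self _

theorem atom_pushC {t v : ℕ} {ψ : StackConstraint}
    (hψ : ∀ a ∈ ψ.atoms, (∀ c ∈ a.clocks,
      Sum.elim (· < P.numClock) (· < P.numStackClock) c) ∧ ∃ z, Sum.inr z ∈ a.clocks)
    {a : Atom (ℕ ⊕ ℕ)} (ha : a ∈ (P.pushC t v ψ).atoms) :
    ((∀ c ∈ a.clocks, Sum.elim (· < P.numClock + 1) (· < P.numStackClock + 1) c) ∧
      ∃ z, Sum.inr z ∈ a.clocks) ∧ a.IsFractional := by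
  simp only [pushC, BoolComb.atoms, List.mem_append, List.mem_singleton, BoolComb.mem_atoms_conj,
    List.mem_map, List.mem_range] at ha
  obtain (rfl | rfl) | ⟨_, ⟨z, hz, rfl⟩, ha⟩ | ha := ha
  · simp [Atom.clocks, Atom.IsFractional]
  · simp [Atom.clocks, Atom.IsFractional]
  · cases h : decide (digit P.stackBase v z = 0) <;> simp [h, BoolComb.atoms] at ha
    subst ha
    simp [Atom.clocks, Atom.IsFractional]
    omega
  · exact stackAtom_toFrac hψ ha

theorem valid_toFractional (hP : P.Valid) : P.toFractional.Valid := by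
  rintro ⟨a, o, b⟩ hR
  change a < _ ∧ b < _ ∧ OpValid _ o
  cases mem_toFractional_rules.1 hR with
  | start h hs =>
    obtain ⟨h1, h2, h3⟩ := hP.op h
    exact ⟨locCode_lt h1 (by omega) hs, locCode_lt h2 (by omega) hs, by simp [OpValid]⟩
  | input h hs =>
    obtain ⟨h1, h2, h3⟩ := hP.op h
    exact ⟨locCode_lt h1 (by omega) hs, locCode_lt h2 (by omega) hs,
      fun a ha => Nat.lt_succ_of_lt (h3 a ha)⟩
  | test h hs =>
    obtain ⟨h1, h2, h3⟩ := hP.op h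
    refine ⟨locCode_lt h1 (by omega) hs, locCode_lt h2 (by omega) hs, fun a ha x hx => ?_⟩
    obtain ⟨b, hb, h⟩ := BoolComb.mem_atoms_bind.1 ha
    change x < P.numClock + 1
    obtain ⟨hf, rfl | ⟨y, hy, rfl⟩⟩ := Atom.mem_atoms_toFrac h
    · exact Nat.lt_succ_of_lt (h3 a hb x hx)
    · have := h3 b hb y hy
      simp only [Atom.clocks, List.mem_cons, List.not_mem_nil, or_false] at hx
      omega
  | reset h hs hs' hb =>
    obtain ⟨h1, h2, h3⟩ := hP.op h
    exact ⟨locCode_lt h1 (by omega) hs, locCode_lt h2 (by omega) hs',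
      fun a ha => Nat.lt_succ_of_lt (h3 a ha)⟩
  | push h hs hs' hb hv =>
    obtain ⟨h1, h2, h3, h4⟩ := hP.op h
    exact ⟨locCode_lt h1 (by omega) hs, locCode_lt h2 (by omega) hs', symCode_lt h3 hs hv,
      fun a ha => (atom_pushC h4 ha).1⟩
  | pop h hs hs' ht hb hv =>
    obtain ⟨h1, h2, h3, h4⟩ := hP.op h
    exact ⟨locCode_lt h1 (by omega) hs, locCode_lt h2 (by omega) hs', symCode_lt h3 ht hv,
      fun a ha => (stackAtom_toFrac h4 ha).1⟩
  | wait hl hs => exact ⟨locCode_lt hl (by omega) hs, locCode_lt hl (by omega) hs, trivial⟩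
  | finish hl hs =>
    exact ⟨locCode_lt hl (by omega) hs, locCode_lt hl (by omega) hs, by simp [OpValid]⟩
  | nonint hl hs =>
    exact ⟨locCode_lt hl (by omega) hs, locCode_lt hl (by omega) hs,
      by simp [OpValid, BoolComb.atoms, Atom.clocks, toFractional]⟩
  | cross hl hs => exact ⟨locCode_lt hl (by omega) hs, locCode_lt hl (by omega) hs, trivial⟩
  | int hl hs =>
    exact ⟨locCode_lt hl (by omega) hs, locCode_lt hl (by omega) hs,
      by simp [OpValid, BoolComb.atoms, Atom.clocks, toFractional]⟩
  | tick hl hs hs' hb =>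
    exact ⟨locCode_lt hl (by omega) hs, locCode_lt hl (by omega) hs',
      by simp [OpValid, toFractional]⟩

theorem fractional_toFractional (hP : P.Valid) : P.toFractional.Fractional := by
  refine ⟨fun l φ r hR => ?_, fun l γ ψ r hR => ?_, fun l γ ψ r hR => ?_⟩
  · cases mem_toFractional_rules.1 hR with
    | test h hs =>
      intro a ha
      obtain ⟨b, hb, h⟩ := BoolComb.mem_atoms_bind.1 ha
      exact (Atom.mem_atoms_toFrac h).1
    | nonint => simp [BoolComb.atoms, Atom.IsFractional]
    | int => simp [BoolComb.atoms, Atom.IsFractional]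
  · cases mem_toFractional_rules.1 hR with
    | push h hs hs' hb hv => exact fun a ha => (atom_pushC (hP.op h).2.2.2 ha).2
  · cases mem_toFractional_rules.1 hR with
    | pop h hs hs' ht hb hv => exact fun a ha => (stackAtom_toFrac (hP.op h).2.2.2 ha).2

end Automaton

end TPDA

/-! ## Elimination of integer and modular constraints: abstraction of integer parts -/

namespace TPDA

namespace Automaton

variable {P : Automaton}

theorem base_pos (P : Automaton) : 0 < P.base := by unfold base; omega

theorem age_lt (P : Automaton) (s i : ℕ) : P.age s i < P.base := by
  unfold age
  cases decide (i < P.numClock)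
  · exact P.base_pos
  · exact digit_lt P.base_pos _ _

theorem age_last (P : Automaton) (s : ℕ) : P.age s P.numClock = 0 := by simp [age]

theorem base_le_stackBase (P : Automaton) : P.base ≤ P.stackBase := Nat.le_add_right _ _

theorem stackBase_pos (P : Automaton) : 0 < P.stackBase :=
  P.base_pos.trans_le P.base_le_stackBase

theorem modulus_pos (P : Automaton) : 0 < P.modulus := Nat.factorial_pos _

theorem thr_le_bigThr (P : Automaton) : P.thr ≤ P.bigThr := le_threshold _ _ _

theorem dvd_modulus (P : Automaton) {k m : ℕ} (hk : k ≤ P.maxParam) (hm : 0 < m) (hmk : m ≤ k) :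
    m ∣ P.modulus := Nat.dvd_factorial hm (hmk.trans hk)

theorem le_maxParam {l r k : ℕ} {o : Op} (h : Rule.mk l o r ∈ P.rules) (hk : k ∈ o.params) :
    k ≤ P.maxParam := by
  have : ∀ l : List ℕ, k ∈ l → k ≤ l.foldr max 0 := by
    intro l hl
    induction l with
    | nil => simp at hl
    | cons a l ih =>
      rcases List.mem_cons.1 hl with rfl | hl
      · exact le_max_left _ _
      · exact (ih hl).trans (le_max_right _ _)
  exact this _ (List.mem_flatMap.2 ⟨_, h, hk⟩)

/-- Agreement of an abstract state with a family of integers, consisting of the integer parts of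
the reset times of all clocks, followed by the integer part of the present time. -/
def AgeOK (P : Automaton) (s : ℕ) (F : ℕ → ℤ) : Prop :=
  ∀ i ≤ P.numClock, ∀ j ≤ P.numClock,
    Sim P.bigThr P.modulus (F i - F j) ((P.age s j : ℤ) - P.age s i)

/-- Agreement of an abstract state with the development from the moment of the last push. -/
def OffOK (P : Automaton) (s : ℕ) (E F : ℕ → ℤ) : Prop :=
  (∀ i < P.numClock, (P.off s i = 0 ∧ F i = E i) ∨ (1 ≤ P.off s i ∧ E P.numClock ≤ F i ∧
    Sim P.thr P.modulus (F i - E P.numClock) ((P.off s i : ℤ) - 1))) ∧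
  E P.numClock ≤ F P.numClock ∧ Sim P.thr P.modulus (F P.numClock - E P.numClock) (P.dist s)

theorem AgeOK.le {s : ℕ} {F : ℕ → ℤ} (h : P.AgeOK s F) {i : ℕ} (hi : i ≤ P.numClock) :
    F i ≤ F P.numClock := by
  have := (h P.numClock le_rfl i hi).symm.nonneg (by rw [age_last]; simp)
  omega

theorem AgeOK.congr {s : ℕ} {F F' : ℕ → ℤ} (h : P.AgeOK s F) (e : ∀ i ≤ P.numClock, F' i = F i) :
    P.AgeOK s F' := fun i hi j hj => by rw [e i hi, e j hj]; exact h i hi j hj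

theorem sim_tick {s : ℕ} {F F' : ℕ → ℤ} (h : P.AgeOK s F) (e : ∀ i < P.numClock, F' i = F i)
    (eN : F' P.numClock = F P.numClock + 1) {i j : ℕ} (hi : i ≤ P.numClock) (hj : j ≤ P.numClock) :
    Sim P.bigThr P.modulus (F' i - F' j)
      ((((bif decide (i = P.numClock) then 1 else 0) + P.age s j : ℕ) : ℤ) -
        ((bif decide (j = P.numClock) then 1 else 0) + P.age s i : ℕ)) := by
  have key : ∀ j ≤ P.numClock, Sim P.bigThr P.modulus (F P.numClock - F j + 1)
      ((P.age s j : ℤ) - P.age s P.numClock + 1) := fun j hj =>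
    (h _ le_rfl j hj).add (Sim.refl _ _ 1) (by have := h.le hj; omega) (by omega)
  rcases hi.lt_or_eq with hi' | rfl <;> rcases hj.lt_or_eq with hj' | rfl
  · rw [e i hi', e j hj']
    simpa [hi'.ne, hj'.ne] using h i hi j hj
  · rw [e i hi', eN]
    have := (key i hi).neg
    simp only [hi'.ne, decide_false, decide_true, cond_false, cond_true]
    convert this using 1
    · ring
    · push_cast; ring
  · rw [e j hj', eN]
    simp only [hj'.ne, decide_false, decide_true, cond_false, cond_true]
    convert key j hj using 1
    · ring
    · push_cast; ring
  · simpa using Sim.refl _ _ _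

theorem tickB_iff {s s' : ℕ} : P.tickB s s' = true ↔
    (∀ i ≤ P.numClock, ∀ j ≤ P.numClock, Sim P.bigThr P.modulus
      ((((bif decide (i = P.numClock) then 1 else 0) + P.age s j : ℕ) : ℤ) -
        ((bif decide (j = P.numClock) then 1 else 0) + P.age s i : ℕ))
      ((P.age s' j : ℤ) - P.age s' i)) ∧
    (∀ i < P.numClock, P.off s' i = P.off s i) ∧
    Sim P.thr P.modulus (P.dist s + 1) (P.dist s') := by
  simp only [tickB, Bool.and_eq_true, List.all_eq_true, List.mem_range, simB_iff,
    decide_eq_true_eq, Nat.lt_succ_iff, and_assoc]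
  push_cast
  simp

theorem AgeOK.tick {s s' : ℕ} {F F' : ℕ → ℤ} (h : P.AgeOK s F) (hb : P.tickB s s' = true)
    (e : ∀ i < P.numClock, F' i = F i) (eN : F' P.numClock = F P.numClock + 1) : P.AgeOK s' F' :=
  fun i hi j hj => (sim_tick h e eN hi hj).trans ((tickB_iff.1 hb).1 i hi j hj)

theorem OffOK.tick {s s' : ℕ} {E F F' : ℕ → ℤ} (h : P.OffOK s E F) (hb : P.tickB s s' = true)
    (e : ∀ i < P.numClock, F' i = F i) (eN : F' P.numClock = F P.numClock + 1) :
    P.OffOK s' E F' := by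
  obtain ⟨-, h1, h2⟩ := tickB_iff.1 hb
  refine ⟨fun i hi => ?_, by have := h.2.1; omega, Sim.trans ?_ h2⟩
  · rw [h1 i hi, e i hi]; exact h.1 i hi
  · have := h.2.2.add (Sim.refl _ _ 1) (by have := h.2.1; omega) (by omega)
    rw [eN]
    convert this using 1
    ring

theorem resetB_iff {Y : List ℕ} {s s' : ℕ} : P.resetB Y s s' = true ↔
    (∀ i < P.numClock, (i ∈ Y → P.age s' i = 0 ∧ 1 ≤ P.off s' i ∧
        Sim P.thr P.modulus (P.dist s) ((P.off s' i : ℤ) - 1)) ∧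
      (i ∉ Y → P.age s' i = P.age s i ∧ P.off s' i = P.off s i)) ∧ P.dist s' = P.dist s := by
  simp only [resetB, Bool.and_eq_true, List.all_eq_true, List.mem_range, decide_eq_true_eq]
  refine and_congr_left fun _ => forall_congr' fun i => imp_congr_right fun _ => ?_
  by_cases hi : i ∈ Y
  · simp [hi, simB_iff, and_assoc]
  · simp [hi]

theorem AgeOK.reset {Y : List ℕ} {s s' : ℕ} {F F' : ℕ → ℤ} (h : P.AgeOK s F)
    (hb : P.resetB Y s s' = true)
    (e : ∀ i < P.numClock, F' i = if i ∈ Y then F P.numClock else F i)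
    (eN : F' P.numClock = F P.numClock) : P.AgeOK s' F' := by
  have key : ∀ i ≤ P.numClock, ∃ k ≤ P.numClock, F' i = F k ∧ P.age s' i = P.age s k := by
    intro i hi
    rcases hi.lt_or_eq with hi' | rfl
    · have := (resetB_iff.1 hb).1 i hi'
      rw [e i hi']
      by_cases hY : i ∈ Y
      · exact ⟨P.numClock, le_rfl, by simp [hY], by rw [(this.1 hY).1, age_last]⟩
      · exact ⟨i, hi, by simp [hY], (this.2 hY).1⟩
    · exact ⟨P.numClock, le_rfl, eN, by rw [age_last, age_last]⟩
  intro i hi j hj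
  obtain ⟨k, hk, e1, e2⟩ := key i hi
  obtain ⟨k', hk', e3, e4⟩ := key j hj
  rw [e1, e2, e3, e4]
  exact h k hk k' hk'

theorem OffOK.reset {Y : List ℕ} {s s' : ℕ} {E F F' : ℕ → ℤ} (h : P.OffOK s E F)
    (hb : P.resetB Y s s' = true)
    (e : ∀ i < P.numClock, F' i = if i ∈ Y then F P.numClock else F i)
    (eN : F' P.numClock = F P.numClock) : P.OffOK s' E F' := by
  obtain ⟨h1, h2⟩ := resetB_iff.1 hb
  refine ⟨fun i hi => ?_, by rw [eN]; exact h.2.1, by rw [eN, h2]; exact h.2.2⟩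
  rw [e i hi]
  by_cases hY : i ∈ Y
  · obtain ⟨-, h3, h4⟩ := (h1 i hi).1 hY
    rw [if_pos hY]
    exact .inr ⟨h3, h.2.1, h.2.2.trans h4⟩
  · rw [if_neg hY, ((h1 i hi).2 hY).2]
    exact h.1 i hi

theorem sameAges_iff {s s' : ℕ} :
    P.sameAges s s' = true ↔ ∀ i < P.numClock, P.age s' i = P.age s i := by
  simp [sameAges]

theorem AgeOK.same {s s' : ℕ} {F : ℕ → ℤ} (h : P.AgeOK s F) (hb : P.sameAges s s' = true) :
    P.AgeOK s' F := by
  have key : ∀ i ≤ P.numClock, P.age s' i = P.age s i := by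
    intro i hi
    rcases hi.lt_or_eq with hi' | rfl
    · exact sameAges_iff.1 hb i hi'
    · rw [age_last, age_last]
  intro i hi j hj
  rw [key i hi, key j hj]
  exact h i hi j hj

theorem pushB_iff {s s' : ℕ} : P.pushB s s' = true ↔
    P.sameAges s s' = true ∧ (∀ i < P.numClock, P.off s' i = 0) ∧ P.dist s' = 0 := by
  simp [pushB, and_assoc]

theorem offOK_push {s s' : ℕ} {F : ℕ → ℤ} (hb : P.pushB s s' = true) : P.OffOK s' F F := by
  obtain ⟨-, h1, h2⟩ := pushB_iff.1 hb
  exact ⟨fun i hi => .inl ⟨h1 i hi, rfl⟩, le_rfl, by rw [h2]; simpa using Sim.refl _ _ 0⟩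

theorem popB_iff {t s s' : ℕ} : P.popB t s s' = true ↔
    P.sameAges s s' = true ∧
    (∀ i < P.numClock, (P.off s i = 0 → P.off s' i = P.off t i) ∧
      (P.off s i ≠ 0 → 1 ≤ P.off s' i ∧
        Sim P.thr P.modulus ((P.off s i : ℤ) + P.dist t - 1) ((P.off s' i : ℤ) - 1))) ∧
    Sim P.thr P.modulus ((P.dist s : ℤ) + P.dist t) (P.dist s') := by
  simp only [popB, Bool.and_eq_true, List.all_eq_true, List.mem_range, simB_iff, and_assoc]
  refine and_congr_right fun _ => and_congr ?_ (by push_cast; simp)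
  refine forall_congr' fun i => imp_congr_right fun _ => ?_
  by_cases h : P.off s i = 0
  · simp [h]
  · simp [h, simB_iff]

theorem OffOK.pop {t s s' : ℕ} {D E F : ℕ → ℤ} (h : P.OffOK t D E) (h' : P.OffOK s E F)
    (hb : P.popB t s s' = true) : P.OffOK s' D F := by
  obtain ⟨-, h1, h2⟩ := popB_iff.1 hb
  have a1 := h.2.1
  have a2 := h'.2.1
  refine ⟨fun i hi => ?_, by omega, Sim.trans ?_ h2⟩
  · rcases h'.1 i hi with ⟨h3, h4⟩ | ⟨h3, h4, h5⟩
    · rw [(h1 i hi).1 h3, h4]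
      exact h.1 i hi
    · obtain ⟨h6, h7⟩ := (h1 i hi).2 (by omega)
      refine .inr ⟨h6, by omega, Sim.trans ?_ h7⟩
      have := h5.add h.2.2 (by omega) (by omega)
      convert this using 1 <;> ring
  · have := h'.2.2.add h.2.2 (by omega) (by omega)
    convert this using 1
    ring

/-- Agreement of an abstract stack element with integers, the integer parts of the (fictitious)
reset times of all stack clocks. -/
def StackOK (P : Automaton) (t v : ℕ) (F Z : ℕ → ℤ) : Prop :=
  (∀ i ≤ P.numClock, ∀ z < P.numStackClock, Sim P.thr P.modulus (F i - Z z)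
    ((digit P.stackBase v z : ℤ) - P.age t i)) ∧
  ∀ z < P.numStackClock, ∀ z' < P.numStackClock, Sim P.thr P.modulus (Z z - Z z')
    ((digit P.stackBase v z' : ℤ) - digit P.stackBase v z)

section Exists

variable {β : Type}

/-- Indices of global clocks and the present, and of stack clocks. -/
def globalIdx (n : ℕ) : Finset (ℕ ⊕ ℕ) := (Finset.range (n + 1)).map ⟨Sum.inl, Sum.inl_injective⟩

def stackIdx (m : ℕ) : Finset (ℕ ⊕ ℕ) := (Finset.range m).map ⟨Sum.inr, Sum.inr_injective⟩

theorem exists_stackPos {t v : ℕ} {F : ℕ → ℤ} (h : P.AgeOK t F) : ∃ Z, P.StackOK t v F Z := by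
  obtain ⟨g, h1, h2, -⟩ := exists_sim_extend_finset P.modulus_pos (stackIdx P.numStackClock)
    (s := globalIdx P.numClock) ⟨.inl 0, by simp [globalIdx]⟩
    (by rw [Finset.disjoint_left]; simp [globalIdx, stackIdx])
    (f := Sum.elim (fun i => -(P.age t i : ℤ)) fun z => -(digit P.stackBase v z : ℤ))
    (g := Sum.elim F fun _ => 0) (K := P.thr)
    (B := ∑ i ∈ globalIdx P.numClock, |(Sum.elim F fun _ => 0 : ℕ ⊕ ℕ → ℤ) i|) (c := 0)
    (by
      intro i hi j hj
      simp only [globalIdx, Finset.mem_map, Finset.mem_range, Nat.lt_succ_iff] at hi hj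
      obtain ⟨i, hi, rfl⟩ := hi
      obtain ⟨j, hj, rfl⟩ := hj
      have : (stackIdx P.numStackClock).card = P.numStackClock := by simp [stackIdx]
      rw [this]
      have := (h i hi j hj).symm
      simp only [Function.Embedding.coeFn_mk, Sum.elim_inl]
      convert this using 1
      · rfl
      · ring)
    (by
      intro i hi
      rw [sub_zero]
      exact Finset.single_le_sum (f := fun i => |(Sum.elim F fun _ => 0 : ℕ ⊕ ℕ → ℤ) i|)
        (fun _ _ => abs_nonneg _) hi)
  have hg : ∀ i ≤ P.numClock, (.inl i : ℕ ⊕ ℕ) ∈ globalIdx P.numClock := fun i hi => by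
    simp [globalIdx]; omega
  have hz : ∀ z < P.numStackClock, (.inr z : ℕ ⊕ ℕ) ∈ stackIdx P.numStackClock := fun z hz => by
    simp [stackIdx, hz]
  refine ⟨fun z => g (.inr z), fun i hi z hz' => ?_, fun z hz' z' hz'' => ?_⟩
  · have := (h2 _ (Finset.mem_union_left _ (hg i hi)) _ (Finset.mem_union_right _ (hz z hz'))).symm
    rw [h1 _ (hg i hi)] at this
    simp only [Sum.elim_inl, Sum.elim_inr] at this
    convert this using 1
    ring
  · have := (h2 _ (Finset.mem_union_right _ (hz z hz')) _ (Finset.mem_union_right _ (hz z' hz''))).symm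
    simp only [Sum.elim_inr] at this
    convert this using 1
    ring

theorem exists_stackAbs {t : ℕ} {F Z : ℕ → ℤ} (h : P.AgeOK t F)
    (hZ : ∀ z < P.numStackClock, Z z ≤ F P.numClock) :
    ∃ v < P.numStackAbs, P.StackOK t v F Z := by
  have hcard : (stackIdx P.numStackClock).card = P.numStackClock := by simp [stackIdx]
  obtain ⟨g, h1, h2, h3⟩ := exists_sim_extend_finset P.modulus_pos (stackIdx P.numStackClock)
    (s := globalIdx P.numClock) ⟨.inl 0, by simp [globalIdx]⟩
    (by rw [Finset.disjoint_left]; simp [globalIdx, stackIdx])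
    (f := Sum.elim F Z) (g := Sum.elim (fun i => -(P.age t i : ℤ)) fun _ => 0) (K := P.thr)
    (B := P.base - 1) (c := 0)
    (by
      intro i hi j hj
      simp only [globalIdx, Finset.mem_map, Finset.mem_range, Nat.lt_succ_iff] at hi hj
      obtain ⟨i, hi, rfl⟩ := hi
      obtain ⟨j, hj, rfl⟩ := hj
      rw [hcard]
      have := h i hi j hj
      simp only [Function.Embedding.coeFn_mk, Sum.elim_inl]
      convert this using 1
      · rfl
      · ring)
    (by
      intro i hi
      simp only [globalIdx, Finset.mem_map, Finset.mem_range, Nat.lt_succ_iff] at hi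
      obtain ⟨i, hi, rfl⟩ := hi
      have := P.age_lt t i
      simp; omega)
  have hg : ∀ i ≤ P.numClock, (.inl i : ℕ ⊕ ℕ) ∈ globalIdx P.numClock := fun i hi => by
    simp [globalIdx]; omega
  have hz : ∀ z < P.numStackClock, (.inr z : ℕ ⊕ ℕ) ∈ stackIdx P.numStackClock := fun z hz => by
    simp [stackIdx, hz]
  have hg0 : ∀ z < P.numStackClock, g (.inr z) ≤ 0 := fun z hz' => by
    have := h2 _ (Finset.mem_union_left _ (hg _ le_rfl)) _ (Finset.mem_union_right _ (hz z hz'))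
    rw [h1 _ (hg _ le_rfl)] at this
    have := this.nonneg (by have := hZ z hz'; simp; omega)
    simp only [Sum.elim_inl, age_last] at this
    omega
  obtain ⟨v, hv, hd⟩ := exists_digits (b := P.stackBase) P.numStackClock
    (fun z => (-g (.inr z)).toNat) (fun z hz' => by
      have := h3 _ (Finset.mem_union_right _ (hz z hz'))
      rw [sub_zero, hcard, abs_le] at this
      have e : (P.stackBase : ℤ) = P.base + P.numStackClock * P.bigThr := by
        rw [stackBase]; push_cast; rfl
      have e' : P.bigThr = threshold P.thr P.modulus P.numStackClock := rfl
      rw [← e'] at this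
      omega)
  have hd' : ∀ z < P.numStackClock, (digit P.stackBase v z : ℤ) = -g (.inr z) := fun z hz' => by
    rw [hd z hz', Int.toNat_of_nonneg (by have := hg0 z hz'; omega)]
  refine ⟨v, hv, fun i hi z hz' => ?_, fun z hz' z' hz'' => ?_⟩
  · have := h2 _ (Finset.mem_union_left _ (hg i hi)) _ (Finset.mem_union_right _ (hz z hz'))
    rw [h1 _ (hg i hi)] at this
    rw [hd' z hz']
    simp only [Sum.elim_inl, Sum.elim_inr] at this
    convert this using 1
    ring
  · have := h2 _ (Finset.mem_union_right _ (hz z hz')) _ (Finset.mem_union_right _ (hz z' hz''))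
    rw [hd' z hz', hd' z' hz'']
    simp only [Sum.elim_inr] at this
    convert this using 1
    ring

theorem exists_state (P : Automaton) {a o : ℕ → ℕ} {d : ℕ} (ha : ∀ i < P.numClock, a i < P.base)
    (ho : ∀ i < P.numClock, o i < P.base) (hd : d < P.base) :
    ∃ s < P.numAbs, (∀ i < P.numClock, P.age s i = a i) ∧ (∀ i < P.numClock, P.off s i = o i) ∧
      P.dist s = d := by
  obtain ⟨s, hs, h⟩ := exists_digits (b := P.base) (2 * P.numClock + 1)
    (fun i => if i < P.numClock then a i else if i < 2 * P.numClock then o (i - P.numClock) else d)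
    (fun i hi => by
      split_ifs with h1 h2
      exacts [ha i h1, ho _ (by omega), hd])
  refine ⟨s, hs, fun i hi => ?_, fun i hi => ?_, ?_⟩
  · rw [age, decide_eq_true hi, cond_true, h i (by omega), if_pos hi]
  · rw [off, h _ (by omega), if_neg (by omega), if_pos (by omega), Nat.add_sub_cancel_left]
  · rw [dist, h _ (by omega), if_neg (by omega), if_neg (by omega)]

theorem exists_ages {F : ℕ → ℤ} (hF : ∀ i < P.numClock, F i ≤ F P.numClock) :
    ∃ a : ℕ → ℕ, (∀ i < P.numClock, a i < P.base) ∧ a P.numClock = 0 ∧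
      ∀ i ≤ P.numClock, ∀ j ≤ P.numClock, Sim P.bigThr P.modulus (F i - F j) ((a j : ℤ) - a i) := by
  obtain ⟨g, h1, h2, h3⟩ := exists_sim_extend_finset P.modulus_pos (Finset.range P.numClock)
    (s := {P.numClock}) (by simp) (by simp) (f := F) (g := fun _ => 0) (K := P.bigThr) (B := 0)
    (c := 0) (by intro i hi j hj; simp_all; exact Sim.refl _ _ _) (by simp)
  have hm : ∀ i ≤ P.numClock, i ∈ {P.numClock} ∪ Finset.range P.numClock := by simp; omega
  have hg0 : ∀ i ≤ P.numClock, g i ≤ 0 := fun i hi => by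
    have := (h2 _ (hm _ le_rfl) i (hm i hi)).nonneg (by
      rcases hi.lt_or_eq with hi | rfl
      · have := hF i hi; omega
      · simp)
    rw [h1 _ (by simp)] at this
    omega
  have e : ∀ i ≤ P.numClock, ((-g i).toNat : ℤ) = -g i := fun i hi =>
    Int.toNat_of_nonneg (by have := hg0 i hi; omega)
  refine ⟨fun i => (-g i).toNat, fun i hi => ?_, by simp [h1], fun i hi j hj => ?_⟩
  · have := h3 i (hm i hi.le)
    rw [sub_zero, Finset.card_range, abs_le] at this
    show (-g i).toNat < P.base
    have e : (P.base : ℤ) = P.numClock * threshold P.bigThr P.modulus P.numClock + P.thr +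
      P.modulus + 2 := by rw [base]; push_cast; rfl
    omega
  · rw [e i hi, e j hj]
    convert h2 i (hm i hi) j (hm j hj) using 1
    ring

theorem exists_small (P : Automaton) (d : ℕ) :
    ∃ d', d' + 1 < P.base ∧ Sim P.thr P.modulus d d' := by
  have hb : P.thr + P.modulus + 2 ≤ P.base := by unfold base; omega
  by_cases h : d ≤ P.thr
  · exact ⟨d, by omega, Sim.refl _ _ _⟩
  · obtain ⟨x, h1, h2, h3⟩ := exists_modEq_mem_Ioc P.modulus P.modulus_pos P.thr d
    refine ⟨x.toNat, by omega, ?_⟩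
    rw [Int.toNat_of_nonneg (by omega)]
    exact ⟨h1.symm, by omega⟩

theorem ageOK_of {s : ℕ} {F : ℕ → ℤ} {a : ℕ → ℕ} (hs : ∀ i < P.numClock, P.age s i = a i)
    (ha : a P.numClock = 0) (h : ∀ i ≤ P.numClock, ∀ j ≤ P.numClock,
      Sim P.bigThr P.modulus (F i - F j) ((a j : ℤ) - a i)) : P.AgeOK s F := by
  have : ∀ i ≤ P.numClock, P.age s i = a i := fun i hi => by
    rcases hi.lt_or_eq with hi | rfl
    · exact hs i hi
    · rw [ha, age_last]
  intro i hi j hj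
  rw [this i hi, this j hj]
  exact h i hi j hj

theorem exists_init {F : ℕ → ℤ} (hF : ∀ i < P.numClock, F i ≤ F P.numClock) :
    ∃ s < P.numAbs, P.AgeOK s F ∧ P.pushB s s = true := by
  obtain ⟨a, h1, h2, h3⟩ := exists_ages hF
  obtain ⟨s, hs, e1, e2, e3⟩ := P.exists_state h1 (o := fun _ => 0) (fun _ _ => P.base_pos)
    P.base_pos
  exact ⟨s, hs, ageOK_of e1 h2 h3, pushB_iff.2 ⟨by simp [sameAges], e2, e3⟩⟩

theorem off_lt (P : Automaton) (s i : ℕ) : P.off s i < P.base := digit_lt P.base_pos _ _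

theorem exists_tick {s : ℕ} {F F' : ℕ → ℤ} (h : P.AgeOK s F) (e : ∀ i < P.numClock, F' i = F i)
    (eN : F' P.numClock = F P.numClock + 1) : ∃ s' < P.numAbs, P.tickB s s' = true := by
  obtain ⟨a, h1, h2, h3⟩ := exists_ages (P := P) (F := F') fun i hi => by
    have := h.le hi.le
    rw [e i hi]; omega
  obtain ⟨d, hd, hd'⟩ := P.exists_small (P.dist s + 1)
  obtain ⟨s', hs', e1, e2, e3⟩ := P.exists_state h1 (o := P.off s) (fun i _ => P.off_lt s i)
    (d := d) (by omega)
  have := ageOK_of e1 h2 h3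
  refine ⟨s', hs', tickB_iff.2 ⟨fun i hi j hj => ?_, e2, ?_⟩⟩
  · exact (sim_tick h e eN hi hj).symm.trans (this i hi j hj)
  · rw [e3]; simpa using hd'

theorem exists_reset (P : Automaton) (Y : List ℕ) (s : ℕ) :
    ∃ s' < P.numAbs, P.resetB Y s s' = true := by
  obtain ⟨d, hd, hd'⟩ := P.exists_small (P.dist s)
  obtain ⟨s', hs', e1, e2, e3⟩ := P.exists_state (a := fun i => if i ∈ Y then 0 else P.age s i)
    (o := fun i => if i ∈ Y then d + 1 else P.off s i)
    (fun i _ => by split_ifs; exacts [P.base_pos, P.age_lt s i])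
    (fun i _ => by split_ifs; exacts [hd, P.off_lt s i])
    (d := P.dist s) (digit_lt P.base_pos _ _)
  refine ⟨s', hs', resetB_iff.2 ⟨fun i hi => ⟨fun hY => ?_, fun hY => ?_⟩, e3⟩⟩
  · rw [e1 i hi, e2 i hi, if_pos hY, if_pos hY]
    exact ⟨rfl, by omega, by simpa using hd'⟩
  · rw [e1 i hi, e2 i hi, if_neg hY, if_neg hY]
    exact ⟨rfl, rfl⟩

theorem exists_push (P : Automaton) (s : ℕ) : ∃ s' < P.numAbs, P.pushB s s' = true := by
  obtain ⟨s', hs', e1, e2, e3⟩ := P.exists_state (a := P.age s) (o := fun _ => 0)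
    (fun i _ => P.age_lt s i) (fun _ _ => P.base_pos) P.base_pos
  exact ⟨s', hs', pushB_iff.2 ⟨sameAges_iff.2 e1, e2, e3⟩⟩

theorem exists_pop (P : Automaton) (t s : ℕ) : ∃ s' < P.numAbs, P.popB t s s' = true := by
  choose f hf hf' using P.exists_small
  obtain ⟨s', hs', e1, e2, e3⟩ := P.exists_state (a := P.age s)
    (o := fun i => if P.off s i = 0 then P.off t i else f (P.off s i - 1 + P.dist t) + 1)
    (fun i _ => P.age_lt s i)
    (fun i _ => by split_ifs; exacts [P.off_lt t i, hf _])
    (d := f (P.dist s + P.dist t)) (by have := hf (P.dist s + P.dist t); omega)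
  refine ⟨s', hs', popB_iff.2 ⟨sameAges_iff.2 e1, fun i hi => ⟨fun h => ?_, fun h => ?_⟩, ?_⟩⟩
  · rw [e2 i hi, if_pos h]
  · rw [e2 i hi, if_neg h]
    refine ⟨by omega, ?_⟩
    have := hf' (P.off s i - 1 + P.dist t)
    convert this using 1
    · push_cast [Nat.one_le_iff_ne_zero.2 h]; ring
    · push_cast; ring
  · rw [e3]; simpa using hf' (P.dist s + P.dist t)

end Exists

end Automaton

end TPDA

/-! ## Elimination of integer and modular constraints: constraints -/

namespace TPDA

namespace Automaton

variable {P : Automaton}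

/-- Restriction of a valuation to all clocks but the last one. -/
def Val.init {n : ℕ} (w : Val (n + 1)) : Val n := fun i => w i.castSucc

theorem Val.init_get {n : ℕ} (w : Val (n + 1)) {i : ℕ} (h : i < n) : w.init.get i = w.get i := by
  rw [Val.get_of_lt _ h, Val.get_of_lt _ (Nat.lt_succ_of_lt h)]; rfl

theorem Val.init_snoc {n : ℕ} (μ : Val n) (q : ℚ≥0) : (μ.snoc q).init = μ := by
  funext i
  have := Val.snoc_get μ q i.2
  rw [Val.get_of_lt _ (Nat.lt_succ_of_lt i.2), Val.get_of_lt _ i.2] at this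
  exact this

theorem Val.get_add {n i : ℕ} (μ : Val n) (δ : ℚ≥0) (h : i < n) :
    Val.get (fun x => μ x + δ) i = μ.get i + δ := by
  rw [Val.get_of_lt _ h, Val.get_of_lt _ h]

theorem Val.get_reset {n i : ℕ} (μ : Val n) (Y : List ℕ) (h : i < n) :
    Val.get (fun x => if (x : ℕ) ∈ Y then 0 else μ x) i = if i ∈ Y then 0 else μ.get i := by
  rw [Val.get_of_lt _ h, Val.get_of_lt _ h]

theorem Val.ext_get {n : ℕ} {μ ν : Val n} (h : ∀ i < n, μ.get i = ν.get i) : μ = ν := by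
  funext i
  have := h i i.2
  rwa [Val.get_of_lt _ i.2, Val.get_of_lt _ i.2] at this

theorem Val.snoc_add {n : ℕ} (μ : Val n) (q δ : ℚ≥0) :
    Val.snoc (fun x => μ x + δ) (q + δ) = fun x => μ.snoc q x + δ := by
  refine Val.ext_get fun i hi => ?_
  rw [Val.get_add _ _ hi]
  rcases Nat.lt_succ_iff_lt_or_eq.1 hi with h | rfl
  · rw [Val.snoc_get _ _ h, Val.snoc_get _ _ h, Val.get_add _ _ h]
  · rw [Val.snoc_get_last, Val.snoc_get_last]

theorem Val.snoc_reset {n : ℕ} (μ : Val n) (q : ℚ≥0) {Y : List ℕ} (hY : ∀ i ∈ Y, i < n) :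
    Val.snoc (fun x => if (x : ℕ) ∈ Y then 0 else μ x) q =
      fun x : Fin (n + 1) => if (x : ℕ) ∈ Y then 0 else μ.snoc q x := by
  refine Val.ext_get fun i hi => ?_
  rw [Val.get_reset _ _ hi]
  rcases Nat.lt_succ_iff_lt_or_eq.1 hi with h | rfl
  · rw [Val.snoc_get _ _ h, Val.snoc_get _ _ h, Val.get_reset _ _ h]
  · rw [Val.snoc_get_last, Val.snoc_get_last, if_neg fun h => lt_irrefl _ (hY _ h)]

/-- The integer parts of the reset times of all clocks, with respect to the time shown by the last
clock, followed by the given number. -/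
def resetTimes {n : ℕ} (w : Val (n + 1)) (N : ℤ) (i : ℕ) : ℤ :=
  if i < n then ⌊(w.get n : ℚ) - w.get i⌋ else N

theorem resetTimes_of_lt {n : ℕ} (w : Val (n + 1)) (N : ℤ) {i : ℕ} (h : i < n) :
    resetTimes w N i = ⌊(w.get n : ℚ) - w.get i⌋ := if_pos h

theorem resetTimes_last {n : ℕ} (w : Val (n + 1)) (N : ℤ) : resetTimes w N n = N :=
  if_neg (lt_irrefl n)

theorem resetTimes_add {n : ℕ} (w : Val (n + 1)) (N : ℤ) (δ : ℚ≥0) (i : ℕ) :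
    resetTimes (n := n) (fun x => w x + δ) N i = resetTimes w N i := by
  unfold resetTimes
  split_ifs with h
  · rw [Val.get_add _ _ (Nat.lt_succ_self n), Val.get_add _ _ (Nat.lt_succ_of_lt h)]
    push_cast
    rw [add_sub_add_right_eq_sub]
  · rfl

theorem resetTimes_reset {n : ℕ} (w : Val (n + 1)) {Y : List ℕ} (hY : ∀ i ∈ Y, i < n) {i : ℕ}
    (h : i < n) :
    resetTimes (n := n) (fun x => if (x : ℕ) ∈ Y then 0 else w x) ⌊(w.get n : ℚ)⌋ i =
      if i ∈ Y then ⌊(w.get n : ℚ)⌋ else resetTimes w ⌊(w.get n : ℚ)⌋ i := by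
  rw [resetTimes_of_lt _ _ h, resetTimes_of_lt _ _ h, Val.get_reset _ _ (Nat.lt_succ_self n),
    Val.get_reset _ _ (Nat.lt_succ_of_lt h), if_neg fun h => lt_irrefl _ (hY _ h)]
  split_ifs <;> simp

theorem param_mem_params_test {φ : TransConstraint} {a : Atom ℕ} (ha : a ∈ φ.atoms) :
    a.param ∈ (Op.test φ).params := List.mem_map_of_mem ha

theorem param_lt_thr {l r k : ℕ} {o : Op} (h : Rule.mk l o r ∈ P.rules) (hk : k ∈ o.params) :
    k < P.thr := Nat.lt_succ_of_le (le_maxParam h hk)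

theorem dvd_modulus_of_mem {l r k : ℕ} {o : Op} (h : Rule.mk l o r ∈ P.rules) (hk : k ∈ o.params) :
    ∀ m, 0 < m → m ≤ k → m ∣ P.modulus := fun _ => P.dvd_modulus (le_maxParam h hk)

theorem sat_testC {l r s : ℕ} {φ : TransConstraint} (hP : P.Valid)
    (h : Rule.mk l (.test φ) r ∈ P.rules) {w : Val (P.numClock + 1)}
    (hs : P.AgeOK s (resetTimes w ⌊(w.get P.numClock : ℚ)⌋)) :
    transSat w (P.testC s φ) ↔ transSat w.init φ := by
  rw [transSat, transSat, testC, BoolComb.sat_bind]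
  refine BoolComb.sat_congr fun a ha => ?_
  have hc := (hP.op h).2.2 a ha
  have hcast : ∀ i, ((P.base - P.age s i : ℕ) : ℤ) = P.base - P.age s i := fun i => by
    have := P.age_lt s i; omega
  refine Atom.sat_toFrac (t := w.get P.numClock) (K := P.thr) (M := P.modulus)
    (fun x hx => by rw [Val.init_get _ (hc x hx)]) rfl (fun x hx => ?_) (fun x y hxy => ?_)
    (param_lt_thr h (param_mem_params_test ha))
    (dvd_modulus_of_mem h (param_mem_params_test ha))
  · have hx := hc x (by simp [hx])
    have := (hs _ le_rfl x hx.le).mono P.thr_le_bigThr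
    rw [resetTimes_last, resetTimes_of_lt _ _ hx, age_last] at this
    rw [hcast, Val.init_get _ hx]
    convert this using 1
    push_cast; ring
  · have hx := hc x (by simp [hxy])
    have hy := hc y (by simp [hxy])
    have := (hs y hy.le x hx.le).mono P.thr_le_bigThr
    rw [resetTimes_of_lt _ _ hx, resetTimes_of_lt _ _ hy] at this
    rw [hcast, hcast, Val.init_get _ hx, Val.init_get _ hy]
    convert this using 1
    ring

/-- Replacement of integer and modular atoms in stack constraints. -/
theorem sat_stack_toFrac {ψ : StackConstraint} {w : Val (P.numClock + 1)} {μ : Val P.numClock}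
    {z : Val (P.numStackClock + 1)} {ζ : Val P.numStackClock} {t : ℚ} {pos : ℕ ⊕ ℕ → ℕ} {now : ℕ}
    (hψ : ∀ a ∈ ψ.atoms, (∀ c ∈ a.clocks,
      Sum.elim (· < P.numClock) (· < P.numStackClock) c) ∧ ∃ z, Sum.inr z ∈ a.clocks)
    (hK : ∀ a ∈ ψ.atoms, a.param < P.thr ∧ ∀ m, 0 < m → m ≤ a.param → m ∣ P.modulus)
    (hw : ∀ i < P.numClock, μ.get i = w.get i)
    (hz : ∀ j < P.numStackClock, Int.fract (z.get j : ℚ) = Int.fract (ζ.get j : ℚ))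
    (hr : Int.fract (z.get P.numStackClock : ℚ) = Int.fract t)
    (hA : ∀ j < P.numStackClock, Sim P.thr P.modulus (⌊t⌋ - ⌊t - ζ.get j⌋) (now - pos (.inr j)))
    (hB : ∀ i < P.numClock, ∀ j < P.numStackClock, Sim P.thr P.modulus
      (⌊t - w.get i⌋ - ⌊t - ζ.get j⌋) (pos (.inl i) - pos (.inr j)))
    (hC : ∀ i < P.numStackClock, ∀ j < P.numStackClock, Sim P.thr P.modulus
      (⌊t - ζ.get i⌋ - ⌊t - ζ.get j⌋) (pos (.inr i) - pos (.inr j))) :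
    (ψ.bind (Atom.toFrac (.inr P.numStackClock) pos now)).Sat (Atom.Sat (Sum.elim w.get z.get)) ↔
      stackSat μ ζ ψ := by
  rw [stackSat, BoolComb.sat_bind]
  refine BoolComb.sat_congr fun a ha => ?_
  obtain ⟨hc, j, hj⟩ := hψ a ha
  refine Atom.sat_toFrac (K := P.thr) (M := P.modulus) (fun x hx => ?_) hr (fun x hx => ?_)
    (fun x y hxy => ?_) (hK a ha).1 (hK a ha).2
  · have := hc x hx
    rcases x with x | x
    · rw [Sum.elim_inl, Sum.elim_inl, hw x this]
    · exact hz x this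
  · rw [hx, List.mem_singleton] at hj
    subst hj
    exact hA _ (hc (.inr j) (by simp [hx]))
  · have hx := hc x (by simp [hxy])
    have hy := hc y (by simp [hxy])
    rcases x with x | x <;> rcases y with y | y
    · simp [hxy] at hj
    · have := (hB x hx y hy).neg
      rw [Sum.elim_inl, Sum.elim_inr, hw x hx]
      convert this using 1 <;> ring
    · have := hB y hy x hx
      rwa [Sum.elim_inl, Sum.elim_inr, hw y hy]
    · exact hC y hy x hx

section Stack

variable {t v : ℕ} {w : Val (P.numClock + 1)} {z : Val (P.numStackClock + 1)}
  {ζ : Val P.numStackClock}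

/-- A stack element of the simulating automaton represents a stack element of the given one. -/
structure StackRel (P : Automaton) (t v : ℕ) (w : Val (P.numClock + 1))
    (z : Val (P.numStackClock + 1)) (ζ : Val P.numStackClock) : Prop where
  ok : P.StackOK t v (resetTimes w ⌊(w.get P.numClock : ℚ)⌋)
    fun j => ⌊(w.get P.numClock : ℚ) - ζ.get j⌋
  fract : ∀ j < P.numStackClock, Int.fract (z.get j : ℚ) = Int.fract (ζ.get j : ℚ)
  last : Int.fract (z.get P.numStackClock : ℚ) = Int.fract (w.get P.numClock : ℚ)

theorem digit_stack_lt (P : Automaton) (v j : ℕ) : digit P.stackBase v j < P.stackBase :=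
  digit_lt P.stackBase_pos _ _

theorem stack_age_le (P : Automaton) (t i : ℕ) : P.age t i ≤ P.stackBase :=
  (P.age_lt t i).le.trans P.base_le_stackBase

theorem StackOK.digit_nonneg {F Z : ℕ → ℤ} (h : P.StackOK t v F Z) {j : ℕ}
    (hj : j < P.numStackClock) : Sim P.thr P.modulus (F P.numClock - Z j) (digit P.stackBase v j) := by
  simpa [age_last] using h.1 _ le_rfl j hj

theorem StackRel.sat_push (h : P.StackRel t v w z ζ) {l r γ : ℕ} {ψ : StackConstraint}
    (hP : P.Valid) (hR : Rule.mk l (.push γ ψ) r ∈ P.rules) :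
    (ψ.bind (Atom.toFrac (.inr P.numStackClock)
      (fun c => c.elim (fun i => P.stackBase - P.age t i)
      fun z => P.stackBase - digit P.stackBase v z) P.stackBase)).Sat
        (Atom.Sat (Sum.elim w.get z.get)) ↔ stackSat w.init ζ ψ := by
  have hc1 : ∀ i, ((P.stackBase - P.age t i : ℕ) : ℤ) = P.stackBase - P.age t i := fun i => by
    have := P.stack_age_le t i; omega
  have hc2 : ∀ j, ((P.stackBase - digit P.stackBase v j : ℕ) : ℤ) =
      P.stackBase - digit P.stackBase v j := fun i => by
    have := P.digit_stack_lt v i; omega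
  have hp : ∀ a ∈ ψ.atoms, a.param ∈ (Op.push γ ψ).params := fun a ha => List.mem_map_of_mem ha
  refine sat_stack_toFrac (hP.op hR).2.2.2
    (fun a ha => ⟨param_lt_thr hR (hp a ha), dvd_modulus_of_mem hR (hp a ha)⟩)
    (fun i hi => Val.init_get _ hi) h.fract h.last (fun j hj => ?_) (fun i hi j hj => ?_)
    (fun i hi j hj => ?_)
  · have := h.ok.digit_nonneg hj
    rw [resetTimes_last] at this
    rw [Sum.elim_inr, hc2, sub_sub_cancel]
    exact this
  · have := h.ok.1 i hi.le j hj
    rw [resetTimes_of_lt _ _ hi] at this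
    rw [Sum.elim_inl, Sum.elim_inr, hc1, hc2, sub_sub_sub_cancel_left]
    exact this
  · rw [Sum.elim_inr, Sum.elim_inr, hc2, hc2, sub_sub_sub_cancel_left]
    exact h.ok.2 i hi j hj

theorem sat_pushC {ψ : StackConstraint} : stackSat w z (P.pushC t v ψ) ↔
    Int.fract (z.get P.numStackClock : ℚ) = Int.fract (w.get P.numClock : ℚ) ∧
    (∀ j < P.numStackClock, digit P.stackBase v j = 0 →
      Int.fract (z.get j : ℚ) ≤ Int.fract (z.get P.numStackClock : ℚ)) ∧
    (ψ.bind (Atom.toFrac (.inr P.numStackClock)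
      (fun c => c.elim (fun i => P.stackBase - P.age t i)
      fun z => P.stackBase - digit P.stackBase v z) P.stackBase)).Sat
        (Atom.Sat (Sum.elim w.get z.get)) := by
  simp only [stackSat, pushC, BoolComb.Sat, Atom.Sat, Sum.elim_inr, Sum.elim_inl, le_antisymm_iff]
  refine and_congr_right fun _ => and_congr_left fun _ => ?_
  rw [BoolComb.sat_conj, List.forall_mem_map]
  refine forall_congr' fun j => ?_
  rw [List.mem_range]
  refine imp_congr_right fun _ => ?_
  by_cases h : digit P.stackBase v j = 0 <;> simp [h, BoolComb.Sat, Atom.Sat]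

theorem exists_stackRel_of_push {ψ : StackConstraint}
    (ht : P.AgeOK t (resetTimes w ⌊(w.get P.numClock : ℚ)⌋))
    (hz : stackSat w z (P.pushC t v ψ)) : ∃ ζ, P.StackRel t v w z ζ := by
  obtain ⟨h1, h2, -⟩ := sat_pushC.1 hz
  obtain ⟨Z, hZ⟩ := exists_stackPos (v := v) ht
  have key : ∀ j : Fin P.numStackClock, ∃ p : ℚ≥0, ⌊(w.get P.numClock : ℚ) - p⌋ = Z j ∧
      Int.fract (z.get j : ℚ) = Int.fract (p : ℚ) := by
    intro j
    have h3 := hZ.digit_nonneg j.2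
    rw [resetTimes_last] at h3
    have h4 := h3.symm.nonneg (by omega)
    obtain ⟨p, hp, hp'⟩ := exists_nnrat
      (k := ⌊(w.get P.numClock : ℚ)⌋ - Z j - ((if Int.fract (z.get j : ℚ) ≤
        Int.fract (w.get P.numClock : ℚ) then 0 else 1 : ℕ) : ℤ)) (f := Int.fract (z.get j : ℚ))
      (by
        split_ifs with h
        · omega
        · have : ⌊(w.get P.numClock : ℚ)⌋ - Z j ≠ 0 := fun h0 => h (by
            rw [← h1]; exact h2 j j.2 (by exact_mod_cast h3.eq_zero h0))
          omega)
      (Int.fract_nonneg _) (Int.fract_lt_one _)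
    refine ⟨p, ?_, hp'.symm⟩
    have := Atom.floor_eq_sub p (w.get P.numClock)
    rw [hp, hp'] at this
    omega
  choose ζ h3 h4 using key
  have e : ∀ j (hj : j < P.numStackClock), Val.get (n := P.numStackClock) ζ j = ζ ⟨j, hj⟩ :=
    fun j hj => Val.get_of_lt _ hj
  refine ⟨ζ, ⟨fun i hi j hj => ?_, fun i hi j hj => ?_⟩, fun j hj => ?_, h1⟩
  · simp only [e j hj, h3]; exact hZ.1 i hi j hj
  · simp only [e j hj, e i hi, h3]; exact hZ.2 i hi j hj
  · rw [e j hj]; exact h4 ⟨j, hj⟩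

theorem exists_stackRel (ht : P.AgeOK t (resetTimes w ⌊(w.get P.numClock : ℚ)⌋))
    (ζ : Val P.numStackClock) :
    ∃ v < P.numStackAbs, P.StackRel t v w (ζ.snoc (w.get P.numClock)) ζ ∧
      ∀ j < P.numStackClock, digit P.stackBase v j = 0 →
        Int.fract (ζ.get j : ℚ) ≤ Int.fract (w.get P.numClock : ℚ) := by
  obtain ⟨v, hv, h⟩ := exists_stackAbs (Z := fun j => ⌊(w.get P.numClock : ℚ) - ζ.get j⌋) ht
    (fun j hj => by
      rw [resetTimes_last]
      exact Int.floor_le_floor (by have := NNRat.coe_nonneg (ζ.get j); linarith))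
  refine ⟨v, hv, ⟨h, fun j hj => by rw [Val.snoc_get _ _ hj], by rw [Val.snoc_get_last]⟩,
    fun j hj h0 => ?_⟩
  have h1 := h.digit_nonneg hj
  rw [resetTimes_last] at h1
  have h2 := h1.symm.eq_zero (by exact_mod_cast h0)
  have := Atom.floor_eq_sub (ζ.get j) (w.get P.numClock)
  by_contra hlt
  rw [if_neg hlt] at this
  have h3 : (0 : ℤ) ≤ ⌊(ζ.get j : ℚ)⌋ := Int.floor_nonneg.2 (NNRat.coe_nonneg _)
  push_cast at this
  omega

theorem StackRel.sat_popC (h : P.StackRel t v w z ζ) {l r γ s : ℕ} {ψ : StackConstraint}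
    (hP : P.Valid) (hR : Rule.mk l (.pop γ ψ) r ∈ P.rules) {w' : Val (P.numClock + 1)} {δ : ℚ≥0}
    (hδ : w'.get P.numClock = w.get P.numClock + δ)
    (hs : P.OffOK s (resetTimes w ⌊(w.get P.numClock : ℚ)⌋)
      (resetTimes w' ⌊(w'.get P.numClock : ℚ)⌋)) :
    stackSat w' (fun i => z i + δ) (P.popC t s v ψ) ↔ stackSat w'.init (fun i => ζ i + δ) ψ := by
  have hc1 : ∀ i, ((P.stackBase - P.age t i : ℕ) : ℤ) = P.stackBase - P.age t i := fun i => by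
    have := P.stack_age_le t i; omega
  have hc2 : ∀ j, ((P.stackBase - digit P.stackBase v j : ℕ) : ℤ) =
      P.stackBase - digit P.stackBase v j := fun i => by
    have := P.digit_stack_lt v i; omega
  have hp : ∀ a ∈ ψ.atoms, a.param ∈ (Op.pop γ ψ).params := fun a ha => List.mem_map_of_mem ha
  have hfr : ∀ x y : ℚ, Int.fract x = Int.fract y → Int.fract (x + δ) = Int.fract (y + δ) := by
    intro x y hxy
    obtain ⟨m, hm⟩ := Int.fract_eq_fract.1 hxy
    exact Int.fract_eq_fract.2 ⟨m, by rw [← hm]; ring⟩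
  have hfl : ∀ j < P.numStackClock, ⌊(w'.get P.numClock : ℚ) -
      Val.get (n := P.numStackClock) (fun i => ζ i + δ) j⌋ = ⌊(w.get P.numClock : ℚ) - ζ.get j⌋ := by
    intro j hj
    rw [Val.get_add _ _ hj, hδ]
    push_cast
    rw [add_sub_add_right_eq_sub]
  obtain ⟨hoff, hle, hdist⟩ := hs
  have hN : ∀ j < P.numStackClock, 0 ≤ resetTimes w ⌊(w.get P.numClock : ℚ)⌋ P.numClock -
      ⌊(w.get P.numClock : ℚ) - ζ.get j⌋ := fun j hj =>
    (h.ok.digit_nonneg hj).symm.nonneg (by omega)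
  refine sat_stack_toFrac (t := w'.get P.numClock) (hP.op hR).2.2.2
    (fun a ha => ⟨param_lt_thr hR (hp a ha), dvd_modulus_of_mem hR (hp a ha)⟩)
    (fun i hi => Val.init_get _ hi) (fun j hj => ?_) ?_ (fun j hj => ?_)
    (fun i hi j hj => ?_) (fun i hi j hj => ?_)
  · rw [Val.get_add _ _ hj, Val.get_add _ _ (Nat.lt_succ_of_lt hj)]
    exact_mod_cast hfr _ _ (h.fract j hj)
  · rw [Val.get_add _ _ (Nat.lt_succ_self _), hδ]
    exact_mod_cast hfr _ _ h.last
  · rw [hfl j hj, Sum.elim_inr, hc2]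
    have := hdist.add (h.ok.digit_nonneg hj) (by omega) (hN j hj)
    rw [resetTimes_last, resetTimes_last] at this
    convert this using 1
    · ring
    · push_cast; ring
  · rw [hfl j hj, Sum.elim_inr, Sum.elim_inl, hc2, ← resetTimes_of_lt w' _ hi]
    rcases hoff i hi with ⟨h0, h1⟩ | ⟨h0, h1, h2⟩
    · rw [h0, decide_eq_true rfl, cond_true, hc1, h1, sub_sub_sub_cancel_left]
      exact h.ok.1 i hi.le j hj
    · have := h2.add (h.ok.digit_nonneg hj) (by omega) (hN j hj)
      rw [decide_eq_false (by omega), cond_false]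
      convert this using 1
      · ring
      · push_cast [h0]; ring
  · rw [hfl j hj, hfl i hi, Sum.elim_inr, Sum.elim_inr, hc2, hc2, sub_sub_sub_cancel_left]
    exact h.ok.2 i hi j hj

end Stack

end Automaton

end TPDA

/-! ## Elimination of integer and modular constraints: simulation -/

namespace TPDA

namespace Automaton

variable {P : Automaton}

/-- The number of integers that the last clock has passed, according to the phase. -/
def potential (ph : ℕ) (t : ℚ≥0) : ℤ :=
  if ph < 2 then ⌊(t : ℚ)⌋ else if ph < 4 then ⌈(t : ℚ)⌉ - 1 else ⌊(t : ℚ)⌋ - 1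

theorem potential_zero (t : ℚ≥0) : potential 0 t = ⌊(t : ℚ)⌋ := rfl

theorem potential_one (t : ℚ≥0) : potential 1 t = ⌊(t : ℚ)⌋ := rfl

theorem potential_two (t : ℚ≥0) : potential 2 t = ⌈(t : ℚ)⌉ - 1 := rfl

theorem potential_three (t : ℚ≥0) : potential 3 t = ⌈(t : ℚ)⌉ - 1 := rfl

theorem potential_four (t : ℚ≥0) : potential 4 t = ⌊(t : ℚ)⌋ - 1 := rfl

theorem potential_two_eq {t : ℚ≥0} (h : Int.fract (t : ℚ) ≠ 0) :
    potential 2 t = ⌊(t : ℚ)⌋ := by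
  have := (Int.ceil_eq_floor_add_one_iff_notMem (t : ℚ)).2 (by
    rintro ⟨k, hk⟩
    exact h (by rw [← hk, Int.fract_intCast]))
  rw [potential_two, this, add_sub_cancel_right]

theorem potential_three_eq {t : ℚ≥0} (h : Int.fract (t : ℚ) = 0) :
    potential 3 t = ⌊(t : ℚ)⌋ - 1 := by
  have := Int.floor_add_fract (t : ℚ)
  rw [h, add_zero] at this
  rw [potential_three, ← this, Int.ceil_intCast, Int.floor_intCast]

theorem floor_le_floor_add (t δ : ℚ≥0) : ⌊(t : ℚ)⌋ ≤ ⌊((t + δ : ℚ≥0) : ℚ)⌋ :=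
  Int.floor_le_floor (by have := NNRat.coe_nonneg δ; push_cast; linarith)

theorem ceil_le_ceil_add (t δ : ℚ≥0) : ⌈(t : ℚ)⌉ ≤ ⌈((t + δ : ℚ≥0) : ℚ)⌉ :=
  Int.ceil_le_ceil (by have := NNRat.coe_nonneg δ; push_cast; linarith)

theorem get_last_add {n : ℕ} (w : Val (n + 1)) (δ : ℚ≥0) :
    Val.get (n := n + 1) (fun x => w x + δ) n = w.get n + δ :=
  Val.get_add _ _ (Nat.lt_succ_self n)

theorem get_last_reset {n : ℕ} (w : Val (n + 1)) {Y : List ℕ} (hY : ∀ i ∈ Y, i < n) :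
    Val.get (n := n + 1) (fun x => if (x : ℕ) ∈ Y then 0 else w x) n = w.get n := by
  rw [Val.get_reset _ _ (Nat.lt_succ_self n), if_neg fun h => lt_irrefl _ (hY _ h)]

theorem transSat_fracZero {n : ℕ} (w : Val n) (i : ℕ) :
    transSat w (.atom (.fracZero i)) ↔ Int.fract (w.get i : ℚ) = 0 := Iff.rfl

theorem transSat_not_fracZero {n : ℕ} (w : Val n) (i : ℕ) :
    transSat w (.not (.atom (.fracZero i))) ↔ Int.fract (w.get i : ℚ) ≠ 0 := Iff.rfl

theorem letterCount_ne {a : Option ℕ} {b : ℕ} (h : ∀ c ∈ a, c ≠ b) : letterCount a b = 0 := by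
  cases a with
  | none => rfl
  | some c => exact Pi.single_eq_of_ne (h c rfl).symm 1

theorem letterCount_self (a : ℕ) : letterCount (some a) a = 1 := Pi.single_eq_same a 1

/-- Balanced runs of `toFractional`, with decoded locations. -/
inductive FracRun (P : Automaton) : ℕ → ℕ → ℕ → Val (P.numClock + 1) → (ℕ → ℕ) → ℚ≥0 →
    ℕ → ℕ → ℕ → Val (P.numClock + 1) → Prop
  | nil (l ph s : ℕ) (w : Val (P.numClock + 1)) : FracRun P l ph s w 0 0 l ph s w
  | start {l l' s r ph' s' : ℕ} {w w' : Val (P.numClock + 1)} {π : ℕ → ℕ} {δ : ℚ≥0}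
      (h : Rule.mk l .elapse l' ∈ P.rules) (t : FracRun P l' 1 s w π δ r ph' s' w') :
      FracRun P l 0 s w π δ r ph' s' w'
  | input {l l' s r ph' s' : ℕ} {w w' : Val (P.numClock + 1)} {π : ℕ → ℕ} {δ : ℚ≥0} {a : Option ℕ}
      (h : Rule.mk l (.input a) l' ∈ P.rules) (t : FracRun P l' 0 s w π δ r ph' s' w') :
      FracRun P l 0 s w (letterCount a + π) δ r ph' s' w'
  | test {l l' s r ph' s' : ℕ} {w w' : Val (P.numClock + 1)} {π : ℕ → ℕ} {δ : ℚ≥0}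
      {φ : TransConstraint} (h : Rule.mk l (.test φ) l' ∈ P.rules)
      (hφ : transSat w (P.testC s φ)) (t : FracRun P l' 0 s w π δ r ph' s' w') :
      FracRun P l 0 s w π δ r ph' s' w'
  | reset {l l' s s₁ r ph' s' : ℕ} {w w' : Val (P.numClock + 1)} {π : ℕ → ℕ} {δ : ℚ≥0}
      {Y : List ℕ} (h : Rule.mk l (.reset Y) l' ∈ P.rules) (hb : P.resetB Y s s₁ = true)
      (t : FracRun P l' 0 s₁ (fun x => if (x : ℕ) ∈ Y then 0 else w x) π δ r ph' s' w') :
      FracRun P l 0 s w π δ r ph' s' w'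
  | pushPop {l l₁ r₁ l' s s₁ s₂ s₃ r ph' s' v γ : ℕ} {w w₁ w' : Val (P.numClock + 1)}
      {π₁ π₂ : ℕ → ℕ} {δ₁ δ₂ : ℚ≥0} {ψ ψ' : StackConstraint} (z : Val (P.numStackClock + 1))
      (h₁ : Rule.mk l (.push γ ψ) l₁ ∈ P.rules) (hb₁ : P.pushB s s₁ = true)
      (hψ : stackSat w z (P.pushC s v ψ)) (t₁ : FracRun P l₁ 0 s₁ w π₁ δ₁ r₁ 0 s₂ w₁)
      (h₂ : Rule.mk r₁ (.pop γ ψ') l' ∈ P.rules) (hb₂ : P.popB s s₂ s₃ = true)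
      (hψ' : stackSat w₁ (fun i => z i + δ₁) (P.popC s s₂ v ψ'))
      (t₂ : FracRun P l' 0 s₃ w₁ π₂ δ₂ r ph' s' w') :
      FracRun P l 0 s w (π₁ + π₂) (δ₁ + δ₂) r ph' s' w'
  | wait {l s r ph' s' : ℕ} {w w' : Val (P.numClock + 1)} {π : ℕ → ℕ} {δ' : ℚ≥0} (δ : ℚ≥0)
      (t : FracRun P l 1 s (fun x => w x + δ) π δ' r ph' s' w') :
      FracRun P l 1 s w π (δ + δ') r ph' s' w'
  | finish {l s r ph' s' : ℕ} {w w' : Val (P.numClock + 1)} {π : ℕ → ℕ} {δ : ℚ≥0}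
      (t : FracRun P l 0 s w π δ r ph' s' w') : FracRun P l 1 s w π δ r ph' s' w'
  | nonint {l s r ph' s' : ℕ} {w w' : Val (P.numClock + 1)} {π : ℕ → ℕ} {δ : ℚ≥0}
      (h : Int.fract (w.get P.numClock : ℚ) ≠ 0) (t : FracRun P l 2 s w π δ r ph' s' w') :
      FracRun P l 1 s w π δ r ph' s' w'
  | cross {l s r ph' s' : ℕ} {w w' : Val (P.numClock + 1)} {π : ℕ → ℕ} {δ' : ℚ≥0} (δ : ℚ≥0)
      (t : FracRun P l 3 s (fun x => w x + δ) π δ' r ph' s' w') :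
      FracRun P l 2 s w π (δ + δ') r ph' s' w'
  | int {l s r ph' s' : ℕ} {w w' : Val (P.numClock + 1)} {π : ℕ → ℕ} {δ : ℚ≥0}
      (h : Int.fract (w.get P.numClock : ℚ) = 0) (t : FracRun P l 4 s w π δ r ph' s' w') :
      FracRun P l 3 s w π δ r ph' s' w'
  | tick {l s s₁ r ph' s' : ℕ} {w w' : Val (P.numClock + 1)} {π : ℕ → ℕ} {δ : ℚ≥0}
      (hb : P.tickB s s₁ = true) (t : FracRun P l 1 s₁ w π δ r ph' s' w') :
      FracRun P l 4 s w (letterCount (some P.numInput) + π) δ r ph' s' w'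

theorem Balanced.fracRun (hP : P.Valid) {c c' : ℕ} {w w' : Val P.toFractional.numClock}
    {π : ℕ → ℕ} {δ : ℚ≥0} (h : Balanced P.toFractional c w π δ c' w') {l ph s r ph' s' : ℕ}
    (hc : c = P.locCode l ph s) (hc' : c' = P.locCode r ph' s') (hl : l < P.numLoc) (hph : ph < 5)
    (hr : r < P.numLoc) (hph' : ph' < 5) : FracRun P l ph s w π δ r ph' s' w' := by
  induction h generalizing l ph s r ph' s' with
  | nil c w =>
    obtain ⟨rfl, rfl, rfl⟩ := locCode_inj (hc.symm.trans hc') hl hr hph hph'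
    exact .nil _ _ _ _
  | elapse δ h t ih =>
    rw [hc] at h
    generalize e : P.locCode l ph s = a at h
    cases mem_toFractional_rules.1 h with
    | wait hl₀ hs =>
      obtain ⟨rfl, rfl, rfl⟩ := locCode_inj e hl hl₀ hph (by omega)
      exact .wait δ (ih rfl hc' hl (by omega) hr hph')
    | cross hl₀ hs =>
      obtain ⟨rfl, rfl, rfl⟩ := locCode_inj e hl hl₀ hph (by omega)
      exact .cross δ (ih rfl hc' hl (by omega) hr hph')
  | input h t ih =>
    rw [hc] at h
    generalize e : P.locCode l ph s = a at h
    cases mem_toFractional_rules.1 h with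
    | start h₀ hs =>
      obtain ⟨rfl, rfl, rfl⟩ := locCode_inj e hl (hP.op h₀).1 hph (by omega)
      rw [letterCount, zero_add]
      exact .start h₀ (ih rfl hc' (hP.op h₀).2.1 (by omega) hr hph')
    | input h₀ hs =>
      obtain ⟨rfl, rfl, rfl⟩ := locCode_inj e hl (hP.op h₀).1 hph (by omega)
      exact .input h₀ (ih rfl hc' (hP.op h₀).2.1 (by omega) hr hph')
    | finish hl₀ hs =>
      obtain ⟨rfl, rfl, rfl⟩ := locCode_inj e hl hl₀ hph (by omega)
      rw [letterCount, zero_add]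
      exact .finish (ih rfl hc' hl (by omega) hr hph')
    | tick hl₀ hs hs' hb =>
      obtain ⟨rfl, rfl, rfl⟩ := locCode_inj e hl hl₀ hph (by omega)
      exact .tick hb (ih rfl hc' hl (by omega) hr hph')
  | test h hφ t ih =>
    rw [hc] at h
    generalize e : P.locCode l ph s = a at h
    cases mem_toFractional_rules.1 h with
    | test h₀ hs =>
      obtain ⟨rfl, rfl, rfl⟩ := locCode_inj e hl (hP.op h₀).1 hph (by omega)
      exact .test h₀ hφ (ih rfl hc' (hP.op h₀).2.1 (by omega) hr hph')
    | nonint hl₀ hs =>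
      obtain ⟨rfl, rfl, rfl⟩ := locCode_inj e hl hl₀ hph (by omega)
      exact .nonint hφ (ih rfl hc' hl (by omega) hr hph')
    | int hl₀ hs =>
      obtain ⟨rfl, rfl, rfl⟩ := locCode_inj e hl hl₀ hph (by omega)
      exact .int hφ (ih rfl hc' hl (by omega) hr hph')
  | reset h t ih =>
    rw [hc] at h
    generalize e : P.locCode l ph s = a at h
    cases mem_toFractional_rules.1 h with
    | reset h₀ hs hs' hb =>
      obtain ⟨rfl, rfl, rfl⟩ := locCode_inj e hl (hP.op h₀).1 hph (by omega)
      exact .reset h₀ hb (ih rfl hc' (hP.op h₀).2.1 (by omega) hr hph')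
  | @pushPop _ _ _ _ _ _ _ _ _ _ _ _ γ ψ ψ' z h₁ hψ _ h₂ hψ' _ ih₁ ih₂ =>
    rw [hc] at h₁
    generalize e : P.locCode l ph s = a at h₁
    generalize e' : γ = γ' at h₂
    cases mem_toFractional_rules.1 h₁ with
    | push h₃ hs hs' hb₁ hv =>
      obtain ⟨rfl, rfl, rfl⟩ := locCode_inj e hl (hP.op h₃).1 hph (by omega)
      cases mem_toFractional_rules.1 h₂ with
      | pop h₄ hs₄ hs₄' ht hb₂ hv =>
        obtain ⟨rfl, rfl, rfl⟩ := symCode_inj e' (hP.op h₃).2.2.1 (hP.op h₄).2.2.1 hs ht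
        exact .pushPop z h₃ hb₁ hψ (ih₁ rfl rfl (hP.op h₃).2.1 (by omega) (hP.op h₄).1 (by omega))
          h₄ hb₂ hψ' (ih₂ rfl hc' (hP.op h₄).2.1 (by omega) hr hph')

theorem FracRun.last (hP : P.Valid) {l ph s r ph' s' : ℕ} {w w' : Val (P.numClock + 1)}
    {π : ℕ → ℕ} {δ : ℚ≥0} (h : FracRun P l ph s w π δ r ph' s' w') :
    w'.get P.numClock = w.get P.numClock + δ := by
  induction h with
  | nil => simp
  | wait δ _ ih | cross δ _ ih => rw [ih, get_last_add, add_assoc]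
  | reset h _ _ ih => rw [ih, get_last_reset _ (hP.op h).2.2]
  | pushPop z h₁ _ hψ _ h₂ _ hψ' _ ih₁ ih₂ => rw [ih₂, ih₁, add_assoc]
  | _ => assumption

/-- The potential grows with each tick. -/
theorem FracRun.potential_le (hP : P.Valid) {l ph s r ph' s' : ℕ} {w w' : Val (P.numClock + 1)}
    {π : ℕ → ℕ} {δ : ℚ≥0} (h : FracRun P l ph s w π δ r ph' s' w') :
    potential ph (w.get P.numClock) + π P.numInput ≤ potential ph' (w'.get P.numClock) := by
  induction h with
  | nil => simp
  | @wait _ _ _ _ _ w _ _ _ δ _ ih =>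
    have := floor_le_floor_add (w.get P.numClock) δ
    rw [get_last_add, potential_one] at ih
    rw [potential_one]
    omega
  | @cross _ _ _ _ _ w _ _ _ δ _ ih =>
    have := ceil_le_ceil_add (w.get P.numClock) δ
    rw [get_last_add, potential_three] at ih
    rw [potential_two]
    omega
  | start _ _ ih | finish _ ih | test _ _ _ ih => exact ih
  | input h _ ih =>
    rw [Pi.add_apply, letterCount_ne fun c hc => ((hP.op h).2.2 c hc).ne, zero_add]
    exact ih
  | nonint h _ ih => rwa [potential_two_eq h] at ih
  | int h _ ih => rwa [potential_three_eq h]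
  | tick _ _ ih =>
    rw [Pi.add_apply, letterCount_self]
    rw [potential_four]
    rw [potential_one] at ih
    push_cast; omega
  | reset h _ _ ih => rwa [get_last_reset _ (hP.op h).2.2] at ih
  | pushPop z h₁ _ hψ _ h₂ _ hψ' _ ih₁ ih₂ =>
    rw [Pi.add_apply, Nat.cast_add]
    omega

/-- The abstraction of integer parts by a state of the simulating automaton. -/
def times (P : Automaton) (ph : ℕ) (w : Val (P.numClock + 1)) : ℕ → ℤ :=
  resetTimes w (potential ph (w.get P.numClock))

theorem times_congr {w : Val (P.numClock + 1)} {ph ph' : ℕ}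
    (h : potential ph (w.get P.numClock) = potential ph' (w.get P.numClock)) :
    P.times ph w = P.times ph' w := by rw [times, times, h]

theorem times_elapse {w : Val (P.numClock + 1)} {ph ph' : ℕ} {δ : ℚ≥0}
    (h : potential ph' (w.get P.numClock + δ) = potential ph (w.get P.numClock)) :
    P.times ph' (fun x => w x + δ) = P.times ph w := by
  funext i
  rw [times, resetTimes_add, get_last_add, h, times]

theorem AgeOK.reset_times (hP : P.Valid) {l l' s s' : ℕ} {Y : List ℕ}
    (h : Rule.mk l (.reset Y) l' ∈ P.rules) {w : Val (P.numClock + 1)} (hb : P.resetB Y s s' = true)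
    (hs : P.AgeOK s (P.times 0 w)) :
    P.AgeOK s' (P.times 0 fun x => if (x : ℕ) ∈ Y then 0 else w x) := by
  have hY := (hP.op h).2.2
  refine hs.reset hb (fun i hi => ?_) ?_
  · simp only [times, get_last_reset _ hY, potential_zero]
    rw [resetTimes_reset _ hY hi, resetTimes_last]
  · simp only [times, get_last_reset _ hY, resetTimes_last]

theorem OffOK.reset_times (hP : P.Valid) {l l' s s' : ℕ} {Y : List ℕ}
    (h : Rule.mk l (.reset Y) l' ∈ P.rules) {w : Val (P.numClock + 1)} (hb : P.resetB Y s s' = true)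
    {E : ℕ → ℤ} (hs : P.OffOK s E (P.times 0 w)) :
    P.OffOK s' E (P.times 0 fun x => if (x : ℕ) ∈ Y then 0 else w x) := by
  have hY := (hP.op h).2.2
  refine hs.reset hb (fun i hi => ?_) ?_
  · simp only [times, get_last_reset _ hY, potential_zero]
    rw [resetTimes_reset _ hY hi, resetTimes_last]
  · simp only [times, get_last_reset _ hY, resetTimes_last]

theorem AgeOK.tick_times {s s' : ℕ} {w : Val (P.numClock + 1)} {ph ph' : ℕ}
    (h : potential ph' (w.get P.numClock) = potential ph (w.get P.numClock) + 1)
    (hb : P.tickB s s' = true) (hs : P.AgeOK s (P.times ph w)) : P.AgeOK s' (P.times ph' w) :=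
  hs.tick hb (fun i hi => by rw [times, times, resetTimes_of_lt _ _ hi, resetTimes_of_lt _ _ hi])
    (by rw [times, times, resetTimes_last, resetTimes_last, h])

theorem OffOK.tick_times {s s' : ℕ} {w : Val (P.numClock + 1)} {ph ph' : ℕ}
    (h : potential ph' (w.get P.numClock) = potential ph (w.get P.numClock) + 1)
    (hb : P.tickB s s' = true) {E : ℕ → ℤ} (hs : P.OffOK s E (P.times ph w)) :
    P.OffOK s' E (P.times ph' w) :=
  hs.tick hb (fun i hi => by rw [times, times, resetTimes_of_lt _ _ hi, resetTimes_of_lt _ _ hi])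
    (by rw [times, times, resetTimes_last, resetTimes_last, h])

/-- Soundness of the simulation. -/
theorem FracRun.sound (hP : P.Valid) {l ph s r ph' s' : ℕ} {w w' : Val (P.numClock + 1)}
    {π : ℕ → ℕ} {δ : ℚ≥0} (h : FracRun P l ph s w π δ r ph' s' w') (hph' : ph' = 0)
    (hV : potential ph (w.get P.numClock) + π P.numInput = potential 0 (w'.get P.numClock))
    (hs : P.AgeOK s (P.times ph w)) :
    P.AgeOK s' (P.times 0 w') ∧
    (∀ E, P.OffOK s E (P.times ph w) → P.OffOK s' E (P.times 0 w')) ∧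
    ∃ δ₁ δ₂ π', δ = δ₁ + δ₂ ∧ (ph = 0 → δ₁ = 0) ∧ (∀ a < P.numInput, π' a = π a) ∧
      Balanced P l (fun x => w.init x + δ₁) π' δ₂ r w'.init := by
  have zero : ∀ w : Val (P.numClock + 1), (fun x => w.init x + 0) = w.init := fun w => by simp
  induction h with
  | nil l ph s w =>
    subst hph'
    exact ⟨hs, fun _ h => h, 0, 0, 0, by simp, fun _ => rfl, fun _ _ => rfl,
      by rw [zero]; exact .nil l w.init⟩
  | start h t ih =>
    obtain ⟨a1, a2, δ₁, δ₂, π', a3, a4, a5, a6⟩ := ih hph' hV hs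
    refine ⟨a1, a2, 0, δ₁ + δ₂, π', by simpa using a3, fun _ => rfl, a5, ?_⟩
    rw [zero]
    exact .elapse _ h a6
  | input h t ih =>
    rw [Pi.add_apply, letterCount_ne fun c hc => ((hP.op h).2.2 c hc).ne, zero_add] at hV
    obtain ⟨a1, a2, δ₁, δ₂, π', a3, a4, a5, a6⟩ := ih hph' hV hs
    exact ⟨a1, a2, δ₁, δ₂, _, a3, a4, fun a ha => by rw [Pi.add_apply, Pi.add_apply, a5 a ha],
      .input h a6⟩
  | test h hφ t ih =>
    obtain ⟨a1, a2, δ₁, δ₂, π', a3, a4, a5, a6⟩ := ih hph' hV hs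
    refine ⟨a1, a2, δ₁, δ₂, π', a3, a4, a5, .test h ?_ a6⟩
    rw [a4 rfl, zero]
    exact (sat_testC hP h hs).1 hφ
  | reset h hb t ih =>
    obtain ⟨a1, a2, δ₁, δ₂, π', a3, a4, a5, a6⟩ := ih hph'
      (by rwa [get_last_reset _ (hP.op h).2.2]) (hs.reset_times hP h hb)
    refine ⟨a1, fun E hE => a2 E (hE.reset_times hP h hb), δ₁, δ₂, π', a3, a4, a5, .reset h ?_⟩
    rw [a4 rfl] at a6 ⊢
    simp only [add_zero] at a6 ⊢
    exact a6
  | @pushPop _ _ _ _ _ _ _ _ _ _ _ v γ w w₁ w' π₁ π₂ δ δ' ψ ψ' z h₁ hb₁ hψ t₁ h₂ hb₂ hψ' t₂ ih₁ ih₂ =>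
    rw [Pi.add_apply, Nat.cast_add] at hV
    have p1 := t₁.potential_le hP
    have p2 := t₂.potential_le hP
    subst hph'
    obtain ⟨a1, a2, δ₁, δ₂, π', a3, a4, a5, a6⟩ := ih₁ rfl (by omega)
      (hs.same (pushB_iff.1 hb₁).1)
    obtain ⟨b1, b2, ε₁, ε₂, ρ', b3, b4, b5, b6⟩ := ih₂ rfl (by omega)
      (a1.same (popB_iff.1 hb₂).1)
    have hoff := a2 _ (offOK_push hb₁)
    obtain ⟨ζ, hζ⟩ := exists_stackRel_of_push hs hψ
    have hδ : δ = δ₂ := by rw [a3, a4 rfl, zero_add]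
    subst hδ
    refine ⟨b1, fun E hE => b2 E (hE.pop hoff hb₂), 0, δ + ε₂, π' + ρ', ?_, fun _ => rfl,
      fun a ha => by rw [Pi.add_apply, Pi.add_apply, a5 a ha, b5 a ha], ?_⟩
    · rw [b3, b4 rfl, zero_add, zero_add]
    · rw [zero]
      rw [a4 rfl, zero] at a6
      rw [b4 rfl, zero] at b6
      exact .pushPop ζ h₁ ((hζ.sat_push hP h₁).1 (sat_pushC.1 hψ).2.2) a6 h₂
        ((hζ.sat_popC hP h₂ (t₁.last hP) hoff).1 hψ') b6
  | @wait _ _ _ _ _ w w' _ _ δ t ih =>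
    have hp := t.potential_le hP
    rw [get_last_add] at hp
    have h1 := floor_le_floor_add (w.get P.numClock) δ
    subst hph'
    have e : potential 1 (w.get P.numClock + δ) = potential 1 (w.get P.numClock) := by
      rw [potential_one] at hp hV ⊢; rw [potential_one]; omega
    obtain ⟨a1, a2, δ₁, δ₂, π', a3, a4, a5, a6⟩ := ih rfl (by rw [get_last_add, e]; exact hV)
      (by rwa [times_elapse e])
    rw [times_elapse e] at a2
    refine ⟨a1, a2, δ + δ₁, δ₂, π', by rw [a3, add_assoc], by simp, a5, ?_⟩
    convert a6 using 1
    funext x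
    exact (add_assoc _ _ _).symm
  | @cross _ _ _ _ _ w w' _ _ δ t ih =>
    have hp := t.potential_le hP
    rw [get_last_add] at hp
    have h1 := ceil_le_ceil_add (w.get P.numClock) δ
    subst hph'
    have e : potential 3 (w.get P.numClock + δ) = potential 2 (w.get P.numClock) := by
      rw [potential_three] at hp ⊢; rw [potential_two] at hV ⊢; omega
    obtain ⟨a1, a2, δ₁, δ₂, π', a3, a4, a5, a6⟩ := ih rfl (by rw [get_last_add, e]; exact hV)
      (by rwa [times_elapse e])
    rw [times_elapse e] at a2
    refine ⟨a1, a2, δ + δ₁, δ₂, π', by rw [a3, add_assoc], by simp, a5, ?_⟩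
    convert a6 using 1
    funext x
    exact (add_assoc _ _ _).symm
  | finish t ih =>
    obtain ⟨a1, a2, δ₁, δ₂, π', a3, a4, a5, a6⟩ := ih hph' hV hs
    exact ⟨a1, a2, δ₁, δ₂, π', a3, by simp, a5, a6⟩
  | nonint h t ih =>
    obtain ⟨a1, a2, δ₁, δ₂, π', a3, a4, a5, a6⟩ := ih hph' (by rwa [potential_two_eq h])
      (by rwa [times_congr (ph' := 1) (potential_two_eq h)])
    rw [times_congr (ph' := 1) (potential_two_eq h)] at a2
    exact ⟨a1, a2, δ₁, δ₂, π', a3, by simp, a5, a6⟩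
  | int h t ih =>
    have e := potential_three_eq h
    rw [← potential_four] at e
    obtain ⟨a1, a2, δ₁, δ₂, π', a3, a4, a5, a6⟩ := ih hph' (by rwa [e] at hV)
      (by rwa [times_congr e] at hs)
    rw [← times_congr e] at a2
    exact ⟨a1, a2, δ₁, δ₂, π', a3, by simp, a5, a6⟩
  | @tick _ _ _ _ _ _ w _ _ _ hb t ih =>
    rw [Pi.add_apply, letterCount_self, Nat.cast_add] at hV
    have e : potential 1 (w.get P.numClock) = potential 4 (w.get P.numClock) + 1 := by
      rw [potential_one, potential_four]; ring
    obtain ⟨a1, a2, δ₁, δ₂, π', a3, a4, a5, a6⟩ := ih hph'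
      (by rw [e]; push_cast at hV; omega) (hs.tick_times e hb)
    refine ⟨a1, fun E hE => a2 E (hE.tick_times e hb), δ₁, δ₂, π', a3, by simp, fun a ha => ?_, a6⟩
    rw [a5 a ha, Pi.add_apply, letterCount_ne (by rintro c ⟨⟩; exact ha.ne'), zero_add]

end Automaton

end TPDA

/-! ## Elimination of integer and modular constraints: completeness and correctness -/

namespace TPDA

namespace Automaton

variable {P : Automaton}

theorem balanced_cast_elapse {c c₁ c' : ℕ} {w w' : Val (P.numClock + 1)} {π : ℕ → ℕ} {δ' : ℚ≥0}
    (δ : ℚ≥0) (h : FracRule P c .elapse c₁)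
    (t : Balanced P.toFractional c₁ (fun x => w x + δ : Val (P.numClock + 1)) π δ' c' w') :
    Balanced P.toFractional c w π (δ + δ') c' w' :=
  .elapse δ (mem_toFractional_rules.2 h) t

theorem balanced_cast_none {c c₁ c' : ℕ} {w w' : Val (P.numClock + 1)} {π : ℕ → ℕ} {δ : ℚ≥0}
    (h : FracRule P c (.input none) c₁) (t : Balanced P.toFractional c₁ w π δ c' w') :
    Balanced P.toFractional c w π δ c' w' := by
  have := Balanced.input (mem_toFractional_rules.2 h) t
  rwa [letterCount, zero_add] at this

/-- Simulation of a time elapse. -/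
theorem exists_balanced_elapse {l : ℕ} (hl : l < P.numLoc) (m : ℕ) {s : ℕ} (hs : s < P.numAbs)
    (w : Val (P.numClock + 1)) (δ : ℚ≥0)
    (hm : ⌊((w.get P.numClock + δ : ℚ≥0) : ℚ)⌋ = ⌊(w.get P.numClock : ℚ)⌋ + m)
    (hw : P.AgeOK s (P.times 1 w)) :
    ∃ s' < P.numAbs, Balanced P.toFractional (P.locCode l 1 s) w (Pi.single P.numInput m) δ
        (P.locCode l 1 s') (fun x => w x + δ : Val (P.numClock + 1)) ∧
      P.AgeOK s' (P.times 1 fun x => w x + δ) ∧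
      ∀ E, P.OffOK s E (P.times 1 w) → P.OffOK s' E (P.times 1 fun x => w x + δ) := by
  induction m generalizing s w δ with
  | zero =>
    have e : potential 1 (w.get P.numClock + δ) = potential 1 (w.get P.numClock) := by
      rw [potential_one, potential_one, hm]; simp
    refine ⟨s, hs, ?_, by rwa [times_elapse e], fun E hE => by rwa [times_elapse e]⟩
    have := balanced_cast_elapse (w := w) δ (.wait hl hs) (.nil _ _)
    rwa [add_zero, ← Pi.single_zero P.numInput] at this
  | succ m ih =>
    set T := w.get P.numClock
    have hT := Int.floor_add_fract (T : ℚ)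
    have hT1 := Int.fract_lt_one (T : ℚ)
    obtain ⟨g, hg⟩ : ∃ g : ℚ≥0, (g : ℚ) = (1 - Int.fract (T : ℚ)) / 2 :=
      ⟨⟨(1 - Int.fract (T : ℚ)) / 2, by linarith⟩, rfl⟩
    have hle : g + g ≤ δ := by
      have h1 := Int.floor_le ((T + δ : ℚ≥0) : ℚ)
      rw [hm] at h1
      push_cast at h1
      have : ((g + g : ℚ≥0) : ℚ) ≤ δ := by
        push_cast
        rw [hg]
        have := (Nat.cast_nonneg m : (0 : ℚ) ≤ m)
        linarith
      exact_mod_cast this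
    obtain ⟨δ', rfl⟩ := exists_add_of_le hle
    have e1 : ((T + g : ℚ≥0) : ℚ) = ⌊(T : ℚ)⌋ + (1 + Int.fract (T : ℚ)) / 2 := by
      push_cast; rw [hg]; linarith
    have e2 : ((T + g + g : ℚ≥0) : ℚ) = ((⌊(T : ℚ)⌋ + 1 : ℤ) : ℚ) := by
      push_cast; rw [hg]; linarith
    have f0 := Int.fract_nonneg (T : ℚ)
    have hd : (1 + Int.fract (T : ℚ)) / 2 ∈ Set.Ico (0 : ℚ) 1 := ⟨by linarith, by linarith⟩
    have h1 : ⌊((T + g : ℚ≥0) : ℚ)⌋ = ⌊(T : ℚ)⌋ := by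
      rw [e1, Int.floor_intCast_add, Int.floor_eq_zero_iff.2 hd, add_zero]
    have h2 : Int.fract ((T + g : ℚ≥0) : ℚ) ≠ 0 := by
      rw [e1, Int.fract_intCast_add, Int.fract_eq_self.2 hd]
      linarith
    have h3 : ⌊((T + g + g : ℚ≥0) : ℚ)⌋ = ⌊(T : ℚ)⌋ + 1 := by rw [e2, Int.floor_intCast]
    have h4 : Int.fract ((T + g + g : ℚ≥0) : ℚ) = 0 := by rw [e2, Int.fract_intCast]
    set w₁ : Val (P.numClock + 1) := fun x => w x + g
    set w₂ : Val (P.numClock + 1) := fun x => w₁ x + g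
    have l1 : w₁.get P.numClock = T + g := get_last_add _ _
    have l2 : w₂.get P.numClock = T + g + g := by rw [get_last_add, l1]
    have e3 : potential 1 (T + g) = potential 1 T := h1
    have e4 : potential 4 (w₁.get P.numClock + g) = potential 1 (w₁.get P.numClock) := by
      rw [l1, potential_four, potential_one, h3, h1, add_sub_cancel_right]
    have t1 : P.times 4 w₂ = P.times 1 w := by rw [times_elapse e4, times_elapse e3]
    have tick : potential 1 (w₂.get P.numClock) = potential 4 (w₂.get P.numClock) + 1 := by
      rw [potential_one, potential_four]; ring
    have hw4 : P.AgeOK s (P.times 4 w₂) := by rwa [t1]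
    obtain ⟨s₁, hs₁, hb⟩ := exists_tick hw4 (F' := P.times 1 w₂)
      (fun i hi => by rw [times, times, resetTimes_of_lt _ _ hi, resetTimes_of_lt _ _ hi])
      (by rw [times, times, resetTimes_last, resetTimes_last, tick])
    obtain ⟨s', hs', b1, b2, b3⟩ := ih hs₁ w₂ δ' (by
      rw [l2, h3]
      have : T + g + g + δ' = T + (g + g + δ') := by ring
      rw [this, hm]; push_cast; ring) (hw4.tick_times tick hb)
    have e5 : (fun x => w x + (g + g + δ') : Val (P.numClock + 1)) = fun x => w₂ x + δ' := by
      funext x; simp only [w₂, w₁]; ring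
    rw [e5]
    refine ⟨s', hs', ?_, b2, fun E hE => b3 E (OffOK.tick_times tick hb (by rwa [t1]))⟩
    have c1 := Balanced.input (mem_toFractional_rules.2 (.tick hl hs hs₁ hb)) b1
    have c2 := Balanced.test (mem_toFractional_rules.2 (.int hl hs))
      ((transSat_fracZero w₂ _).2 (by rw [l2]; exact h4)) c1
    have c3 := balanced_cast_elapse (w := w₁) g (.cross hl hs) c2
    have c4 := Balanced.test (mem_toFractional_rules.2 (.nonint hl hs))
      ((transSat_not_fracZero w₁ _).2 (by rw [l1]; exact h2)) c3
    have c5 := balanced_cast_elapse (w := w) g (.wait hl hs) c4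
    rw [letterCount, ← Pi.single_add, add_comm 1] at c5
    rw [add_assoc g g]
    exact c5

/-- Completeness of the simulation. -/
theorem toFractional_complete (hP : P.Valid) {l r : ℕ} {μ ν : Val P.numClock} {π : ℕ → ℕ}
    {δ : ℚ≥0} (h : Balanced P l μ π δ r ν) (hl : l < P.numLoc) (T : ℚ≥0) {s : ℕ}
    (hs : s < P.numAbs) (hw : P.AgeOK s (P.times 0 (μ.snoc T))) :
    ∃ s' < P.numAbs, ∃ π' : ℕ → ℕ,
      Balanced P.toFractional (P.locCode l 0 s) (μ.snoc T) π' δ (P.locCode r 0 s')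
        (ν.snoc (T + δ)) ∧
      ((π' P.numInput : ℕ) : ℤ) = ⌊((T + δ : ℚ≥0) : ℚ)⌋ - ⌊(T : ℚ)⌋ ∧
      (∀ a < P.numInput, π' a = π a) ∧ P.AgeOK s' (P.times 0 (ν.snoc (T + δ))) ∧
      ∀ E, P.OffOK s E (P.times 0 (μ.snoc T)) → P.OffOK s' E (P.times 0 (ν.snoc (T + δ))) := by
  induction h generalizing T s with
  | nil l μ => exact ⟨s, hs, 0, by rw [add_zero]; exact .nil _ _, by simp, fun _ _ => rfl,
      by rwa [add_zero], fun E hE => by rwa [add_zero]⟩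
  | @elapse l l' r μ ν π δ' δ h t ih =>
    obtain ⟨m, hm⟩ := Int.eq_ofNat_of_zero_le (sub_nonneg.2 (floor_le_floor_add T δ))
    have hl' := (hP.op h).2.1
    obtain ⟨s₁, hs₁, a1, a2, a3⟩ := exists_balanced_elapse hl' m hs (μ.snoc T) δ
      (by rw [Val.snoc_get_last]; omega) hw
    rw [← Val.snoc_add] at a1 a2 a3
    obtain ⟨s', hs', π', b1, b2, b3, b4, b5⟩ := ih hl' (T + δ) hs₁ a2
    rw [← add_assoc T]
    refine ⟨s', hs', _, balanced_cast_none (.start h hs)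
      (a1.trans (balanced_cast_none (.finish hl' hs₁) b1)), ?_, fun a ha => ?_, b4,
      fun E hE => b5 E (a3 E hE)⟩
    · rw [Pi.add_apply, Pi.single_eq_same, Nat.cast_add, b2]; omega
    · rw [Pi.add_apply, Pi.single_eq_of_ne ha.ne, b3 a ha, zero_add]
  | input h t ih =>
    obtain ⟨s', hs', π', b1, b2, b3, b4, b5⟩ := ih (hP.op h).2.1 T hs hw
    refine ⟨s', hs', _, .input (mem_toFractional_rules.2 (.input h hs)) b1, ?_, fun a ha => ?_, b4,
      b5⟩
    · rw [Pi.add_apply, letterCount_ne fun c hc => ((hP.op h).2.2 c hc).ne, zero_add, b2]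
    · rw [Pi.add_apply, Pi.add_apply, b3 a ha]
  | @test l l' r μ ν π δ φ h hφ t ih =>
    obtain ⟨s', hs', π', b1, b2, b3, b4, b5⟩ := ih (hP.op h).2.1 T hs hw
    refine ⟨s', hs', π', .test (mem_toFractional_rules.2 (.test h hs)) ?_ b1, b2, b3, b4, b5⟩
    exact (sat_testC hP h (w := μ.snoc T) hw).2 (by rwa [Val.init_snoc])
  | @reset l l' r μ ν π δ Y h t ih =>
    obtain ⟨s₁, hs₁, hb⟩ := P.exists_reset Y s
    have e := Val.snoc_reset μ T (hP.op h).2.2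
    obtain ⟨s', hs', π', b1, b2, b3, b4, b5⟩ := ih (hP.op h).2.1 T hs₁
      (by rw [e]; exact hw.reset_times hP h hb)
    rw [e] at b1 b5
    exact ⟨s', hs', π', .reset (mem_toFractional_rules.2 (.reset h hs hs₁ hb)) b1, b2, b3, b4,
      fun E hE => b5 E (hE.reset_times hP h hb)⟩
  | @pushPop l l₁ r₁ l' r μ μ₁ ν π₁ π₂ δ₁ δ₂ γ ψ ψ' ζ h₁ hψ t₁ h₂ hψ' t₂ ih₁ ih₂ =>
    obtain ⟨s₁, hs₁, hb₁⟩ := P.exists_push s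
    obtain ⟨s₂, hs₂, π₁', a1, a2, a3, a4, a5⟩ := ih₁ (hP.op h₁).2.1 T hs₁
      (hw.same (pushB_iff.1 hb₁).1)
    obtain ⟨s₃, hs₃, hb₂⟩ := P.exists_pop s s₂
    obtain ⟨s', hs', π₂', b1, b2, b3, b4, b5⟩ := ih₂ (hP.op h₂).2.1 (T + δ₁) hs₃
      (a4.same (popB_iff.1 hb₂).1)
    have hoff := a5 _ (offOK_push hb₁)
    obtain ⟨v, hv, hζ, hz⟩ := exists_stackRel (w := μ.snoc T) hw ζ
    rw [← add_assoc T]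
    refine ⟨s', hs', _, .pushPop (ζ.snoc T : Val (P.numStackClock + 1))
      (mem_toFractional_rules.2 (.push h₁ hs hs₁ hb₁ hv)) ?_ a1
      (mem_toFractional_rules.2 (.pop h₂ hs₂ hs₃ hs hb₂ hv)) ?_ b1, ?_, fun a ha => ?_, b4,
      fun E hE => b5 E (hE.pop hoff hb₂)⟩
    · refine (sat_pushC (w := μ.snoc T) (z := ζ.snoc T)).2 ⟨?_, fun j hj h0 => ?_, ?_⟩
      · rw [Val.snoc_get_last, Val.snoc_get_last]
      · have := hz j hj h0
        rwa [Val.snoc_get _ _ hj, Val.snoc_get_last, ← Val.snoc_get_last μ T]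
      · rw [Val.snoc_get_last] at hζ
        exact (hζ.sat_push hP h₁).2 (by rwa [Val.init_snoc])
    · rw [Val.snoc_get_last] at hζ
      exact (hζ.sat_popC hP h₂ (w' := μ₁.snoc (T + δ₁))
        (by rw [Val.snoc_get_last, Val.snoc_get_last]) hoff).2 (by rwa [Val.init_snoc])
    · rw [Pi.add_apply, Nat.cast_add, a2, b2]; ring
    · rw [Pi.add_apply, Pi.add_apply, a3 a ha, b3 a ha]

/-! ### The reachability relation -/

/-- A formula for similarity of a difference of terms and a difference of numbers. -/
def simFormula (K M : ℕ) (x y : LinTerm ℤ) (a b : ℕ) : Formula :=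
  .and (.zmod (M - 1).succPNat (.add x (.const b)) (.add y (.const a))) <|
    bif decide (K + b < a) then .zle (.add y (.const (K + 1 : ℕ))) x
    else bif decide (a + K < b) then .zle (.add x (.const (K + 1 : ℕ))) y
    else .zeq (.add x (.const b)) (.add y (.const a))

theorem sat_simFormula {K M : ℕ} (hM : 0 < M) {x y : LinTerm ℤ} {a b : ℕ} {ρ : List ℤ}
    {σ : List ℚ} : (simFormula K M x y a b).Sat ρ σ ↔
      Sim K M (x.eval id ρ - y.eval id ρ) ((a : ℤ) - b) := by
  have h : (((M - 1).succPNat : ℕ) : ℤ) = M := by rw [Nat.succPNat_coe]; omega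
  have h' : x.eval id ρ + b ≡ y.eval id ρ + a [ZMOD M] ↔
      x.eval id ρ - y.eval id ρ ≡ a - b [ZMOD M] := by
    constructor
    · intro h
      have := h.sub_right (y.eval id ρ + b)
      convert this using 1 <;> ring
    · intro h
      have := h.add_right (y.eval id ρ + b)
      convert this using 1 <;> ring
  rw [simFormula, Formula.Sat, Formula.Sat, Sim, h]
  refine and_congr h' ?_
  by_cases h1 : K + b < a
  · rw [decide_eq_true h1, cond_true]
    simp only [Formula.Sat, LinTerm.eval, id]
    omega
  · rw [decide_eq_false h1, cond_false]
    by_cases h2 : a + K < b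
    · rw [decide_eq_true h2, cond_true]
      simp only [Formula.Sat, LinTerm.eval, id]
      omega
    · rw [decide_eq_false h2, cond_false, Formula.sat_zeq]
      simp only [LinTerm.eval, id]
      omega

theorem scoped_simFormula {K M : ℕ} {x y : LinTerm ℤ} {a b m n : ℕ} (hx : x.Scoped m)
    (hy : y.Scoped m) : (simFormula K M x y a b).Scoped m n := by
  unfold simFormula
  refine ⟨⟨⟨hx, trivial⟩, hy, trivial⟩, ?_⟩
  cases decide (K + b < a) <;> cases decide (a + K < b)
  · exact ⟨⟨⟨hx, trivial⟩, hy, trivial⟩, ⟨hy, trivial⟩, hx, trivial⟩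
  · exact ⟨⟨hx, trivial⟩, hy⟩
  · exact ⟨⟨hy, trivial⟩, hx⟩
  · exact ⟨⟨hy, trivial⟩, hx⟩

/-- The initial state of the simulating automaton fits the initial values of the clocks, and the
last letter counts the integers that the last clock passes. -/
def initFormula (P : Automaton) (s : ℕ) : Formula :=
  .and (.and (.zeq (.var P.numClock) (.const 0))
    (.zeq (.var (2 * P.numClock + P.numInput + 2)) (.var (P.numClock + 1 + P.numInput)))) <|
  .and (.conj ((List.range P.numClock).map fun i => .qle (.var i) (.var P.numClock)))
    (.conj ((List.range (P.numClock + 1)).flatMap fun i => (List.range (P.numClock + 1)).map fun j =>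
      simFormula P.bigThr P.modulus (.var j) (.var i) (P.age s j) (P.age s i)))

def fracEntries (P : Automaton) (l r : ℕ) : List (ℕ × ℕ × Formula) :=
  (List.range P.numAbs).flatMap fun s => bif P.pushB s s then
    (List.range P.numAbs).map fun s' => (P.locCode l 0 s, P.locCode r 0 s', P.initFormula s) else []

section Primrec

variable {α : Type} [Primcodable α]

@[fun_prop] theorem primrec_simFormula {K M a b : α → ℕ} {x y : α → LinTerm ℤ} (hK : Primrec K)
    (hM : Primrec M) (hx : Primrec x) (hy : Primrec y) (ha : Primrec a) (hb : Primrec b) :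
    Primrec fun i => simFormula (K i) (M i) (x i) (y i) (a i) (b i) := by
  unfold simFormula; fun_prop

@[fun_prop] theorem primrec_initFormula {P : α → Automaton} {s : α → ℕ} (hP : Primrec P)
    (hs : Primrec s) : Primrec fun x => (P x).initFormula (s x) := by
  unfold initFormula; fun_prop

theorem primrec_fracEntries :
    Primrec fun p : Automaton × ℕ × ℕ => fracEntries p.1 p.2.1 p.2.2 := by
  unfold fracEntries; fun_prop

end Primrec

theorem mem_fracEntries {l r : ℕ} {e : ℕ × ℕ × Formula} : e ∈ P.fracEntries l r ↔
    ∃ s < P.numAbs, P.pushB s s = true ∧ ∃ s' < P.numAbs,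
      (P.locCode l 0 s, P.locCode r 0 s', P.initFormula s) = e := by
  simp only [fracEntries, List.mem_flatMap, List.mem_range, mem_bif_nil, List.mem_map]

theorem scoped_initFormula (s : ℕ) : (P.initFormula s).Scoped
    (2 * P.numClock + P.numInput + 3) (2 * P.numClock + 2) := by
  simp only [initFormula, Formula.Scoped, Formula.scoped_conj, Formula.zeq, LinTerm.Scoped, and_true,
    true_and,
    List.forall_mem_map, List.forall_mem_flatMap, List.mem_range]
  refine ⟨⟨?_, ?_⟩, fun i hi => ?_, fun i hi j hj => scoped_simFormula ?_ ?_⟩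
  all_goals
    try simp only [LinTerm.Scoped]
    omega

theorem sat_initFormula {s : ℕ} (μ ν : Val P.numClock) (π : Fin P.numInput → ℕ) (p q : ℚ≥0)
    (t : ℕ) : (P.initFormula s).Sat
      (intEnv (μ.snoc p) (Fin.snoc (α := fun _ => ℕ) π t : Fin (P.numInput + 1) → ℕ) (ν.snoc q))
      (ratEnv (μ.snoc p) (ν.snoc q)) ↔
    ⌊(p : ℚ)⌋ = 0 ∧ ⌊(q : ℚ)⌋ = t ∧
      (∀ i < P.numClock, Int.fract (μ.get i : ℚ) ≤ Int.fract (p : ℚ)) ∧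
      P.AgeOK s fun i => -⌊((μ.snoc p).get i : ℚ)⌋ := by
  rw [initFormula, Formula.Sat, Formula.Sat, Formula.Sat, Formula.sat_zeq, Formula.sat_zeq,
    Formula.sat_conj, Formula.sat_conj, List.forall_mem_map, List.forall_mem_flatMap, and_assoc]
  simp only [List.forall_mem_map, List.mem_range, sat_simFormula P.modulus_pos, LinTerm.eval, id,
    Formula.Sat, AgeOK]
  have e : 2 * P.numClock + P.numInput + 2 =
    P.numClock + 1 + (P.numInput + 1) + P.numClock := by ring
  rw [e, intEnv_left _ _ _ (Nat.lt_succ_self _), intEnv_right _ _ _ (Nat.lt_succ_self _),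
    intEnv_mid _ _ _ (Nat.lt_succ_self _), ratEnv_left _ _ (Nat.lt_succ_self _),
    Val.snoc_get_last, Val.snoc_get_last]
  refine and_congr_right fun _ => and_congr ?_ (and_congr ?_ ?_)
  · simp [Fin.snoc]
  · refine forall_congr' fun i => imp_congr_right fun hi => ?_
    rw [ratEnv_left _ _ (by omega), Val.snoc_get _ _ hi]
  · refine forall_congr' fun i => ?_
    rw [Nat.lt_succ_iff]
    refine imp_congr_right fun hi => forall_congr' fun j => ?_
    rw [Nat.lt_succ_iff]
    refine imp_congr_right fun hj => ?_
    rw [intEnv_left _ _ _ (by omega), intEnv_left _ _ _ (by omega), neg_sub_neg]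

theorem times_zero_eq {μ : Val P.numClock} {p : ℚ≥0} (hp : ⌊(p : ℚ)⌋ = 0)
    (h : ∀ i < P.numClock, Int.fract (μ.get i : ℚ) ≤ Int.fract (p : ℚ)) {i : ℕ}
    (hi : i ≤ P.numClock) : P.times 0 (μ.snoc p) i = -⌊((μ.snoc p).get i : ℚ)⌋ := by
  rcases hi.lt_or_eq with hi | rfl
  · rw [times, resetTimes_of_lt _ _ hi, Val.snoc_get_last, Val.snoc_get _ _ hi]
    have := Atom.floor_eq_sub (μ.get i) p
    rw [if_pos (h i hi)] at this
    push_cast at this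
    omega
  · rw [times, resetTimes_last, Val.snoc_get_last, potential_zero, hp, neg_zero]

theorem exists_fract_bound {n : ℕ} (μ : Val n) :
    ∃ p : ℚ≥0, ⌊(p : ℚ)⌋ = 0 ∧ ∀ i < n, Int.fract (μ.get i : ℚ) ≤ Int.fract (p : ℚ) := by
  suffices h : ∀ k, ∃ f : ℚ, 0 ≤ f ∧ f < 1 ∧ ∀ i < k, Int.fract (μ.get i : ℚ) ≤ f by
    obtain ⟨f, h0, h1, h2⟩ := h n
    obtain ⟨p, hp, rfl⟩ := exists_nnrat le_rfl h0 h1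
    exact ⟨p, hp, h2⟩
  intro k
  induction k with
  | zero => exact ⟨0, le_rfl, one_pos, by simp⟩
  | succ k ih =>
    obtain ⟨f, h0, h1, h2⟩ := ih
    refine ⟨max f (Int.fract (μ.get k : ℚ)), h0.trans (le_max_left _ _),
      max_lt h1 (Int.fract_lt_one _), fun i hi => ?_⟩
    rcases Nat.lt_succ_iff_lt_or_eq.1 hi with h | rfl
    · exact (h2 i h).trans (le_max_left _ _)
    · exact le_max_right _ _

theorem reach_toFractional_iff (hP : P.Valid) {l r : ℕ} (hl : l < P.numLoc) (hr : r < P.numLoc)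
    (μ : Val P.numClock) (π : Fin P.numInput → ℕ) (ν : Val P.numClock) :
    P.Reach l r μ π ν ↔ ∃ e ∈ P.fracEntries l r, ∃ (p q : ℚ≥0) (t : ℕ),
      e.2.2.Sat (intEnv (μ.snoc p) (Fin.snoc (α := fun _ => ℕ) π t : Fin (P.numInput + 1) → ℕ)
        (ν.snoc q)) (ratEnv (μ.snoc p) (ν.snoc q)) ∧
      Reach P.toFractional e.1 e.2.1 (μ.snoc p)
        (Fin.snoc (α := fun _ => ℕ) π t : Fin (P.numInput + 1) → ℕ) (ν.snoc q) := by
  rw [reach_iff]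
  constructor
  · rintro ⟨π', δ, h, e⟩
    obtain ⟨p, hp, hμ⟩ := exists_fract_bound μ
    have ht : ∀ i ≤ P.numClock, _ := fun i hi => times_zero_eq hp hμ hi
    obtain ⟨s, hs, h1, h2⟩ := exists_init (P := P) (F := fun i => -⌊((μ.snoc p).get i : ℚ)⌋)
      (fun i hi => by
        simp only [Val.snoc_get_last, hp, neg_zero]
        have : (0 : ℤ) ≤ ⌊((μ.snoc p).get i : ℚ)⌋ := Int.floor_nonneg.2 (NNRat.coe_nonneg _)
        omega)
    obtain ⟨s', hs', ρ, b1, b2, b3, -, -⟩ := toFractional_complete hP h hl p hs (h1.congr ht)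
    refine ⟨_, mem_fracEntries.2 ⟨s, hs, h2, s', hs', rfl⟩, p, p + δ, ρ P.numInput,
      (sat_initFormula ..).2 ⟨hp, ?_, hμ, h1⟩, reach_iff.2 ⟨ρ, δ, b1, fun a => ?_⟩⟩
    · rw [b2, hp, sub_zero]
    · induction a using Fin.lastCases with
      | last => rw [Fin.snoc_last]; rfl
      | cast a => rw [Fin.snoc_castSucc, ← e a]; exact b3 a a.2
  · rintro ⟨e, he, p, q, t, h1, h2⟩
    obtain ⟨s, hs, hb, s', hs', rfl⟩ := mem_fracEntries.1 he
    obtain ⟨hp, hq, hμ, hF⟩ := (sat_initFormula ..).1 h1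
    obtain ⟨π', δ, h, e⟩ := reach_iff.1 h2
    have et : π' P.numInput = t := (e (Fin.last _)).trans (Fin.snoc_last ..)
    obtain ⟨-, -, δ₁, δ₂, ρ, a3, a4, a5, a6⟩ := (h.fracRun hP rfl rfl hl (by omega) hr
      (by omega)).sound hP rfl
      (by rw [Val.snoc_get_last, Val.snoc_get_last, potential_zero, potential_zero, hp, hq, et,
        zero_add])
      (hF.congr fun i hi => times_zero_eq hp hμ hi)
    rw [a4 rfl, Val.init_snoc, Val.init_snoc] at a6
    simp only [add_zero] at a6
    refine ⟨ρ, δ₂, a6, fun a => ?_⟩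
    rw [a5 a a.2]
    exact (e a.castSucc).trans (Fin.snoc_castSucc ..)

theorem effectiveReduction_toFractional :
    EffectiveReduction (fun _ => True) Fractional toFractional :=
  ⟨primrec_toFractional.to_comp, fun _ hP _ => ⟨valid_toFractional hP, fractional_toFractional hP⟩,
    fun P => P.reduceFamily P.fracEntries, computable_reduceFamily primrec_fracEntries,
    fun P hP _ Φ hΦ => expresses_reduceFamily hΦ
      (fun l hl r hr e he => by
        obtain ⟨s, hs, -, s', hs', rfl⟩ := mem_fracEntries.1 he
        exact ⟨locCode_lt hl (by omega) hs, locCode_lt hr (by omega) hs', scoped_initFormula s⟩)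
      fun l hl r hr μ π ν => reach_toFractional_iff hP hl hr μ π ν⟩

end Automaton

end TPDA

/-! ## Push-copy automata: construction -/

namespace TPDA

namespace Atom

variable {C : Type}

/-- Truth of a fractional atom when the fractional parts have the given ranks. -/
def rankB (g : C → ℕ) : Atom C → Bool
  | fracZero x => decide (g x = 0)
  | fracLe x y => decide (g x ≤ g y)
  | _ => false

theorem rankB_iff {g : C → ℕ} {v : C → ℚ≥0} {a : Atom C} (ha : a.IsFractional)
    (h₀ : ∀ x ∈ a.clocks, g x = 0 ↔ Int.fract (v x : ℚ) = 0)
    (h : ∀ x ∈ a.clocks, ∀ y ∈ a.clocks, g x ≤ g y ↔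
      Int.fract (v x : ℚ) ≤ Int.fract (v y : ℚ)) : a.rankB g = true ↔ a.Sat v := by
  cases a with
  | fracZero x => simpa [rankB, Sat] using h₀ x (by simp [clocks])
  | fracLe x y => simpa [rankB, Sat] using h x (by simp [clocks]) y (by simp [clocks])
  | _ => exact ha.elim

@[fun_prop] theorem primrec_rankB {α : Type} [Primcodable α] [Denumerable C] {g : α → C → ℕ}
    {a : α → Atom C} (hg : Primrec fun p : α × C => g p.1 p.2) (ha : Primrec a) :
    Primrec fun x => (a x).rankB (g x) := by
  have hg' : ∀ {β : Type} [Primcodable β] {f : β → α} {k : β → C}, Primrec f → Primrec k →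
      Primrec fun y => g (f y) (k y) := fun hf hk => hg.comp (hf.pair hk)
  refine primrec_casesOn (h := fun x a => a.rankB (g x)) (g₁ := fun _ _ => false)
    (g₂ := fun _ _ => false) (g₃ := fun _ _ => false) (g₄ := fun _ _ => false)
    (g₅ := fun x p => decide (g x p = 0)) (g₆ := fun x p => decide (g x p.1 ≤ g x p.2)) ha
    (by fun_prop) (by fun_prop) (by fun_prop) (by fun_prop) ?_ ?_ ?_
  · have := @hg' (α × C) _ (fun p => p.1) (fun p => p.2) (by fun_prop) (by fun_prop)
    fun_prop
  · have := @hg' (α × C × C) _ (fun p => p.1) (fun p => p.2.1) (by fun_prop) (by fun_prop)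
    have := @hg' (α × C × C) _ (fun p => p.1) (fun p => p.2.2) (by fun_prop) (by fun_prop)
    fun_prop
  · rintro x (_ | _ | _ | _ | _ | _) <;> rfl

end Atom

section RankC

variable {C : Type}

/-- A constraint that is valid if and only if the given boolean says so. -/
def literal (b : Bool) (a : Atom C) : Constraint C := bif b then .atom a else .not (.atom a)

/-- The fractional parts of the given pairs of clocks are ordered like their ranks. -/
def rankC (g : C → ℕ) (l : List (C × C)) : Constraint C :=
  .conj (l.map fun p => .and
    (.and (literal (decide (g p.1 ≤ g p.2)) (.fracLe p.1 p.2))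
      (literal (decide (g p.2 ≤ g p.1)) (.fracLe p.2 p.1)))
    (literal (decide (g p.2 = 0)) (.fracZero p.2)))

theorem sat_literal {b : Bool} {a : Atom C} {v : C → ℚ≥0} :
    (literal b a).Sat (Atom.Sat v) ↔ (b = true ↔ a.Sat v) := by
  cases b <;> simp [literal, BoolComb.Sat]

theorem sat_rankC {g : C → ℕ} {l : List (C × C)} {v : C → ℚ≥0} :
    (rankC g l).Sat (Atom.Sat v) ↔ ∀ p ∈ l,
      (g p.1 ≤ g p.2 ↔ Int.fract (v p.1 : ℚ) ≤ Int.fract (v p.2 : ℚ)) ∧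
      (g p.2 ≤ g p.1 ↔ Int.fract (v p.2 : ℚ) ≤ Int.fract (v p.1 : ℚ)) ∧
      (g p.2 = 0 ↔ Int.fract (v p.2 : ℚ) = 0) := by
  rw [rankC, BoolComb.sat_conj, List.forall_mem_map]
  refine forall_congr' fun p => imp_congr_right fun _ => ?_
  simp only [BoolComb.Sat, sat_literal, decide_eq_true_eq, Atom.Sat, and_assoc]

theorem mem_atoms_literal {b : Bool} {a c : Atom C} : c ∈ (literal b a).atoms ↔ c = a := by
  cases b <;> simp [literal, BoolComb.atoms]

theorem mem_atoms_rankC {g : C → ℕ} {l : List (C × C)} {a : Atom C} (h : a ∈ (rankC g l).atoms) :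
    a.IsFractional ∧ ∃ p ∈ l, (∀ c ∈ a.clocks, c = p.1 ∨ c = p.2) ∧ p.2 ∈ a.clocks := by
  simp only [rankC, BoolComb.mem_atoms_conj, List.mem_map] at h
  obtain ⟨_, ⟨p, hp, rfl⟩, h⟩ := h
  simp only [BoolComb.atoms, List.mem_append, mem_atoms_literal] at h
  rcases h with (rfl | rfl) | rfl
  all_goals
    refine ⟨trivial, p, hp, ?_, by simp [Atom.clocks]⟩
    simp [Atom.clocks]

variable {α : Type} [Primcodable α] [Denumerable C]

@[fun_prop] theorem primrec_literal {b : α → Bool} {a : α → Atom C} (hb : Primrec b)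
    (ha : Primrec a) : Primrec fun x => literal (b x) (a x) := by
  unfold literal; fun_prop

@[fun_prop] theorem primrec_rankC {g : α → C → ℕ} {l : α → List (C × C)}
    (hg : Primrec fun p : α × C => g p.1 p.2) (hl : Primrec l) :
    Primrec fun x => rankC (g x) (l x) := by
  have h1 := hg.comp (g := fun p : α × C × C => (p.1, p.2.1)) (by fun_prop)
  have h2 := hg.comp (g := fun p : α × C × C => (p.1, p.2.2)) (by fun_prop)
  unfold rankC
  fun_prop

end RankC

namespace Automaton

/-- The number of relevant values when an element is removed from the stack: zero, the values of
the global clocks, of their copies on the stack, and of the original stack clocks. -/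
def numPoints (P : Automaton) : ℕ := 2 * P.numClock + 2 + P.numStackClock

/-- Number of codes of rankings. -/
def numRank (P : Automaton) : ℕ := P.numPoints ^ P.numPoints

/-- Rank of a value. -/
def rank (P : Automaton) (ρ u : ℕ) : ℕ :=
  bif decide (u = 0) then 0 else digit P.numPoints ρ u

/-- Rank of a value, relative to the value of the copy of the last clock. -/
def rot (P : Automaton) (ρ u : ℕ) : ℕ :=
  bif decide (P.rank ρ (2 * P.numClock + 1) ≤ P.rank ρ u) then
    P.rank ρ u - P.rank ρ (2 * P.numClock + 1)
  else P.rank ρ u + P.numPoints - P.rank ρ (2 * P.numClock + 1)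

/-- Code of an intermediate location. -/
def midCode (P : Automaton) (j ρ : ℕ) : ℕ := P.numLoc + (ρ + P.numRank * j)

def rankTest (P : Automaton) (ρ : ℕ) : TransConstraint :=
  rankC (fun i => P.rank ρ (i + 1))
    ((List.range P.numClock).flatMap fun i => (List.range P.numClock).map fun j => (i, j))

def rankPop (P : Automaton) (ρ : ℕ) : StackConstraint :=
  rankC (fun c => c.elim (fun i => P.rank ρ (i + 1)) fun j => P.rank ρ (P.numClock + 1 + j))
    ((List.range (P.numClock + 1)).flatMap fun j =>
      ((List.range P.numClock).map fun i => (.inl i, .inr j)) ++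
      (List.range (P.numClock + 1)).map fun i => (.inr i, .inr j))

/-- The constraints of a push rule and of a pop rule hold for given ranks at the moment of the
pop. -/
def rankB (P : Automaton) (ρ : ℕ) (ψ ψ' : StackConstraint) : Bool :=
  ψ.eval (Atom.rankB fun c => c.elim (fun i => P.rot ρ (P.numClock + 1 + i))
    fun z => P.rot ρ (2 * P.numClock + 2 + z)) &&
  ψ'.eval (Atom.rankB fun c => c.elim (fun i => P.rank ρ (i + 1))
    fun z => P.rank ρ (2 * P.numClock + 2 + z))

def popRules (P : Automaton) (j γ : ℕ) (ψ' : StackConstraint) (r ρ i : ℕ) : List Rule :=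
  (P.rules[i]?).elim [] fun R => R.op.elim [] (fun _ => []) (fun _ => []) (fun _ => [])
    (fun γ' ψ => bif decide (γ' = γ) && P.rankB ρ ψ ψ' then
      [⟨P.midCode j ρ, .pop i (P.rankPop ρ), r⟩] else []) (fun _ _ => [])

def copyRules (P : Automaton) (j : ℕ) (R : Rule) : List Rule :=
  R.op.elim [R] (fun _ => [R]) (fun _ => [R]) (fun _ => [R])
    (fun _ _ => [⟨R.src, .reset [P.numClock], P.midCode j 0⟩,
      ⟨P.midCode j 0, .push j (copyConstraint (P.numClock + 1)), R.dst⟩])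
    (fun γ ψ' => (List.range P.numRank).flatMap fun ρ =>
      ⟨R.src, .test (P.rankTest ρ), P.midCode j ρ⟩ ::
        (List.range P.rules.length).flatMap (P.popRules j γ ψ' R.dst ρ))

/-- A push-copy automaton. The new clock is reset before each push, hence its copy shows the time
elapsed since the push. Stack clocks are guessed when the element is removed. -/
def toPushCopy (P : Automaton) : Automaton where
  numLoc := P.numLoc + P.numRank * P.rules.length
  numInput := P.numInput + 1
  numStackSym := P.rules.length
  numClock := P.numClock + 1
  numStackClock := P.numClock + 1
  rules := (List.range P.rules.length).flatMap fun j =>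
    (P.rules[j]?).elim [] (P.copyRules j)

section Primrec

variable {α : Type} [Primcodable α] {P : α → Automaton} {ρ u j γ r i : α → ℕ}

@[fun_prop] theorem primrec_copyConstraint (hu : Primrec u) :
    Primrec fun x => copyConstraint (u x) := by
  unfold copyConstraint; fun_prop

@[fun_prop] theorem primrec_numPoints (hP : Primrec P) : Primrec fun x => (P x).numPoints := by
  unfold numPoints; fun_prop

@[fun_prop] theorem primrec_numRank (hP : Primrec P) : Primrec fun x => (P x).numRank := by
  unfold numRank; fun_prop

@[fun_prop] theorem primrec_rank (hP : Primrec P) (hρ : Primrec ρ) (hu : Primrec u) :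
    Primrec fun x => (P x).rank (ρ x) (u x) := by
  unfold rank; fun_prop

@[fun_prop] theorem primrec_rot (hP : Primrec P) (hρ : Primrec ρ) (hu : Primrec u) :
    Primrec fun x => (P x).rot (ρ x) (u x) := by
  unfold rot; fun_prop

@[fun_prop] theorem primrec_midCode (hP : Primrec P) (hj : Primrec j) (hρ : Primrec ρ) :
    Primrec fun x => (P x).midCode (j x) (ρ x) := by
  unfold midCode; fun_prop

@[fun_prop] theorem primrec_rankTest (hP : Primrec P) (hρ : Primrec ρ) :
    Primrec fun x => (P x).rankTest (ρ x) := by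
  unfold rankTest; fun_prop

@[fun_prop] theorem primrec_rankPop (hP : Primrec P) (hρ : Primrec ρ) :
    Primrec fun x => (P x).rankPop (ρ x) := by
  unfold rankPop; fun_prop

@[fun_prop] theorem primrec_automaton_rankB {ψ ψ' : α → StackConstraint} (hP : Primrec P)
    (hρ : Primrec ρ) (hψ : Primrec ψ) (hψ' : Primrec ψ') :
    Primrec fun x => (P x).rankB (ρ x) (ψ x) (ψ' x) := by
  unfold rankB; fun_prop

@[fun_prop] theorem primrec_popRules {ψ' : α → StackConstraint} (hP : Primrec P) (hj : Primrec j)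
    (hγ : Primrec γ) (hψ' : Primrec ψ') (hr : Primrec r) (hρ : Primrec ρ) (hi : Primrec i) :
    Primrec fun x => (P x).popRules (j x) (γ x) (ψ' x) (r x) (ρ x) (i x) := by
  unfold popRules; fun_prop

@[fun_prop] theorem primrec_copyRules {R : α → Rule} (hP : Primrec P) (hj : Primrec j)
    (hR : Primrec R) : Primrec fun x => (P x).copyRules (j x) (R x) := by
  unfold copyRules; fun_prop

theorem primrec_toPushCopy : Primrec toPushCopy := by
  unfold toPushCopy; fun_prop

end Primrec

/-- The rules of `toPushCopy`. -/
inductive CopyRule (P : Automaton) : ℕ → Op → ℕ → Prop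
  | plain {l r : ℕ} {o : Op} (h : Rule.mk l o r ∈ P.rules) (h₁ : ∀ γ ψ, o ≠ .push γ ψ)
      (h₂ : ∀ γ ψ, o ≠ .pop γ ψ) : CopyRule P l o r
  | pushReset {l r j γ : ℕ} {ψ : StackConstraint} (h : P.rules[j]? = some ⟨l, .push γ ψ, r⟩) :
      CopyRule P l (.reset [P.numClock]) (P.midCode j 0)
  | pushCopy {l r j γ : ℕ} {ψ : StackConstraint} (h : P.rules[j]? = some ⟨l, .push γ ψ, r⟩) :
      CopyRule P (P.midCode j 0) (.push j (copyConstraint (P.numClock + 1))) r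
  | popTest {l r j γ ρ : ℕ} {ψ : StackConstraint} (h : P.rules[j]? = some ⟨l, .pop γ ψ, r⟩)
      (hρ : ρ < P.numRank) : CopyRule P l (.test (P.rankTest ρ)) (P.midCode j ρ)
  | popRank {l r l' r' i j γ ρ : ℕ} {ψ ψ' : StackConstraint}
      (h : P.rules[i]? = some ⟨l, .push γ ψ, r⟩) (h' : P.rules[j]? = some ⟨l', .pop γ ψ', r'⟩)
      (hρ : ρ < P.numRank) (hb : P.rankB ρ ψ ψ' = true) :
      CopyRule P (P.midCode j ρ) (.pop i (P.rankPop ρ)) r'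

variable {P : Automaton}

theorem mem_toPushCopy_rules {a b : ℕ} {o : Op} :
    Rule.mk a o b ∈ P.toPushCopy.rules ↔ CopyRule P a o b := by
  have lt_of_some : ∀ {j : ℕ} {R : Rule}, P.rules[j]? = some R → j < P.rules.length := fun h =>
    (List.getElem?_eq_some_iff.1 h).1
  constructor
  · intro h
    simp only [toPushCopy, List.mem_flatMap, List.mem_range] at h
    obtain ⟨j, hj, h⟩ := h
    rw [List.getElem?_eq_getElem hj] at h
    have hR := List.getElem?_eq_getElem hj
    have hm := List.getElem_mem hj
    generalize P.rules[j] = R at h hR hm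
    obtain ⟨l, o', r⟩ := R
    rw [Option.elim_some, copyRules] at h
    cases o' with
    | push γ ψ =>
      simp only [Op.elim, List.mem_cons, List.not_mem_nil, or_false, Rule.mk.injEq] at h
      obtain ⟨rfl, rfl, rfl⟩ | ⟨rfl, rfl, rfl⟩ := h
      · exact .pushReset hR
      · exact .pushCopy hR
    | pop γ ψ' =>
      simp only [Op.elim, List.mem_flatMap, List.mem_range, List.mem_cons, Rule.mk.injEq] at h
      obtain ⟨ρ, hρ, ⟨rfl, rfl, rfl⟩ | ⟨i, hi, h⟩⟩ := h
      · exact .popTest hR hρ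
      · rw [popRules, List.getElem?_eq_getElem hi] at h
        have hR' := List.getElem?_eq_getElem hi
        generalize P.rules[i] = R' at h hR'
        obtain ⟨l', o', r'⟩ := R'
        cases o' with
        | push γ' ψ =>
          simp only [Option.elim_some, Op.elim, mem_bif_nil, Bool.and_eq_true, decide_eq_true_eq,
            List.mem_singleton, Rule.mk.injEq] at h
          obtain ⟨⟨rfl, hb⟩, rfl, rfl, rfl⟩ := h
          exact .popRank hR' hR hρ hb
        | _ => simp [Op.elim] at h
    | _ =>
      simp only [Op.elim, List.mem_singleton, Rule.mk.injEq] at h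
      obtain ⟨rfl, rfl, rfl⟩ := h
      exact .plain hm (by simp) (by simp)
  · have key : ∀ {j : ℕ} {R : Rule}, P.rules[j]? = some R → Rule.mk a o b ∈ P.copyRules j R →
        Rule.mk a o b ∈ P.toPushCopy.rules := by
      intro j R hR h
      simp only [toPushCopy, List.mem_flatMap, List.mem_range]
      exact ⟨j, lt_of_some hR, by rwa [hR]⟩
    intro h
    cases h with
    | plain h h₁ h₂ =>
      obtain ⟨j, hj⟩ := List.getElem?_of_mem h
      refine key hj ?_
      cases o with
      | push γ ψ => exact absurd rfl (h₁ γ ψ)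
      | pop γ ψ => exact absurd rfl (h₂ γ ψ)
      | _ => simp [copyRules, Op.elim]
    | pushReset h => exact key h (by simp [copyRules, Op.elim])
    | pushCopy h => exact key h (by simp [copyRules, Op.elim])
    | @popTest _ _ _ _ ρ _ h hρ =>
      refine key h ?_
      simp only [copyRules, Op.elim, List.mem_flatMap, List.mem_range]
      exact ⟨ρ, hρ, List.mem_cons_self⟩
    | @popRank _ _ _ _ i _ _ ρ _ _ h h' hρ hb =>
      refine key h' ?_
      simp only [copyRules, Op.elim, List.mem_flatMap, List.mem_range, List.mem_cons]
      refine ⟨ρ, hρ, .inr ⟨i, lt_of_some h, ?_⟩⟩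
      simp [popRules, h, Op.elim, hb]

theorem numPoints_pos (P : Automaton) : 0 < P.numPoints := by unfold numPoints; omega

theorem numRank_pos (P : Automaton) : 0 < P.numRank := Nat.pow_pos P.numPoints_pos

theorem midCode_lt {j ρ : ℕ} {R : Rule} (h : P.rules[j]? = some R) (hρ : ρ < P.numRank) :
    P.midCode j ρ < P.toPushCopy.numLoc :=
  Nat.add_lt_add_left (add_mul_lt hρ (List.getElem?_eq_some_iff.1 h).1) _

theorem le_midCode (j ρ : ℕ) : P.numLoc ≤ P.midCode j ρ := Nat.le_add_right _ _

theorem midCode_inj {j ρ j' ρ' : ℕ} (h : P.midCode j ρ = P.midCode j' ρ') (hρ : ρ < P.numRank)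
    (hρ' : ρ' < P.numRank) : ρ = ρ' ∧ j = j' :=
  add_mul_inj hρ hρ' (Nat.add_left_cancel h)

theorem Valid.op_getElem? (hP : P.Valid) {l r j : ℕ} {o : Op}
    (h : P.rules[j]? = some ⟨l, o, r⟩) : l < P.numLoc ∧ r < P.numLoc ∧ P.OpValid o :=
  hP.op (List.mem_of_getElem? h)

theorem atom_copyConstraint {n : ℕ} {a : Atom (ℕ ⊕ ℕ)} (h : a ∈ (copyConstraint n).atoms) :
    ∃ x < n, (∀ c ∈ a.clocks, c = .inl x ∨ c = .inr x) ∧ .inr x ∈ a.clocks := by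
  simp only [copyConstraint, BoolComb.mem_atoms_conj, List.mem_map, List.mem_range] at h
  obtain ⟨_, ⟨x, hx, rfl⟩, h⟩ := h
  simp only [BoolComb.atoms, List.mem_append, List.mem_singleton] at h
  refine ⟨x, hx, ?_⟩
  rcases h with (rfl | rfl) | (rfl | rfl) <;> simp [Atom.clocks]

theorem atom_rankTest {ρ : ℕ} {a : Atom ℕ} (h : a ∈ (P.rankTest ρ).atoms) :
    a.IsFractional ∧ ∀ x ∈ a.clocks, x < P.numClock := by
  obtain ⟨hf, p, hp, h, -⟩ := mem_atoms_rankC h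
  simp only [List.mem_flatMap, List.mem_map, List.mem_range] at hp
  obtain ⟨i, hi, j, hj, rfl⟩ := hp
  exact ⟨hf, fun x hx => by rcases h x hx with rfl | rfl <;> assumption⟩

theorem atom_rankPop {ρ : ℕ} {a : Atom (ℕ ⊕ ℕ)} (h : a ∈ (P.rankPop ρ).atoms) :
    a.IsFractional ∧ (∀ c ∈ a.clocks, Sum.elim (· < P.numClock + 1) (· < P.numClock + 1) c) ∧
      ∃ z, Sum.inr z ∈ a.clocks := by
  obtain ⟨hf, p, hp, h, h'⟩ := mem_atoms_rankC h
  simp only [List.mem_flatMap, List.mem_append, List.mem_map, List.mem_range] at hp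
  obtain ⟨j, hj, ⟨i, hi, rfl⟩ | ⟨i, hi, rfl⟩⟩ := hp
  · refine ⟨hf, fun c hc => ?_, j, h'⟩
    rcases h c hc with rfl | rfl
    · exact Nat.lt_succ_of_lt hi
    · exact hj
  · refine ⟨hf, fun c hc => ?_, j, h'⟩
    rcases h c hc with rfl | rfl
    · exact hi
    · exact hj

theorem valid_toPushCopy (hP : P.Valid) : P.toPushCopy.Valid := by
  rintro ⟨a, o, b⟩ hR
  change a < P.numLoc + _ ∧ b < P.numLoc + _ ∧ OpValid _ o
  cases mem_toPushCopy_rules.1 hR with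
  | plain h h₁ h₂ =>
    obtain ⟨a1, a2, a3⟩ := hP.op h
    refine ⟨Nat.lt_add_right _ a1, Nat.lt_add_right _ a2, ?_⟩
    cases o with
    | push γ ψ => exact absurd rfl (h₁ γ ψ)
    | pop γ ψ => exact absurd rfl (h₂ γ ψ)
    | elapse => trivial
    | input a => exact fun b hb => Nat.lt_succ_of_lt (a3 b hb)
    | test φ => exact fun b hb x hx => Nat.lt_succ_of_lt (a3 b hb x hx)
    | reset Y => exact fun x hx => Nat.lt_succ_of_lt (a3 x hx)
  | pushReset h =>
    exact ⟨Nat.lt_add_right _ (hP.op_getElem? h).1, midCode_lt h P.numRank_pos,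
      by simp [OpValid, toPushCopy]⟩
  | pushCopy h =>
    refine ⟨midCode_lt h P.numRank_pos, Nat.lt_add_right _ (hP.op_getElem? h).2.1,
      (List.getElem?_eq_some_iff.1 h).1, fun a ha => ?_⟩
    obtain ⟨x, hx, h1, h2⟩ := atom_copyConstraint ha
    exact ⟨fun c hc => by rcases h1 c hc with rfl | rfl <;> exact hx, x, h2⟩
  | popTest h hρ =>
    exact ⟨Nat.lt_add_right _ (hP.op_getElem? h).1, midCode_lt h hρ,
      fun a ha x hx => Nat.lt_succ_of_lt ((atom_rankTest ha).2 x hx)⟩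
  | popRank h h' hρ hb =>
    exact ⟨midCode_lt h' hρ, Nat.lt_add_right _ (hP.op_getElem? h').2.1,
      (List.getElem?_eq_some_iff.1 h).1, fun a ha => (atom_rankPop ha).2⟩

theorem pushCopy_toPushCopy : P.toPushCopy.PushCopy := by
  refine ⟨rfl, fun l γ ψ r hR => ?_⟩
  cases mem_toPushCopy_rules.1 hR with
  | plain h h₁ h₂ => exact absurd rfl (h₁ γ ψ)
  | pushCopy h => rfl

theorem popIntegerFree_toPushCopy : P.toPushCopy.PopIntegerFree := by
  intro l γ ψ r hR
  cases mem_toPushCopy_rules.1 hR with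
  | plain h h₁ h₂ => exact absurd rfl (h₂ γ ψ)
  | popRank h h' hρ hb =>
    intro a ha
    have := (atom_rankPop ha).1
    cases a <;> simp_all [Atom.IsFractional, Atom.IsInteger]

end Automaton

end TPDA

/-! ## Push-copy automata: rankings of fractional parts -/

namespace TPDA

/-- The first `m` values are ordered like their ranks. -/
def Ranked (g : ℕ → ℕ) (f : ℕ → ℚ) (m : ℕ) : Prop :=
  ∀ u < m, ∀ v < m, g u ≤ g v ↔ f u ≤ f v

theorem Ranked.mono {g : ℕ → ℕ} {f : ℕ → ℚ} {m m' : ℕ} (h : Ranked g f m) (hm : m' ≤ m) :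
    Ranked g f m' := fun u hu v hv => h u (hu.trans_le hm) v (hv.trans_le hm)

theorem Ranked.congr {g : ℕ → ℕ} {f f' : ℕ → ℚ} {m : ℕ} (h : Ranked g f m)
    (e : ∀ u < m, f' u = f u) : Ranked g f' m := fun u hu v hv => by
  rw [e u hu, e v hv]; exact h u hu v hv

theorem Ranked.exists_value {g : ℕ → ℕ} {f : ℕ → ℚ} {m : ℕ} (h : Ranked g f m)
    (h1 : ∀ u < m, f u < 1) (a : ℕ) :
    ∃ c < 1, ∀ u < m, (g u ≤ a ↔ f u ≤ c) ∧ (a ≤ g u ↔ c ≤ f u) := by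
  by_cases ha : ∃ v < m, g v = a
  · obtain ⟨v, hv, rfl⟩ := ha
    exact ⟨f v, h1 v hv, fun u hu => ⟨h u hu v hv, h v hv u hu⟩⟩
  · obtain ⟨c, hc, hc'⟩ := Order.exists_between_finsets
      (((Finset.range m).filter fun u => g u < a).image f)
      (insert 1 (((Finset.range m).filter fun u => a < g u).image f)) (by
        simp only [Finset.mem_image, Finset.mem_filter, Finset.mem_range, Finset.mem_insert]
        rintro _ ⟨u, ⟨hu, hua⟩, rfl⟩ _ (rfl | ⟨v, ⟨hv, hva⟩, rfl⟩)
        · exact h1 u hu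
        · exact lt_of_not_ge fun hle => absurd ((h v hv u hu).2 hle) (by omega))
    simp only [Finset.mem_image, Finset.mem_filter, Finset.mem_range, Finset.mem_insert] at hc hc'
    refine ⟨c, hc' 1 (.inl rfl), fun u hu => ?_⟩
    have hne : g u ≠ a := fun e => ha ⟨u, hu, e⟩
    rcases lt_or_gt_of_ne hne with hlt | hgt
    · have := hc _ ⟨u, ⟨hu, hlt⟩, rfl⟩
      exact ⟨⟨fun _ => this.le, fun _ => hlt.le⟩, ⟨fun h => absurd h (by omega),
        fun h => absurd h (not_le.2 this)⟩⟩
    · have := hc' _ (.inr ⟨u, ⟨hu, hgt⟩, rfl⟩)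
      exact ⟨⟨fun h => absurd h (by omega), fun h => absurd h (not_le.2 this)⟩,
        ⟨fun _ => this.le, fun _ => hgt.le⟩⟩

theorem Ranked.exists_extension {g : ℕ → ℕ} {f : ℕ → ℚ} {m : ℕ} (h : Ranked g f m)
    (h1 : ∀ u < m, f u < 1) (k : ℕ) : ∃ f' : ℕ → ℚ, (∀ u < m, f' u = f u) ∧
      Ranked g f' (m + k) ∧ ∀ u < m + k, f' u < 1 := by
  induction k with
  | zero => exact ⟨f, fun _ _ => rfl, h, h1⟩
  | succ k ih =>
    obtain ⟨f', e, h', h1'⟩ := ih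
    obtain ⟨c, hc, hc'⟩ := h'.exists_value h1' (g (m + k))
    have lt : ∀ u < m + (k + 1), u < m + k ∨ u = m + k := fun u hu => by omega
    have e1 : ∀ u < m + k, Function.update f' (m + k) c u = f' u := fun u hu =>
      Function.update_of_ne hu.ne _ _
    refine ⟨Function.update f' (m + k) c, fun u hu => ?_, fun u hu v hv => ?_, fun u hu => ?_⟩
    · rw [e1 u (by omega), e u hu]
    · rcases lt u hu with hu | rfl <;> rcases lt v hv with hv | rfl
      · rw [e1 u hu, e1 v hv]; exact h' u hu v hv
      · rw [e1 u hu, Function.update_self]; exact (hc' u hu).1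
      · rw [e1 v hv, Function.update_self]; exact (hc' v hv).2
      · simp
    · rcases lt u hu with hu | rfl
      · rw [e1 u hu]; exact h1' u hu
      · rwa [Function.update_self]

theorem exists_ranked (f : ℕ → ℚ) (m : ℕ) : ∃ g : ℕ → ℕ, Ranked g f m ∧ (∀ u < m, g u < m) ∧
    ∀ u, (∀ v < m, f u ≤ f v) → g u = 0 := by
  set s := (Finset.range m).image f
  have hs : s.card ≤ m := Finset.card_image_le.trans (Finset.card_range m).le
  have mem : ∀ u < m, f u ∈ s := fun u hu => Finset.mem_image_of_mem f (Finset.mem_range.2 hu)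
  refine ⟨fun u => (s.filter (· < f u)).card, fun u hu v hv => ⟨fun h => ?_, fun h => ?_⟩,
    fun u hu => ?_, fun u hu => ?_⟩
  · by_contra hlt
    rw [not_le] at hlt
    refine absurd h (not_le.2 (Finset.card_lt_card ⟨fun x hx => ?_, fun hsub => ?_⟩))
    · rw [Finset.mem_filter] at hx ⊢
      exact ⟨hx.1, hx.2.trans hlt⟩
    · have := hsub (Finset.mem_filter.2 ⟨mem v hv, hlt⟩)
      exact lt_irrefl _ (Finset.mem_filter.1 this).2
  · refine Finset.card_le_card fun x hx => ?_
    rw [Finset.mem_filter] at hx ⊢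
    exact ⟨hx.1, hx.2.trans_le h⟩
  · refine (Finset.card_lt_card ⟨Finset.filter_subset _ _, fun hsub => ?_⟩).trans_le hs
    exact lt_irrefl _ (Finset.mem_filter.1 (hsub (mem u hu))).2
  · rw [Finset.card_eq_zero, Finset.filter_eq_empty_iff]
    intro x hx
    obtain ⟨v, hv, rfl⟩ := Finset.mem_image.1 hx
    exact not_lt.2 (hu v (Finset.mem_range.1 hv))

theorem fract_sub_eq {x d : ℚ} (hx : 0 ≤ x) (hx' : x < 1) (hd : 0 ≤ d) (hd' : d < 1) :
    Int.fract (x - d) = if d ≤ x then x - d else x - d + 1 := by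
  rw [Int.fract_eq_iff]
  split_ifs with h
  · exact ⟨by linarith, by linarith, 0, by simp⟩
  · exact ⟨by linarith, by linarith, -1, by push_cast; ring⟩

namespace Automaton

variable {P : Automaton}

/-- The values that are ranked: zero and the fractional parts of all clocks. -/
def pointVal {n k : ℕ} (w z : Val (n + 1)) (ζ : Val k) (u : ℕ) : ℚ :=
  if u = 0 then 0 else if u < n + 1 then Int.fract (w.get (u - 1) : ℚ)
  else if u < 2 * n + 2 then Int.fract (z.get (u - (n + 1)) : ℚ)
  else Int.fract (ζ.get (u - (2 * n + 2)) : ℚ)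

section Point

variable {n k : ℕ} (w z : Val (n + 1)) (ζ : Val k)

theorem pointVal_zero : pointVal w z ζ 0 = 0 := rfl

theorem pointVal_global {i : ℕ} (hi : i < n) :
    pointVal w z ζ (i + 1) = Int.fract (w.get i : ℚ) := by
  rw [pointVal, if_neg (by omega), if_pos (by omega), Nat.add_sub_cancel]

theorem pointVal_copy {j : ℕ} (hj : j < n + 1) :
    pointVal w z ζ (n + 1 + j) = Int.fract (z.get j : ℚ) := by
  rw [pointVal, if_neg (by omega), if_neg (by omega), if_pos (by omega), Nat.add_sub_cancel_left]

theorem pointVal_stack (j : ℕ) : pointVal w z ζ (2 * n + 2 + j) = Int.fract (ζ.get j : ℚ) := by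
  rw [pointVal, if_neg (by omega), if_neg (by omega), if_neg (by omega), Nat.add_sub_cancel_left]

theorem pointVal_nonneg (u : ℕ) : 0 ≤ pointVal w z ζ u := by
  unfold pointVal
  split_ifs
  exacts [le_rfl, Int.fract_nonneg _, Int.fract_nonneg _, Int.fract_nonneg _]

theorem pointVal_lt_one (u : ℕ) : pointVal w z ζ u < 1 := by
  unfold pointVal
  split_ifs
  exacts [one_pos, Int.fract_lt_one _, Int.fract_lt_one _, Int.fract_lt_one _]

end Point

theorem rank_zero (ρ : ℕ) : P.rank ρ 0 = 0 := rfl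

theorem rank_lt (P : Automaton) (ρ u : ℕ) : P.rank ρ u < P.numPoints := by
  unfold rank
  cases decide (u = 0)
  · exact digit_lt P.numPoints_pos _ _
  · exact P.numPoints_pos

theorem Ranked.rank_eq_zero {ρ m u : ℕ} {f : ℕ → ℚ} (h : Ranked (P.rank ρ) f m) (hu : u < m)
    (h0 : f 0 = 0) (hf : 0 ≤ f u) : P.rank ρ u = 0 ↔ f u = 0 := by
  have := h u hu 0 (by omega)
  rw [rank_zero, Nat.le_zero, h0] at this
  rw [this, le_antisymm_iff]
  exact ⟨fun h => ⟨h, hf⟩, fun h => h.1⟩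

theorem sat_rank {ρ : ℕ} {w z : Val (P.numClock + 1)} (ζ : Val P.numStackClock) :
    transSat w (P.rankTest ρ) ∧ stackSat w z (P.rankPop ρ) ↔
      Ranked (P.rank ρ) (pointVal w z ζ) (2 * P.numClock + 2) := by
  rw [transSat, stackSat, rankTest, rankPop, sat_rankC, sat_rankC]
  simp only [List.forall_mem_flatMap, List.forall_mem_append, List.forall_mem_map, List.mem_range,
    Sum.elim_inl, Sum.elim_inr]
  constructor
  · rintro ⟨h1, h2⟩
    have cs : ∀ u < 2 * P.numClock + 2, u = 0 ∨ (∃ i < P.numClock, u = i + 1) ∨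
        ∃ j < P.numClock + 1, u = P.numClock + 1 + j := by
      intro u hu
      by_cases h0 : u = 0
      · exact .inl h0
      · by_cases h : u < P.numClock + 1
        · exact .inr (.inl ⟨u - 1, by omega, by omega⟩)
        · exact .inr (.inr ⟨u - (P.numClock + 1), by omega, by omega⟩)
    have z1 : ∀ i < P.numClock, _ := fun i hi => (h1 i hi i hi).2.2
    have z2 : ∀ j < P.numClock + 1, _ := fun j hj => ((h2 j hj).2 j hj).2.2
    intro u hu v hv
    rcases cs u hu with rfl | ⟨i, hi, rfl⟩ | ⟨i, hi, rfl⟩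
    · exact ⟨fun _ => pointVal_nonneg w z ζ v, fun _ => Nat.zero_le _⟩
    · rcases cs v hv with rfl | ⟨j, hj, rfl⟩ | ⟨j, hj, rfl⟩
      · rw [rank_zero, Nat.le_zero, pointVal_zero, pointVal_global w z ζ hi, z1 i hi,
          le_antisymm_iff]
        exact ⟨fun h => h.1, fun h => ⟨h, Int.fract_nonneg _⟩⟩
      · rw [pointVal_global w z ζ hi, pointVal_global w z ζ hj]
        exact (h1 i hi j hj).1
      · rw [pointVal_global w z ζ hi, pointVal_copy w z ζ hj]
        exact ((h2 j hj).1 i hi).1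
    · rcases cs v hv with rfl | ⟨j, hj, rfl⟩ | ⟨j, hj, rfl⟩
      · rw [rank_zero, Nat.le_zero, pointVal_zero, pointVal_copy w z ζ hi, z2 i hi,
          le_antisymm_iff]
        exact ⟨fun h => h.1, fun h => ⟨h, Int.fract_nonneg _⟩⟩
      · rw [pointVal_copy w z ζ hi, pointVal_global w z ζ hj]
        exact ((h2 i hi).1 j hj).2.1
      · rw [pointVal_copy w z ζ hi, pointVal_copy w z ζ hj]
        exact ((h2 j hj).2 i hi).1
  · intro h
    refine ⟨fun i hi j hj => ?_, fun j hj => ⟨fun i hi => ?_, fun i hi => ?_⟩⟩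
    · rw [← pointVal_global w z ζ hi, ← pointVal_global w z ζ hj]
      exact ⟨h _ (by omega) _ (by omega), h _ (by omega) _ (by omega),
        Ranked.rank_eq_zero h (by omega) rfl (pointVal_nonneg ..)⟩
    · rw [← pointVal_global w z ζ hi, ← pointVal_copy w z ζ hj]
      exact ⟨h _ (by omega) _ (by omega), h _ (by omega) _ (by omega),
        Ranked.rank_eq_zero h (by omega) rfl (pointVal_nonneg ..)⟩
    · rw [← pointVal_copy w z ζ hi, ← pointVal_copy w z ζ hj]
      exact ⟨h _ (by omega) _ (by omega), h _ (by omega) _ (by omega),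
        Ranked.rank_eq_zero h (by omega) rfl (pointVal_nonneg ..)⟩

theorem rot_eq (ρ u : ℕ) : P.rot ρ u =
    if P.rank ρ (2 * P.numClock + 1) ≤ P.rank ρ u then
      P.rank ρ u - P.rank ρ (2 * P.numClock + 1)
    else P.rank ρ u + P.numPoints - P.rank ρ (2 * P.numClock + 1) := by
  rw [rot]
  split_ifs with h <;> simp [h]

theorem Ranked.rot {ρ m : ℕ} {f : ℕ → ℚ} (h : Ranked (P.rank ρ) f m)
    (hm : 2 * P.numClock + 1 < m) (h0 : ∀ u, 0 ≤ f u) (h1 : ∀ u < m, f u < 1) :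
    Ranked (P.rot ρ) (fun u => Int.fract (f u - f (2 * P.numClock + 1))) m ∧
      ∀ u < m, P.rot ρ u = 0 ↔ Int.fract (f u - f (2 * P.numClock + 1)) = 0 := by
  have key : ∀ u < m,
      (f (2 * P.numClock + 1) ≤ f u ∧ P.rank ρ (2 * P.numClock + 1) ≤ P.rank ρ u ∧
        P.rot ρ u = P.rank ρ u - P.rank ρ (2 * P.numClock + 1) ∧
        Int.fract (f u - f (2 * P.numClock + 1)) = f u - f (2 * P.numClock + 1)) ∨
      (f u < f (2 * P.numClock + 1) ∧ P.rank ρ u < P.rank ρ (2 * P.numClock + 1) ∧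
        P.rot ρ u = P.rank ρ u + P.numPoints - P.rank ρ (2 * P.numClock + 1) ∧
        Int.fract (f u - f (2 * P.numClock + 1)) = f u - f (2 * P.numClock + 1) + 1) := by
    intro u hu
    rw [fract_sub_eq (h0 _) (h1 u hu) (h0 _) (h1 _ hm), rot_eq]
    by_cases a : f (2 * P.numClock + 1) ≤ f u
    · have a' := (h _ hm u hu).2 a
      rw [if_pos a, if_pos a']
      exact .inl ⟨a, a', rfl, rfl⟩
    · have a' := (h _ hm u hu).not.2 a
      rw [if_neg a, if_neg a']
      exact .inr ⟨not_le.1 a, not_le.1 a', rfl, rfl⟩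
  have b := P.rank_lt ρ (2 * P.numClock + 1)
  refine ⟨fun u hu v hv => ?_, fun u hu => ?_⟩
  · have k := h u hu v hv
    have bu := P.rank_lt ρ u
    have bv := P.rank_lt ρ v
    have fu := h0 u
    have fv := h0 v
    have fu1 := h1 u hu
    have fv1 := h1 v hv
    rcases key u hu with ⟨a1, a2, a3, a4⟩ | ⟨a1, a2, a3, a4⟩ <;>
      rcases key v hv with ⟨b1, b2, b3, b4⟩ | ⟨b1, b2, b3, b4⟩ <;> simp only [a3, a4, b3, b4]
    · rw [sub_le_sub_iff_right, ← k]; omega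
    · exact iff_of_true (by omega) (by linarith)
    · exact iff_of_false (by omega) (by linarith)
    · rw [add_le_add_iff_right, sub_le_sub_iff_right, ← k]; omega
  · have fu := h0 u
    have fp := h1 _ hm
    rcases key u hu with ⟨a1, a2, a3, a4⟩ | ⟨a1, a2, a3, a4⟩ <;> rw [a3, a4]
    · rw [sub_eq_zero, show f u = f (2 * P.numClock + 1) ↔ f u ≤ f (2 * P.numClock + 1) from
        ⟨le_of_eq, fun h => le_antisymm h a1⟩, ← h u hu _ hm]
      omega
    · exact iff_of_false (by omega) (by linarith)

theorem exists_rank (P : Automaton) (f : ℕ → ℚ) (h0 : f 0 = 0) (hf : ∀ u, 0 ≤ f u) :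
    ∃ ρ < P.numRank, Ranked (P.rank ρ) f P.numPoints := by
  obtain ⟨g, h1, h2, h3⟩ := exists_ranked f P.numPoints
  obtain ⟨ρ, hρ, h⟩ := exists_digits P.numPoints g h2
  have e : ∀ u < P.numPoints, P.rank ρ u = g u := by
    intro u hu
    rw [rank]
    by_cases h' : u = 0
    · subst h'
      rw [h3 0 fun v _ => by rw [h0]; exact hf v]; rfl
    · rw [decide_eq_false h', cond_false, h u hu]
  exact ⟨ρ, hρ, fun u hu v hv => by rw [e u hu, e v hv]; exact h1 u hu v hv⟩

theorem fract_add_sub (x δ : ℚ) : Int.fract (Int.fract (x + δ) - Int.fract δ) = Int.fract x := by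
  rw [Int.fract_eq_fract]
  refine ⟨⌊δ⌋ - ⌊x + δ⌋, ?_⟩
  rw [Int.fract, Int.fract]
  push_cast
  ring

theorem fract_sub_add {c δ : ℚ} (h0 : 0 ≤ c) (h1 : c < 1) :
    Int.fract (Int.fract (c - δ) + δ) = c := by
  rw [Int.fract_eq_iff]
  exact ⟨h0, h1, -⌊c - δ⌋, by rw [Int.fract]; push_cast; ring⟩

section Pair

variable {ρ : ℕ} {ψ ψ' : StackConstraint} {w w' : Val (P.numClock + 1)} {δ : ℚ≥0}

/-- Validity of a fractional stack constraint. -/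
def StackFractional (P : Automaton) (ψ : StackConstraint) : Prop :=
  ∀ a ∈ ψ.atoms, a.IsFractional ∧ ∀ c ∈ a.clocks,
    Sum.elim (· < P.numClock) (· < P.numStackClock) c

theorem rankB_iff (hψ : P.StackFractional ψ) (hψ' : P.StackFractional ψ')
    (hw : w.get P.numClock = 0) {ζ : Val P.numStackClock}
    (h : Ranked (P.rank ρ) (pointVal w' (fun i => w i + δ) fun i => ζ i + δ) P.numPoints) :
    P.rankB ρ ψ ψ' = true ↔ stackSat w.init ζ ψ ∧ stackSat w'.init (fun i => ζ i + δ) ψ' := by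
  set f := pointVal w' (fun i => w i + δ) (fun i => ζ i + δ) with hf
  have hm : P.numPoints = 2 * P.numClock + 2 + P.numStackClock := rfl
  have f0 : ∀ u, 0 ≤ f u := pointVal_nonneg _ _ _
  have f1 : ∀ u < P.numPoints, f u < 1 := fun u _ => pointVal_lt_one _ _ _ u
  obtain ⟨r1, r2⟩ := Ranked.rot h (by omega) f0 f1
  have fp : f (2 * P.numClock + 1) = Int.fract (δ : ℚ) := by
    have e : 2 * P.numClock + 1 = P.numClock + 1 + P.numClock := by ring
    rw [e, hf, pointVal_copy _ _ _ (Nat.lt_succ_self _), get_last_add, hw, zero_add]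
  rw [fp] at r1 r2
  have key : ∀ c : ℕ ⊕ ℕ, Sum.elim (· < P.numClock) (· < P.numStackClock) c →
      ∃ u < P.numPoints, (c.elim (fun i => P.rot ρ (P.numClock + 1 + i))
        fun z => P.rot ρ (2 * P.numClock + 2 + z)) = P.rot ρ u ∧
      Int.fract ((Sum.elim w.init.get ζ.get c : ℚ≥0) : ℚ) = Int.fract (f u - Int.fract (δ : ℚ)) := by
    rintro (i | z) hc
    · refine ⟨P.numClock + 1 + i, by simp only [Sum.elim_inl] at hc; omega, rfl, ?_⟩
      rw [hf, pointVal_copy _ _ _ (Nat.lt_succ_of_lt hc), Val.get_add _ _ (Nat.lt_succ_of_lt hc),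
        Sum.elim_inl, Val.init_get _ hc]
      push_cast
      rw [fract_add_sub]
    · refine ⟨2 * P.numClock + 2 + z, by simp only [Sum.elim_inr] at hc; omega, rfl, ?_⟩
      rw [hf, pointVal_stack, Val.get_add _ _ hc, Sum.elim_inr]
      push_cast
      rw [fract_add_sub]
  have key' : ∀ c : ℕ ⊕ ℕ, Sum.elim (· < P.numClock) (· < P.numStackClock) c →
      ∃ u < P.numPoints, (c.elim (fun i => P.rank ρ (i + 1))
        fun z => P.rank ρ (2 * P.numClock + 2 + z)) = P.rank ρ u ∧
      Int.fract ((Sum.elim w'.init.get (Val.get (n := P.numStackClock) fun i => ζ i + δ) c : ℚ≥0) :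
        ℚ) = f u := by
    rintro (i | z) hc
    · refine ⟨i + 1, by simp only [Sum.elim_inl] at hc; omega, rfl, ?_⟩
      rw [hf, pointVal_global _ _ _ hc, Sum.elim_inl, Val.init_get _ hc]
    · exact ⟨2 * P.numClock + 2 + z, by simp only [Sum.elim_inr] at hc; omega, rfl, by
        rw [hf, pointVal_stack, Sum.elim_inr]⟩
  rw [rankB, Bool.and_eq_true, BoolComb.eval_iff, BoolComb.eval_iff, stackSat, stackSat]
  refine and_congr (BoolComb.sat_congr fun a ha => ?_) (BoolComb.sat_congr fun a ha => ?_)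
  · obtain ⟨ha1, ha2⟩ := hψ a ha
    refine Atom.rankB_iff ha1 (fun x hx => ?_) fun x hx y hy => ?_
    · obtain ⟨u, hu, e1, e2⟩ := key x (ha2 x hx)
      rw [e1, e2]; exact r2 u hu
    · obtain ⟨u, hu, e1, e2⟩ := key x (ha2 x hx)
      obtain ⟨v, hv, e3, e4⟩ := key y (ha2 y hy)
      rw [e1, e2, e3, e4]; exact r1 u hu v hv
  · obtain ⟨ha1, ha2⟩ := hψ' a ha
    refine Atom.rankB_iff ha1 (fun x hx => ?_) fun x hx y hy => ?_
    · obtain ⟨u, hu, e1, e2⟩ := key' x (ha2 x hx)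
      rw [e1, e2]; exact Ranked.rank_eq_zero h hu rfl (f0 u)
    · obtain ⟨u, hu, e1, e2⟩ := key' x (ha2 x hx)
      obtain ⟨v, hv, e3, e4⟩ := key' y (ha2 y hy)
      rw [e1, e2, e3, e4]; exact h u hu v hv

theorem exists_stack_of_rank (hψ : P.StackFractional ψ) (hψ' : P.StackFractional ψ')
    (hw : w.get P.numClock = 0) (h1 : transSat w' (P.rankTest ρ))
    (h2 : stackSat (n := P.numClock + 1) (k := P.numClock + 1) w' (fun i => w i + δ) (P.rankPop ρ))
    (hb : P.rankB ρ ψ ψ' = true) :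
    ∃ ζ : Val P.numStackClock, stackSat w.init ζ ψ ∧ stackSat w'.init (fun i => ζ i + δ) ψ' := by
  have hr := (sat_rank (fun _ => 0)).1 ⟨h1, h2⟩
  obtain ⟨f', e, r, l⟩ := hr.exists_extension (fun u _ => pointVal_lt_one _ _ _ u) P.numStackClock
  have nn : ∀ u < 2 * P.numClock + 2 + P.numStackClock, 0 ≤ f' u := by
    intro u hu
    have := (r 0 (by omega) u hu).1 (Nat.zero_le _)
    rwa [e 0 (by omega), pointVal_zero] at this
  refine ⟨fun i => ⟨Int.fract (f' (2 * P.numClock + 2 + i) - δ), Int.fract_nonneg _⟩,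
    (rankB_iff hψ hψ' hw (r.congr fun u hu => ?_)).1 hb⟩
  rcases lt_or_ge u (2 * P.numClock + 2) with hu' | hu'
  · rw [e u hu']
    simp only [pointVal, if_pos hu']
  · obtain ⟨j, rfl⟩ := Nat.exists_eq_add_of_le hu'
    rw [pointVal_stack, Val.get_of_lt _ (Nat.add_lt_add_iff_left.1 hu)]
    exact fract_sub_add (nn _ hu) (l _ hu)

theorem exists_rank_of_stack (hψ : P.StackFractional ψ) (hψ' : P.StackFractional ψ')
    (hw : w.get P.numClock = 0) {ζ : Val P.numStackClock} (h1 : stackSat w.init ζ ψ)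
    (h2 : stackSat w'.init (fun i => ζ i + δ) ψ') :
    ∃ ρ < P.numRank, transSat w' (P.rankTest ρ) ∧
      stackSat (n := P.numClock + 1) (k := P.numClock + 1) w' (fun i => w i + δ) (P.rankPop ρ) ∧
      P.rankB ρ ψ ψ' = true := by
  obtain ⟨ρ, hρ, h⟩ := P.exists_rank (pointVal w' (fun i => w i + δ) fun i => ζ i + δ) rfl
    (pointVal_nonneg _ _ _)
  obtain ⟨a1, a2⟩ := (sat_rank _).2 (h.mono (Nat.le_add_right _ _))
  exact ⟨ρ, hρ, a1, a2, (rankB_iff hψ hψ' hw h).2 ⟨h1, h2⟩⟩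

end Pair

end Automaton

end TPDA

/-! ## Push-copy automata: correctness -/

namespace TPDA

namespace Automaton

variable {P : Automaton}

theorem eq_of_floor_fract {p q : ℚ≥0} (h₁ : ⌊(p : ℚ)⌋ = ⌊(q : ℚ)⌋)
    (h₂ : Int.fract (p : ℚ) = Int.fract (q : ℚ)) : p = q := by
  have h3 := Int.floor_add_fract (p : ℚ)
  rw [h₁, h₂, Int.floor_add_fract] at h3
  exact_mod_cast h3.symm

theorem sat_copyConstraint {n : ℕ} {w z : Val n} : stackSat w z (copyConstraint n) ↔ z = w := by
  rw [stackSat, copyConstraint, BoolComb.sat_conj, List.forall_mem_map]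
  constructor
  · intro h
    refine Val.ext_get fun i hi => ?_
    have := h i (List.mem_range.2 hi)
    simp only [BoolComb.Sat, Atom.Sat, Sum.elim_inl, Sum.elim_inr] at this
    obtain ⟨⟨h1, h2⟩, h3, h4⟩ := this
    exact eq_of_floor_fract (by omega) (le_antisymm h3 h4)
  · rintro rfl i -
    simp [BoolComb.Sat, Atom.Sat]

theorem Fractional.stackFractional_push (hP : P.Valid) (hF : P.Fractional) {l r j γ : ℕ}
    {ψ : StackConstraint} (h : P.rules[j]? = some ⟨l, .push γ ψ, r⟩) : P.StackFractional ψ :=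
  fun a ha => ⟨hF.2.1 _ _ _ _ (List.mem_of_getElem? h) a ha, ((hP.op_getElem? h).2.2.2 a ha).1⟩

theorem Fractional.stackFractional_pop (hP : P.Valid) (hF : P.Fractional) {l r j γ : ℕ}
    {ψ : StackConstraint} (h : P.rules[j]? = some ⟨l, .pop γ ψ, r⟩) : P.StackFractional ψ :=
  fun a ha => ⟨hF.2.2 _ _ _ _ (List.mem_of_getElem? h) a ha, ((hP.op_getElem? h).2.2.2 a ha).1⟩

theorem transSat_init (hP : P.Valid) {l r : ℕ} {φ : TransConstraint}
    (h : Rule.mk l (.test φ) r ∈ P.rules) (w : Val (P.numClock + 1)) :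
    transSat w φ ↔ transSat w.init φ :=
  BoolComb.sat_congr fun a ha => Atom.sat_congr fun x hx =>
    (Val.init_get w ((hP.op h).2.2 a ha x hx)).symm

theorem init_reset_last {n : ℕ} (w : Val (n + 1)) :
    Val.init (fun x : Fin (n + 1) => if (x : ℕ) ∈ [n] then 0 else w x) = w.init := by
  funext i
  have : (i : ℕ) ≠ n := i.2.ne
  simp [Val.init, this]

/-- A location of `toPushCopy` represents a location of the given automaton. -/
inductive AtLoc (P : Automaton) : ℕ → ℕ → Val (P.numClock + 1) → Prop
  | main {l : ℕ} {w : Val (P.numClock + 1)} (h : l < P.numLoc) : AtLoc P l l w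
  | push {l r j γ : ℕ} {ψ : StackConstraint} {w : Val (P.numClock + 1)}
      (h : P.rules[j]? = some ⟨l, .push γ ψ, r⟩) (hw : w.get P.numClock = 0) :
      AtLoc P (P.midCode j 0) l w
  | pop {l r j γ ρ : ℕ} {ψ : StackConstraint} {w : Val (P.numClock + 1)}
      (h : P.rules[j]? = some ⟨l, .pop γ ψ, r⟩) (hρ : ρ < P.numRank)
      (hw : transSat w (P.rankTest ρ)) : AtLoc P (P.midCode j ρ) l w

theorem AtLoc.eq {c l : ℕ} {w : Val (P.numClock + 1)} (h : AtLoc P c l w) (hc : c < P.numLoc) :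
    l = c := by
  cases h with
  | main h => rfl
  | push h hw => exact absurd hc (not_lt.2 (le_midCode _ _))
  | pop h hρ hw => exact absurd hc (not_lt.2 (le_midCode _ _))

theorem AtLoc.midCode_push {l' l r j γ : ℕ} {ψ : StackConstraint} {w : Val (P.numClock + 1)}
    (h : AtLoc P (P.midCode j 0) l' w) (hj : P.rules[j]? = some ⟨l, .push γ ψ, r⟩) :
    l' = l ∧ w.get P.numClock = 0 := by
  generalize e : P.midCode j 0 = c at h
  cases h with
  | main h => exact absurd h (not_lt.2 (e ▸ le_midCode _ _))
  | push h hw =>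
    obtain ⟨-, rfl⟩ := midCode_inj e P.numRank_pos P.numRank_pos
    rw [hj, Option.some_inj] at h
    cases h
    exact ⟨rfl, hw⟩
  | pop h hρ hw =>
    obtain ⟨-, rfl⟩ := midCode_inj e P.numRank_pos hρ
    rw [hj, Option.some_inj] at h
    cases h

theorem AtLoc.midCode_pop {l' l r j γ ρ : ℕ} {ψ : StackConstraint} {w : Val (P.numClock + 1)}
    (h : AtLoc P (P.midCode j ρ) l' w) (hj : P.rules[j]? = some ⟨l, .pop γ ψ, r⟩)
    (hρ : ρ < P.numRank) : l' = l ∧ transSat w (P.rankTest ρ) := by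
  generalize e : P.midCode j ρ = c at h
  cases h with
  | main h => exact absurd h (not_lt.2 (e ▸ le_midCode _ _))
  | push h hw =>
    obtain ⟨-, rfl⟩ := midCode_inj e hρ P.numRank_pos
    rw [hj, Option.some_inj] at h
    cases h
  | pop h hρ' hw =>
    obtain ⟨rfl, rfl⟩ := midCode_inj e hρ hρ'
    rw [hj, Option.some_inj] at h
    cases h
    exact ⟨rfl, hw⟩

/-- Soundness of the simulation by `toPushCopy`. -/
theorem toPushCopy_sound (hP : P.Valid) (hF : P.Fractional) {c c' : ℕ}
    {w w' : Val P.toPushCopy.numClock} {π : ℕ → ℕ} {δ : ℚ≥0}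
    (h : Balanced P.toPushCopy c w π δ c' w') {l : ℕ} (hc : AtLoc P c l w) :
    ∃ r, AtLoc P c' r w' ∧ Balanced P l (Val.init (n := P.numClock) w) π δ r
      (Val.init (n := P.numClock) w') := by
  induction h generalizing l with
  | nil c w => exact ⟨l, hc, .nil _ _⟩
  | elapse δ h t ih =>
    cases mem_toPushCopy_rules.1 h with
    | plain h₀ h₁ h₂ =>
      obtain rfl := hc.eq (hP.op h₀).1
      obtain ⟨r, hr, b⟩ := ih (.main (hP.op h₀).2.1)
      exact ⟨r, hr, .elapse δ h₀ b⟩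
  | input h t ih =>
    cases mem_toPushCopy_rules.1 h with
    | plain h₀ h₁ h₂ =>
      obtain rfl := hc.eq (hP.op h₀).1
      obtain ⟨r, hr, b⟩ := ih (.main (hP.op h₀).2.1)
      exact ⟨r, hr, .input h₀ b⟩
  | test h hφ t ih =>
    cases mem_toPushCopy_rules.1 h with
    | plain h₀ h₁ h₂ =>
      obtain rfl := hc.eq (hP.op h₀).1
      obtain ⟨r, hr, b⟩ := ih (.main (hP.op h₀).2.1)
      exact ⟨r, hr, .test h₀ ((transSat_init hP h₀ _).1 hφ) b⟩
    | popTest h₀ hρ =>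
      obtain rfl := hc.eq (hP.op_getElem? h₀).1
      exact ih (.pop h₀ hρ hφ)
  | @reset _ _ _ w _ _ _ _ h t ih =>
    cases mem_toPushCopy_rules.1 h with
    | plain h₀ h₁ h₂ =>
      obtain rfl := hc.eq (hP.op h₀).1
      obtain ⟨r, hr, b⟩ := ih (.main (hP.op h₀).2.1)
      exact ⟨r, hr, .reset h₀ b⟩
    | pushReset h₀ =>
      obtain rfl := hc.eq (hP.op_getElem? h₀).1
      obtain ⟨r, hr, b⟩ := ih (.push h₀
        ((Val.get_reset (n := P.numClock + 1) w _ (Nat.lt_succ_self _)).trans (if_pos (by simp))))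
      refine ⟨r, hr, ?_⟩
      convert b using 1
      exact (init_reset_last (n := P.numClock) w).symm
  | pushPop z h₁ hψ _ h₂ hψ' _ ih₁ ih₂ =>
    cases mem_toPushCopy_rules.1 h₁ with
    | plain h₀ k₁ k₂ => exact absurd rfl (k₁ _ _)
    | pushCopy h₃ =>
      cases mem_toPushCopy_rules.1 h₂ with
      | plain h₀ k₁ k₂ => exact absurd rfl (k₂ _ _)
      | popRank h h' hρ hb =>
        rw [h₃, Option.some_inj] at h
        cases h
        obtain ⟨rfl, hw⟩ := hc.midCode_push h₃
        obtain ⟨r₁, hr₁, b₁⟩ := ih₁ (.main (hP.op_getElem? h₃).2.1)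
        obtain ⟨rfl, hw₁⟩ := hr₁.midCode_pop h' hρ
        obtain ⟨r, hr, b₂⟩ := ih₂ (.main (hP.op_getElem? h').2.1)
        obtain rfl := (sat_copyConstraint (n := P.numClock + 1)).1 hψ
        obtain ⟨ζ, hζ, hζ'⟩ := exists_stack_of_rank (hF.stackFractional_push hP h₃)
          (hF.stackFractional_pop hP h') hw hw₁ hψ' hb
        exact ⟨r, hr, .pushPop ζ (List.mem_of_getElem? h₃) hζ b₁ (List.mem_of_getElem? h') hζ' b₂⟩

/-- Completeness of the simulation by `toPushCopy`. -/
theorem toPushCopy_complete (hP : P.Valid) (hF : P.Fractional) {l r : ℕ} {μ ν : Val P.numClock}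
    {π : ℕ → ℕ} {δ : ℚ≥0} (h : Balanced P l μ π δ r ν) (T : ℚ≥0) :
    ∃ T', Balanced P.toPushCopy l (μ.snoc T) π δ r (ν.snoc T') := by
  induction h generalizing T with
  | nil l μ => exact ⟨T, .nil _ _⟩
  | @elapse _ _ _ μ _ _ _ δ h t ih =>
    obtain ⟨T', b⟩ := ih (T + δ)
    rw [Val.snoc_add] at b
    exact ⟨T', .elapse δ (mem_toPushCopy_rules.2 (.plain h (by simp) (by simp))) b⟩
  | input h t ih =>
    obtain ⟨T', b⟩ := ih T
    exact ⟨T', .input (mem_toPushCopy_rules.2 (.plain h (by simp) (by simp))) b⟩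
  | @test _ _ _ μ _ _ _ _ h hφ t ih =>
    obtain ⟨T', b⟩ := ih T
    refine ⟨T', .test (mem_toPushCopy_rules.2 (.plain h (by simp) (by simp))) ?_ b⟩
    exact (transSat_init hP h (μ.snoc T)).2 (by rwa [Val.init_snoc])
  | @reset _ _ _ μ _ _ _ _ h t ih =>
    obtain ⟨T', b⟩ := ih T
    rw [Val.snoc_reset μ T (hP.op h).2.2] at b
    exact ⟨T', .reset (mem_toPushCopy_rules.2 (.plain h (by simp) (by simp))) b⟩
  | @pushPop l l₁ r₁ l' r μ μ₁ ν π₁ π₂ δ₁ δ₂ γ ψ ψ' ζ h₁ hψ t₁ h₂ hψ' t₂ ih₁ ih₂ =>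
    obtain ⟨i, hi⟩ := List.getElem?_of_mem h₁
    obtain ⟨j, hj⟩ := List.getElem?_of_mem h₂
    obtain ⟨T₁, b₁⟩ := ih₁ 0
    obtain ⟨T', b₂⟩ := ih₂ T₁
    obtain ⟨ρ, hρ, h3, h4, h5⟩ := exists_rank_of_stack (w := μ.snoc 0) (w' := μ₁.snoc T₁)
      (hF.stackFractional_push hP hi) (hF.stackFractional_pop hP hj) (Val.snoc_get_last _ _)
      (ζ := ζ) (δ := δ₁) (by rwa [Val.init_snoc]) (by rwa [Val.init_snoc])
    have c₁ := b₁.trans (.test (mem_toPushCopy_rules.2 (.popTest hj hρ)) h3 (.nil _ _))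
    rw [add_zero, add_zero] at c₁
    have c₂ := Balanced.pushPop (μ.snoc 0 : Val (P.numClock + 1))
      (mem_toPushCopy_rules.2 (.pushCopy hi))
      ((sat_copyConstraint (n := P.numClock + 1)).2 rfl) c₁
      (mem_toPushCopy_rules.2 (.popRank hi hj hρ h5)) h4 b₂
    refine ⟨T', .reset (mem_toPushCopy_rules.2 (.pushReset hi)) ?_⟩
    have e : (fun x : Fin (P.numClock + 1) =>
        if (x : ℕ) ∈ [P.numClock] then 0 else μ.snoc T x) = μ.snoc 0 := by
      refine Val.ext_get fun x hx => ?_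
      rw [Val.get_reset (n := P.numClock + 1) (μ.snoc T) _ hx]
      rcases Nat.lt_succ_iff_lt_or_eq.1 hx with h | rfl
      · rw [Val.snoc_get _ _ h, Val.snoc_get _ _ h, if_neg (by simpa using h.ne)]
      · rw [if_pos (by simp), Val.snoc_get_last]
    exact Eq.mpr (congrArg (fun w => Balanced P.toPushCopy _ w _ _ _ _) e) c₂

theorem reach_toPushCopy_iff (hP : P.Valid) (hF : P.Fractional) {l r : ℕ} (hl : l < P.numLoc)
    (hr : r < P.numLoc) (μ : Val P.numClock) (π : Fin P.numInput → ℕ) (ν : Val P.numClock) :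
    P.Reach l r μ π ν ↔ ∃ e ∈ [(l, r, Formula.tru)], ∃ (p q : ℚ≥0) (t : ℕ),
      e.2.2.Sat (intEnv (μ.snoc p) (Fin.snoc (α := fun _ => ℕ) π t : Fin (P.numInput + 1) → ℕ)
        (ν.snoc q)) (ratEnv (μ.snoc p) (ν.snoc q)) ∧
      Reach P.toPushCopy e.1 e.2.1 (μ.snoc p)
        (Fin.snoc (α := fun _ => ℕ) π t : Fin (P.numInput + 1) → ℕ) (ν.snoc q) := by
  simp only [List.mem_singleton, exists_eq_left, Formula.sat_tru, true_and]
  rw [reach_iff]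
  constructor
  · rintro ⟨π', δ, h, e⟩
    obtain ⟨T', b⟩ := toPushCopy_complete hP hF h 0
    refine ⟨0, T', π' P.numInput, reach_iff.2 ⟨π', δ, b, fun a => ?_⟩⟩
    induction a using Fin.lastCases with
    | last => rw [Fin.snoc_last]; rfl
    | cast a => rw [Fin.snoc_castSucc, ← e a]; rfl
  · rintro ⟨p, q, t, h⟩
    obtain ⟨π', δ, h, e⟩ := reach_iff.1 h
    obtain ⟨r', hr', b⟩ := toPushCopy_sound hP hF h (.main hl)
    obtain rfl := hr'.eq hr
    rw [Val.init_snoc, Val.init_snoc] at b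
    exact ⟨π', δ, b, fun a => (e a.castSucc).trans (Fin.snoc_castSucc ..)⟩

theorem effectiveReduction_toPushCopy :
    EffectiveReduction Fractional (fun P => P.PushCopy ∧ P.PopIntegerFree) toPushCopy :=
  ⟨primrec_toPushCopy.to_comp, fun _ hP _ => ⟨valid_toPushCopy hP, pushCopy_toPushCopy,
      popIntegerFree_toPushCopy⟩,
    fun P => P.reduceFamily fun l r => [(l, r, Formula.tru)],
    computable_reduceFamily (L := fun _ l r => [(l, r, Formula.tru)]) (by fun_prop),
    fun P hP hF Φ hΦ => expresses_reduceFamily hΦ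
      (fun l hl r hr e he => by
        rw [List.mem_singleton] at he
        subst he
        exact ⟨Nat.lt_add_right _ hl, Nat.lt_add_right _ hr, Formula.scoped_tru⟩)
      fun l hl r hr μ π ν => reach_toPushCopy_iff hP hF hl hr μ π ν⟩

end Automaton

end TPDA

/-! ## The three transformations -/

namespace TPDA

namespace Atom

variable {C : Type}

/-- Whether an atom is not an integer one. -/
def nonInteger : Atom C → Bool
  | intLe _ _ => false
  | intDiffLe _ _ _ => false
  | _ => true

theorem nonInteger_iff {a : Atom C} : a.nonInteger = true ↔ ¬ a.IsInteger := by
  cases a <;> simp [nonInteger, IsInteger]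

@[fun_prop] theorem primrec_nonInteger {α : Type} [Primcodable α] [Denumerable C] {a : α → Atom C}
    (ha : Primrec a) : Primrec fun x => (a x).nonInteger := by
  refine primrec_casesOn (h := fun _ a => a.nonInteger) (g₁ := fun _ _ => false)
    (g₂ := fun _ _ => false) (g₃ := fun _ _ => true) (g₄ := fun _ _ => true)
    (g₅ := fun _ _ => true) (g₆ := fun _ _ => true) ha
    (by fun_prop) (by fun_prop) (by fun_prop) (by fun_prop) (by fun_prop) (by fun_prop) ?_
  rintro x (_ | _ | _ | _ | _ | _) <;> rfl

end Atom

namespace Automaton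

/-- Decision procedure for `PopIntegerFree`. -/
def popIntegerFreeB (P : Automaton) : Bool :=
  P.rules.all fun ρ => ρ.op.elim true (fun _ => true) (fun _ => true) (fun _ => true)
    (fun _ _ => true) (fun _ ψ => ψ.atoms.all Atom.nonInteger)

theorem popIntegerFreeB_iff {P : Automaton} : P.popIntegerFreeB = true ↔ P.PopIntegerFree := by
  rw [popIntegerFreeB, List.all_eq_true]
  constructor
  · intro h l γ ψ r hR a ha
    exact Atom.nonInteger_iff.1 (List.all_eq_true.1 (h _ hR) a ha)
  · rintro h ⟨l, o, r⟩ hR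
    cases o with
    | pop γ ψ => exact List.all_eq_true.2 fun a ha => Atom.nonInteger_iff.2 (h l γ ψ r hR a ha)
    | _ => rfl

@[fun_prop] theorem primrec_popIntegerFreeB {α : Type} [Primcodable α] {P : α → Automaton}
    (hP : Primrec P) : Primrec fun x => (P x).popIntegerFreeB := by
  unfold popIntegerFreeB; fun_prop

/-- A reduction needs to be applied only to automata outside the target class. -/
theorem EffectiveReduction.cond {A B : Automaton → Prop} {T : Automaton → Automaton}
    (h : EffectiveReduction A B T) {b : Automaton → Bool} (hb : Primrec b) {A' : Automaton → Prop}
    (h₁ : ∀ P, A' P → b P = true → B P) (h₂ : ∀ P, A' P → b P = false → A P) :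
    EffectiveReduction A' B fun P => bif b P then P else T P := by
  obtain ⟨hT, hv, F, hF, hE⟩ := h
  refine ⟨Computable.cond hb.to_comp Computable.id hT, fun P hP hA => ?_,
    fun P Φ => bif b P then Φ else F P Φ,
    Computable.cond (hb.to_comp.comp Computable.fst) Computable.snd hF, fun P hP hA Φ hΦ => ?_⟩
  · change (bif b P then P else T P).Valid ∧ B (bif b P then P else T P)
    cases h : b P with
    | true => exact ⟨hP, h₁ P hA h⟩
    | false => exact hv P hP (h₂ P hA h)
  · change (bif b P then P else T P).Expresses Φ at hΦ
    change P.Expresses (bif b P then Φ else F P Φ)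
    cases h : b P with
    | true => simpa [h] using hΦ
    | false => exact hE P hP (h₂ P hA h) Φ (by simpa [h] using hΦ)

theorem effectiveReduction_toPushCopy_toFractional :
    EffectiveReduction (fun _ => True) (fun P => P.PushCopy ∧ P.PopIntegerFree)
      fun P => P.toFractional.toPushCopy :=
  effectiveReduction_toFractional.comp effectiveReduction_toPushCopy fun _ h => h

/-- Elimination of integer atoms from pop constraints. -/
def elimPopInteger (P : Automaton) : Automaton :=
  bif P.popIntegerFreeB then P else P.toFractional.toPushCopy

theorem effectiveReduction_elimPopInteger :
    EffectiveReduction PushCopy (fun P => P.PushCopy ∧ P.PopIntegerFree) elimPopInteger :=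
  effectiveReduction_toPushCopy_toFractional.cond (b := popIntegerFreeB) (by fun_prop)
    (fun _ h h' => ⟨h, popIntegerFreeB_iff.1 h'⟩) fun _ _ _ => trivial

theorem elimPopInteger_of_popIntegerFree {P : Automaton} (h : P.PopIntegerFree) :
    P.elimPopInteger = P := by
  rw [elimPopInteger, popIntegerFreeB_iff.2 h]; rfl

end Automaton

end TPDA

/-! ## Size bounds -/

namespace TPDA

theorem BoolComb.size_le_of_mem_atoms {α : Type} {s : α → ℕ} {φ : BoolComb α} {a : α}
    (h : a ∈ φ.atoms) : s a ≤ φ.size s := by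
  induction φ with
  | tru => simp [atoms] at h
  | atom b => rw [List.mem_singleton.1 h]; rfl
  | not φ ih => exact (ih h).trans (Nat.le_succ _)
  | and φ ψ h₁ h₂ =>
    rw [size]
    rcases List.mem_append.1 h with h | h
    · have := h₁ h; omega
    · have := h₂ h; omega
  | or φ ψ h₁ h₂ =>
    rw [size]
    rcases List.mem_append.1 h with h | h
    · have := h₁ h; omega
    · have := h₂ h; omega

theorem Atom.param_lt {C : Type} (a : Atom C) : a.param < 2 ^ a.size := by
  rw [← Nat.size_le]
  cases a <;> simp only [param, size, Nat.size_zero] <;> omega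

theorem Atom.param_of_isFractional {C : Type} {a : Atom C} (h : a.IsFractional) :
    a.param = 0 := by
  cases a <;> first | rfl | exact h.elim

theorem Op.size_pos (o : Op) : 1 ≤ o.size := by
  cases o <;> simp only [size] <;> omega

theorem Op.params_lt {o : Op} {k : ℕ} (h : k ∈ o.params) : k < 2 ^ o.size := by
  have key : ∀ {C : Type} {φ : Constraint C}, k ∈ φ.atoms.map Atom.param →
      k < 2 ^ (1 + φ.size Atom.size) := by
    intro C φ h
    obtain ⟨a, ha, rfl⟩ := List.mem_map.1 h
    refine a.param_lt.trans_le (Nat.pow_le_pow_right two_pos ?_)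
    have := BoolComb.size_le_of_mem_atoms (s := Atom.size) ha
    omega
  cases o with
  | test φ => exact key h
  | push γ ψ => exact key h
  | pop γ ψ => exact key h
  | _ => simp [params, elim] at h

theorem length_flatMap_le {α β : Type} {l : List α} {f : α → List β} {k : ℕ}
    (h : ∀ x ∈ l, (f x).length ≤ k) : (l.flatMap f).length ≤ l.length * k := by
  induction l with
  | nil => simp
  | cons a l ih =>
    rw [List.forall_mem_cons] at h
    rw [List.flatMap_cons, List.length_append, List.length_cons, add_mul, one_mul, add_comm]
    exact add_le_add (ih h.2) h.1

theorem threshold_le (K M n : ℕ) : threshold K M n ≤ 2 ^ n * (K + M) := by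
  suffices threshold K M n + M ≤ 2 ^ n * (K + M) by omega
  induction n with
  | zero => simp [threshold]
  | succ n ih =>
    rw [threshold, pow_succ, mul_right_comm]
    omega

section DoubleExp

variable {x y a b : ℕ}

theorem le_dexp_mono (hx : x ≤ 2 ^ 2 ^ a) (h : a ≤ b) : x ≤ 2 ^ 2 ^ b :=
  hx.trans (Nat.pow_le_pow_right two_pos (Nat.pow_le_pow_right two_pos h))

theorem le_dexp_of_le_exp (hx : x ≤ 2 ^ a) : x ≤ 2 ^ 2 ^ a :=
  hx.trans (Nat.pow_le_pow_right two_pos Nat.lt_two_pow_self.le)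

theorem le_dexp_of_le (hx : x ≤ a) : x ≤ 2 ^ 2 ^ a :=
  le_dexp_of_le_exp (hx.trans Nat.lt_two_pow_self.le)

theorem mul_le_dexp (hx : x ≤ 2 ^ 2 ^ a) (hy : y ≤ 2 ^ 2 ^ a) : x * y ≤ 2 ^ 2 ^ (a + 1) := by
  rw [pow_succ, pow_mul, sq]
  exact Nat.mul_le_mul hx hy

theorem add_le_dexp (hx : x ≤ 2 ^ 2 ^ a) (hy : y ≤ 2 ^ 2 ^ a) : x + y ≤ 2 ^ 2 ^ (a + 1) := by
  have h2 : 2 ≤ 2 ^ 2 ^ a := Nat.le_self_pow (Nat.pow_pos two_pos).ne' 2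
  calc x + y ≤ 2 * 2 ^ 2 ^ a := by omega
    _ ≤ 2 ^ 2 ^ (a + 1) := mul_le_dexp h2 le_rfl

theorem pow_le_dexp (hx : x ≤ 2 ^ 2 ^ a) (hy : y ≤ 2 ^ b) : x ^ y ≤ 2 ^ 2 ^ (a + b) := by
  rw [pow_add, pow_mul]
  exact (Nat.pow_le_pow_left hx y).trans
    (Nat.pow_le_pow_right (Nat.pow_pos two_pos) hy)

end DoubleExp

namespace Automaton

variable {P : Automaton}

theorem maxParam_le {B : ℕ} (h : ∀ l o r, Rule.mk l o r ∈ P.rules → ∀ k ∈ o.params, k ≤ B) :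
    P.maxParam ≤ B := by
  have key : ∀ l : List ℕ, (∀ k ∈ l, k ≤ B) → l.foldr max 0 ≤ B := by
    intro l hl
    induction l with
    | nil => exact Nat.zero_le _
    | cons a l ih =>
      rw [List.forall_mem_cons] at hl
      exact max_le hl.1 (ih hl.2)
  refine key _ fun k hk => ?_
  obtain ⟨⟨l, o, r⟩, hR, hk⟩ := List.mem_flatMap.1 hk
  exact h l o r hR k hk

theorem sum_opSize_le_size (P : Automaton) : (P.rules.map fun ρ => ρ.op.size).sum ≤ P.size :=
  Nat.le_add_left _ _

theorem length_rules_le_size (P : Automaton) : P.rules.length ≤ P.size := by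
  refine le_trans ?_ P.sum_opSize_le_size
  induction P.rules with
  | nil => simp
  | cons ρ l ih =>
    have := ρ.op.size_pos
    simp only [List.length_cons, List.map_cons, List.sum_cons]
    omega

theorem maxParam_le_size (P : Automaton) : P.maxParam ≤ 2 ^ P.size := by
  refine maxParam_le fun l o r hR k hk => (Op.params_lt hk).le.trans ?_
  refine Nat.pow_le_pow_right two_pos (le_trans ?_ P.sum_opSize_le_size)
  exact List.le_sum_of_mem (List.mem_map.2 ⟨_, hR, rfl⟩)

theorem maxParam_toPushCopy (hF : P.Fractional) : P.toPushCopy.maxParam = 0 := by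
  have key : ∀ {C : Type} {φ : Constraint C}, (∀ a ∈ φ.atoms, a.param = 0) →
      ∀ k ∈ φ.atoms.map Atom.param, k ≤ 0 := by
    intro C φ h k hk
    obtain ⟨a, ha, rfl⟩ := List.mem_map.1 hk
    exact (h a ha).le
  refine Nat.le_zero.1 (maxParam_le fun l o r hR => ?_)
  cases mem_toPushCopy_rules.1 hR with
  | plain h h₁ h₂ =>
    cases o with
    | push γ ψ => exact absurd rfl (h₁ γ ψ)
    | pop γ ψ => exact absurd rfl (h₂ γ ψ)
    | test φ => exact key fun a ha => Atom.param_of_isFractional (hF.1 _ _ _ h a ha)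
    | _ => simp [Op.params, Op.elim]
  | pushReset h => simp [Op.params, Op.elim]
  | pushCopy h =>
    refine key fun a ha => ?_
    simp only [copyConstraint, BoolComb.mem_atoms_conj, List.mem_map, List.mem_range] at ha
    obtain ⟨_, ⟨x, hx, rfl⟩, ha⟩ := ha
    simp only [BoolComb.atoms, List.mem_append, List.mem_singleton] at ha
    rcases ha with (rfl | rfl) | (rfl | rfl) <;> rfl
  | popTest h hρ => exact key fun a ha => Atom.param_of_isFractional (atom_rankTest ha).1
  | popRank h h' hρ hb => exact key fun a ha => Atom.param_of_isFractional (atom_rankPop ha).1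

/-- All parameters that determine the size of `toFractional` are bounded in terms of `a`. -/
structure Bounded (P : Automaton) (a : ℕ) : Prop where
  numLoc : P.numLoc ≤ 2 ^ 2 ^ a
  numStackSym : P.numStackSym ≤ 2 ^ 2 ^ a
  numClock : P.numClock ≤ a
  numStackClock : P.numStackClock ≤ a
  thr : P.thr ≤ 2 ^ 2 ^ a
  modulus : P.modulus ≤ 2 ^ 2 ^ a

namespace Bounded

variable {a : ℕ}

theorem two_pow_mul_add_le (h : P.Bounded a) {n x b : ℕ} (hn : n ≤ a) (hab : a ≤ b)
    (hx : x ≤ 2 ^ 2 ^ b) : 2 ^ n * (x + P.modulus) ≤ 2 ^ 2 ^ (b + 2) :=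
  mul_le_dexp (le_dexp_of_le_exp (Nat.pow_le_pow_right two_pos (by omega)))
    (add_le_dexp hx (le_dexp_mono h.modulus hab))

theorem bigThr (h : P.Bounded a) : P.bigThr ≤ 2 ^ 2 ^ (a + 2) :=
  (threshold_le _ _ _).trans (h.two_pow_mul_add_le h.numStackClock le_rfl h.thr)

theorem base (h : P.Bounded a) : P.base ≤ 2 ^ 2 ^ (a + 8) := by
  have h1 : threshold P.bigThr P.modulus P.numClock ≤ 2 ^ 2 ^ (a + 4) :=
    (threshold_le _ _ _).trans (h.two_pow_mul_add_le h.numClock (by omega) h.bigThr)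
  refine add_le_dexp (add_le_dexp (add_le_dexp (mul_le_dexp (le_dexp_of_le ?_) h1) ?_) ?_) ?_
  · have := h.numClock; omega
  · exact le_dexp_mono h.thr (by omega)
  · exact le_dexp_mono h.modulus (by omega)
  · exact le_dexp_of_le (by omega)

theorem numAbs (h : P.Bounded a) : P.numAbs ≤ 2 ^ 2 ^ (2 * a + 9) := by
  have h1 : 2 * P.numClock + 1 ≤ 2 ^ (a + 1) := by
    have := h.numClock
    have : a < 2 ^ a := Nat.lt_two_pow_self
    rw [pow_succ]; omega
  exact le_dexp_mono (pow_le_dexp h.base h1) (by omega)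

theorem numStackAbs (h : P.Bounded a) : P.numStackAbs ≤ 2 ^ 2 ^ (2 * a + 9) := by
  have h1 : P.stackBase ≤ 2 ^ 2 ^ (a + 9) := by
    refine add_le_dexp h.base (le_dexp_mono (mul_le_dexp (le_dexp_of_le ?_) h.bigThr) (by omega))
    have := h.numStackClock; omega
  exact le_dexp_mono (pow_le_dexp h1 (h.numStackClock.trans Nat.lt_two_pow_self.le)) (by omega)

theorem numLoc_toFractional (h : P.Bounded a) :
    P.toFractional.numLoc ≤ 2 ^ 2 ^ (2 * a + 11) :=
  mul_le_dexp (le_dexp_mono h.numLoc (by omega))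
    (mul_le_dexp (le_dexp_of_le (by omega)) h.numAbs)

theorem numStackSym_toFractional (h : P.Bounded a) :
    P.toFractional.numStackSym ≤ 2 ^ 2 ^ (2 * a + 11) :=
  mul_le_dexp (le_dexp_mono h.numStackSym (by omega)) (mul_le_dexp h.numAbs h.numStackAbs)

theorem length_opRules (h : P.Bounded a) (s s' : ℕ) (ρ : Rule) :
    (P.opRules s s' ρ).length ≤ 2 ^ 2 ^ (2 * a + 10) := by
  have key : ∀ (b : Bool) (R : Rule), (bif b then [R] else []).length ≤ 2 ^ 2 ^ (2 * a + 10) :=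
    fun b R => le_trans (by cases b <;> simp) (le_dexp_of_le (x := 1) (by omega))
  have key' : ∀ (b : Bool) (f : ℕ → Rule),
      (bif b then (List.range P.numStackAbs).map f else []).length ≤ P.numStackAbs :=
    fun b f => by cases b <;> simp
  obtain ⟨l, o, r⟩ := ρ
  cases o with
  | push γ ψ => exact (key' _ _).trans (le_dexp_mono h.numStackAbs (by omega))
  | pop γ ψ =>
    refine (length_flatMap_le fun t _ => key' _ _).trans ?_
    rw [List.length_range]
    exact mul_le_dexp h.numAbs h.numStackAbs
  | _ => exact key _ _

theorem length_phaseRules (P : Automaton) (s s' l : ℕ) : (P.phaseRules s s' l).length ≤ 6 := by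
  rw [phaseRules]
  cases decide (s = s') <;> cases P.tickB s s' <;> simp

theorem length_rules_toFractional (h : P.Bounded a) (hr : P.rules.length ≤ 2 ^ 2 ^ a) :
    P.toFractional.rules.length ≤ 2 ^ 2 ^ (2 * a + 14) := by
  have h1 : ∀ s s', (P.rules.flatMap (P.opRules s s') ++
      (List.range P.numLoc).flatMap (P.phaseRules s s')).length ≤ 2 ^ 2 ^ (2 * a + 12) := by
    intro s s'
    rw [List.length_append]
    refine add_le_dexp ((length_flatMap_le fun ρ _ => h.length_opRules s s' ρ).trans ?_)
      ((length_flatMap_le fun l _ => length_phaseRules P s s' l).trans ?_)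
    · exact mul_le_dexp (le_dexp_mono hr (by omega)) le_rfl
    · rw [List.length_range]
      exact mul_le_dexp (le_dexp_mono h.numLoc (by omega)) (le_dexp_of_le (by omega))
  refine (length_flatMap_le fun s _ => length_flatMap_le fun s' _ => h1 s s').trans ?_
  rw [List.length_range]
  exact mul_le_dexp (le_dexp_mono h.numAbs (by omega))
    (mul_le_dexp (le_dexp_mono h.numAbs (by omega)) le_rfl)

end Bounded

theorem bounded_size (P : Automaton) : P.Bounded (2 * P.size + 1) where
  numLoc := le_dexp_of_le (by rw [size]; omega)
  numStackSym := le_dexp_of_le (by rw [size]; omega)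
  numClock := by rw [size]; omega
  numStackClock := by rw [size]; omega
  thr := by
    refine le_dexp_of_le_exp ((Nat.succ_le_succ P.maxParam_le_size).trans ?_)
    calc 2 ^ P.size + 1 ≤ 2 ^ P.size + 2 ^ P.size := Nat.add_le_add_left Nat.one_le_two_pow _
      _ = 2 ^ (P.size + 1) := by rw [pow_succ]; ring
      _ ≤ _ := Nat.pow_le_pow_right two_pos (by omega)
  modulus := by
    calc P.maxParam.factorial ≤ (2 ^ P.size).factorial := Nat.factorial_le P.maxParam_le_size
      _ ≤ (2 ^ P.size) ^ 2 ^ P.size := Nat.factorial_le_pow _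
      _ ≤ 2 ^ 2 ^ (P.size + P.size) :=
        pow_le_dexp (Nat.pow_le_pow_right two_pos Nat.lt_two_pow_self.le) le_rfl
      _ ≤ _ := le_dexp_mono le_rfl (by omega)

theorem bounded_toPushCopy_toFractional (hP : P.Valid) :
    P.toFractional.toPushCopy.Bounded (6 * P.size + 18) := by
  have h := P.bounded_size
  have e1 : P.numClock ≤ P.size := by rw [size]; omega
  have e2 : P.numStackClock ≤ P.size := by rw [size]; omega
  have hr : P.toFractional.rules.length ≤ 2 ^ 2 ^ (6 * P.size + 16) :=
    le_dexp_mono (h.length_rules_toFractional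
      (le_dexp_of_le (by have := P.length_rules_le_size; omega))) (by omega)
  have hm := maxParam_toPushCopy (fractional_toFractional hP)
  have hp : P.toFractional.numPoints ≤ 3 * P.size + 5 := by
    change 2 * (P.numClock + 1) + 2 + (P.numStackClock + 1) ≤ _
    omega
  have hk : P.toFractional.numRank ≤ 2 ^ 2 ^ (6 * P.size + 16) :=
    le_dexp_mono (pow_le_dexp (le_dexp_of_le hp) (hp.trans Nat.lt_two_pow_self.le)) (by omega)
  exact {
    numLoc := add_le_dexp (le_dexp_mono h.numLoc_toFractional (by omega)) (mul_le_dexp hk hr)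
    numStackSym := le_dexp_mono hr (by omega)
    numClock := by change P.numClock + 1 + 1 ≤ _; omega
    numStackClock := by change P.numClock + 1 + 1 ≤ _; omega
    thr := by rw [thr, hm]; exact le_dexp_of_le (by omega)
    modulus := by rw [modulus, hm]; exact le_dexp_of_le (by simp) }

end Automaton

end TPDA

theorem mainTheorem3 :
    ∃ T₁ T₂ T₃ : TPDA.Automaton → TPDA.Automaton,
      TPDA.Automaton.EffectiveReduction (fun _ => True) TPDA.Automaton.PushCopy T₁ ∧
      TPDA.Automaton.EffectiveReduction TPDA.Automaton.PushCopy
        (fun P => P.PushCopy ∧ P.PopIntegerFree) T₂ ∧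
      TPDA.Automaton.EffectiveReduction (fun P => P.PushCopy ∧ P.PopIntegerFree)
        TPDA.Automaton.Fractional T₃ ∧
      TPDA.Automaton.EffectiveReduction (fun _ => True) TPDA.Automaton.Fractional
        (fun P => T₃ (T₂ (T₁ P))) ∧
      ∃ p : Polynomial ℕ, ∀ P : TPDA.Automaton, P.Valid →
        (T₃ (T₂ (T₁ P))).numLoc ≤ 2 ^ 2 ^ p.eval P.size ∧
        (T₃ (T₂ (T₁ P))).numStackSym ≤ 2 ^ 2 ^ p.eval P.size ∧
        (T₃ (T₂ (T₁ P))).numClock + (T₃ (T₂ (T₁ P))).numStackClock ≤ 2 ^ p.eval P.size := by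
  have h₁ := TPDA.Automaton.effectiveReduction_toPushCopy_toFractional.mono (fun _ h => h)
    fun _ (h : _ ∧ _) => h.1
  have h₂ := TPDA.Automaton.effectiveReduction_elimPopInteger
  have h₃ := TPDA.Automaton.effectiveReduction_toFractional.mono
    (A' := fun P => P.PushCopy ∧ P.PopIntegerFree) (fun _ _ => trivial) fun _ h => h
  refine ⟨_, _, _, h₁, h₂, h₃, (h₁.comp h₂ fun _ h => h).comp h₃ fun _ h => h,
    .C 12 * .X + .C 47, fun P hP => ?_⟩
  have hb := TPDA.Automaton.bounded_toPushCopy_toFractional hP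
  have e : (Polynomial.C 12 * Polynomial.X + Polynomial.C 47 : Polynomial ℕ).eval P.size =
      2 * (6 * P.size + 18) + 11 := by
    simp only [Polynomial.eval_add, Polynomial.eval_mul, Polynomial.eval_C, Polynomial.eval_X]
    ring
  rw [TPDA.Automaton.elimPopInteger_of_popIntegerFree
    TPDA.Automaton.popIntegerFree_toPushCopy, e]
  refine ⟨hb.numLoc_toFractional, hb.numStackSym_toFractional, ?_⟩
  have h1 := hb.numClock
  have h2 := hb.numStackClock
  refine le_trans ?_ Nat.lt_two_pow_self.le
  change TPDA.Automaton.numClock _ + 1 + (TPDA.Automaton.numStackClock _ + 1) ≤ _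
  omega
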